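/- Let $\alpha$ be irrational with $0<\alpha<\tfrac12$ and put $M(\alpha,\gamma):=\liminf_{|n|\to\infty}|n|\,\|n\alpha-\gamma\|$ ($n\in\mathbb Z$), where $\|x\|$ is the distance from $x$ to the nearest integer. Let $$\alpha=\cfrac{\varepsilon_1}{a_1+\cfrac{\varepsilon_2}{a_2+\cfrac{\varepsilon_3}{a_3+\cdots}}},\qquad \varepsilon_1=1,\ \varepsilon_i=\pm1,$$ be the nearest integer continued fraction expansion of $\alpha$, generated by $\alpha_0:=\alpha$ and, for $i\ge 0$, $\alpha_{i+1}:=\|\alpha_i^{-1}\|$, with $a_{i+1}$ the integer nearest to $\alpha_i^{-1}$ and $\varepsilon_{i+2}=1$ or $-1$ according as $\alpha_i^{-1}$ is rounded down or up. Let $p_i/q_i$ be its convergents ($p_0/q_0=0/1$), $D_i:=|q_i\alpha-p_i|$, and $$\gamma_*=\gamma_*(\alpha):=\sum_{i=1}^\infty \tfrac12\,(a_i-1+\varepsilon_i+\lambda_i)\,D_{i-1},$$ where $\lambda_i=0$ if $a_i$ is even and $\lambda_i=(-1)^j$ if $a_i$ is the $j$-th odd term of the sequence $a_1,a_2,\dots$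 (the series converges). Suppose that $R:=\liminf_{i\to\infty}a_i$ is finite. Let $R_*$ be the odd and $R_{**}$ the even one of the integers $R,R+1$, and put $$\theta_1:=\tfrac12\Big(\sqrt{R_*^2+4}-R_*\Big),\qquad \theta_2:=\begin{cases}\tfrac12\Big(R_{**}-\sqrt{R_{**}^2-4}\Big),& R\ge3,\\ \tfrac12,& R=2.\end{cases}$$ **Theorem 4.** One has $$M(\alpha,\gamma_*)\ \ge\ M_1:=\frac14\cdot\frac{\left(1-\frac{2}{R_*-\theta_2}\right)\left(1-\frac{1}{\max\{4,R_{**}\}}\left(1+\frac{\theta_1^2}{1-\theta_1}\right)\right)}{1+\frac{1}{\max\{4,R_{**}\}}\left(\theta_1-\frac{1}{R_*-\theta_2}\right)} .$$ The bound is best possible in the following sense. For a finite list $s$ of integers let $(s,)^k$ denote its $k$-fold repetition. If $R\ge3$, then for every $k\ge0$ there is an $\alpha$ whose sequence $(\varepsilon_ia_i)_{i\ge1}$ is periodic with period $$(R_*,)^k\,R_{**},\,-R_*,\,(-R_{**},)^k,$$ and for any choice, for each $k$, of an $\alpha$ whose sequence $(\varepsilon_ia_i)$ is periodic (or just eventually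 periodic) with this period, $M(\alpha,\gamma_*)\to M_1$ as $k\to\infty$. If $R=2$, the same holds with the periods $$(3,)^k\,4,\,-3,\,-2,\,A\qquad(k\ge0,\ A\ge2),$$ and then $M(\alpha,\gamma_*)\to M_1$ as $k$ and $A$ tend to infinity. -/

import Mathlib

noncomputable section

namespace NICF

open Filter Topology

/-- Distance from `x` to the nearest integer. -/
def distInt (x : ℝ) : ℝ := |x - round x|

/-- The two-sided inhomogeneous approximation constant `liminf_{|n| → ∞} |n| ‖n α - γ‖`, as an
extended real number (so that no boundedness convention enters). -/
def approxConst (α γ : ℝ) : EReal :=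
  liminf (fun n : ℤ => ((|(n : ℝ)| * distInt (n * α - γ) : ℝ) : EReal)) cofinite

/-- The tails `α_i` of the nearest integer algorithm: `α_0 = α`, `α_{i+1} = ‖α_i⁻¹‖`. -/
def tail (α : ℝ) : ℕ → ℝ
  | 0 => α
  | i + 1 => distInt (tail α i)⁻¹

/-- The partial quotients `a_i` of the nearest integer expansion, with `a_0 = 0`:
`α_i⁻¹` is rounded to the nearest integer. -/
def quot (α : ℝ) : ℕ → ℕ
  | 0 => 0
  | i + 1 =>
    if distInt (tail α i)⁻¹ = Int.fract (tail α i)⁻¹ then ⌊(tail α i)⁻¹⌋₊ else ⌈(tail α i)⁻¹⌉₊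

/-- The signs `ε_i` of the nearest integer expansion, with `ε_1 = 1`; `ε_{i+2}` is `1` if `α_i⁻¹`
is rounded down and `-1` if it is rounded up. (There is no `ε_0`; the value is never used.) -/
def sgn (α : ℝ) : ℕ → ℤ
  | 0 => 1
  | 1 => 1
  | i + 2 => if distInt (tail α i)⁻¹ = Int.fract (tail α i)⁻¹ then 1 else -1

/-- Numerators `p_i` of the convergents `[a_0; ε_1 a_1, …, ε_i a_i]`, with `p_{-1} = 1`,
`p_0 = a_0 = 0`. -/
def convNum (α : ℝ) : ℕ → ℤ
  | 0 => 0
  | 1 => sgn α 1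
  | i + 2 => quot α (i + 2) * convNum α (i + 1) + sgn α (i + 2) * convNum α i

/-- Denominators `q_i` of the convergents `[a_0; ε_1 a_1, …, ε_i a_i]`, with `q_{-1} = 0`,
`q_0 = 1`. -/
def convDen (α : ℝ) : ℕ → ℤ
  | 0 => 1
  | 1 => quot α 1
  | i + 2 => quot α (i + 2) * convDen α (i + 1) + sgn α (i + 2) * convDen α i

/-- `D_i = |q_i α - p_i|`. -/
def convDist (α : ℝ) (i : ℕ) : ℝ := |convDen α i * α - convNum α i|

/-- `λ_i = 0` if `a_i` is even, and `λ_i = (-1)^j` if `a_i` is the `j`-th odd partial quotient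
among `a_1, a_2, …`. -/
def altSign (α : ℝ) (i : ℕ) : ℤ :=
  if Even (quot α i) then 0
  else (-1) ^ ((Finset.Icc 1 i).filter (fun l => Odd (quot α l))).card

/-- The `i`-th term `(a_i - 1 + ε_i + λ_i) D_{i-1} / 2` (`i ≥ 1`) of the series for `γ_*`. -/
def gammaTerm (α : ℝ) (i : ℕ) : ℝ :=
  1 / 2 * ((quot α i : ℝ) - 1 + (sgn α i : ℝ) + (altSign α i : ℝ)) * convDist α (i - 1)

/-- `γ_* = ∑_{i ≥ 1} (a_i - 1 + ε_i + λ_i) D_{i-1} / 2`. -/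
def gammaStar (α : ℝ) : ℝ := ∑' n : ℕ, gammaTerm α (n + 1)

/-- `R = liminf a_i`, possibly infinite. -/
def liminfQuot (α : ℝ) : ℕ∞ := liminf (fun i => (quot α i : ℕ∞)) atTop

/-- `R_*`: the odd one of `R`, `R + 1`. -/
def Rodd (R : ℕ) : ℕ := if Odd R then R else R + 1

/-- `R_**`: the even one of `R`, `R + 1`. -/
def Reven (R : ℕ) : ℕ := if Even R then R else R + 1

def theta1 (R : ℕ) : ℝ := 1 / 2 * (√((Rodd R : ℝ) ^ 2 + 4) - Rodd R)

def theta2 (R : ℕ) : ℝ :=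
  if 3 ≤ R then 1 / 2 * ((Reven R : ℝ) - √((Reven R : ℝ) ^ 2 - 4)) else 1 / 2

/-- The bound `M_1`. -/
def M1 (R : ℕ) : ℝ :=
  1 / 4 *
    ((1 - 2 / ((Rodd R : ℝ) - theta2 R)) *
      (1 - 1 / max 4 (Reven R : ℝ) * (1 + theta1 R ^ 2 / (1 - theta1 R)))) /
    (1 + 1 / max 4 (Reven R : ℝ) * (theta1 R - 1 / ((Rodd R : ℝ) - theta2 R)))

/-- The sequence `ε_i a_i`, `i > N`, is the periodic repetition of the finite list `P`. -/
def HasPeriodFrom (α : ℝ) (P : List ℤ) (N : ℕ) : Prop :=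
  ∀ m : ℕ, P[m % P.length]? = some (sgn α (N + m + 1) * (quot α (N + m + 1) : ℤ))

/-- The period `(R_*,)^k R_**, -R_*, (-R_**,)^k`. -/
def period (R k : ℕ) : List ℤ :=
  List.replicate k (Rodd R : ℤ) ++ [(Reven R : ℤ), -(Rodd R : ℤ)] ++
    List.replicate k (-(Reven R : ℤ))

/-- The period `(3,)^k 4, -3, -2, A`, used when `R = 2`. -/
def periodTwo (k A : ℕ) : List ℤ :=
  List.replicate k (3 : ℤ) ++ [4, -3, -2, (A : ℤ)]

end NICF

end

noncomputable section

namespace NICF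

open Filter Topology

/-! The series for γ_* telescopes to 2γ_* = 1 + α − g₀, where g₀ is a normalized alternating sum
over the odd partial quotients. With x = 1 − 2n and z = −(2r + 1) this turns 2(nα − γ_* − r) into z
− xα + g₀, so 4M(α, γ_*) is the lower limit of |x|·|z − xα + g₀| over points with both coordinates
odd. The problem is thus one about a product of two linear forms, and the expansion supplies a chain
of divided cells for it. In the coordinates of the k-th cell the product is |z − xα_k + g_k|·|x +
zB_k + E_k| / (1 + α_kB_k). The pair (α_k, g_k) depends on the later partial quotients, (B_k, E_k)
on the earlier ones, and the changes of coordinates preserve oddness; see `RightSystem.product_eq`.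
The vertices of a cell are the points (±1, ±1).

The lower bound has two halves. First, once all quotients are at least R, every vertex has value at
least 4M₁. This comes from a planar region mapped into itself by the steps of (B, E)
(`CellData.Left.step`), a region containing all (α, g) (`CellData.For.right`), and a bilinear
estimate on the product of the two regions (`CellData.Left.vertexBound`). An arbitrary beginning of
the expansion is harmless because the steps of (B, E) are contractions (`leftDist_seq`). Second,
other points do no better than vertices: along the chain, |z| at a point descends to a local
minimum, and there concavity or monotonicity bounds the product below by values at scaled vertices
of two consecutive cells (`HalfBound.point_le`).

The number 4M₁ = (1 − 2A)ρ is the value at the vertex (−1, −1) when the past is ..., R_*, R_*, then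
an even quotient followed by a minus sign, and the future is R_*, −R_**, −R_**, .... The past puts
(B, E) of the preceding cell at the fixed point (θ₁, κ) of the step belonging to R_*, the future
puts the following (α, g) at (θ₂, 0). The periods of the theorem imitate this configuration for ever
longer stretches, and by continuity the vertex values tend to 4M₁ (`extremal_near`,
`Expandable.approxConst_le_of_blocks`). For R = 2 the tail θ₂ = 1/2 is approached by a quotient 2
followed by a large A. -/

/-- The real parameters attached to a lower bound for the partial quotients, with the inequalities
between them that control the vertices of a cell. -/
structure CellData where
  -- Roles: `n` and `m` bound the odd quotients and the even quotients other than 2, `r` all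
  -- quotients other than 2. The pair (`t`, `κ`) is the fixed point of the step with quotient `n`
  -- and sign +. On the left, `b` bounds |B| after a quotient other than 2. On the right, `c` bounds
  -- α, `s` bounds α − g and 2`A` bounds α + g. Finally `ρ` is the least second factor at the
  -- extremal vertex; the remaining fields are what the step and vertex estimates consume.
  (n m r t κ s A b c ρ : ℝ)
  t_pos : 0 < t
  κ_pos : 0 < κ
  κ_half : 2 * κ ≤ 1
  t_eq : κ * (1 - t) = t
  n_eq : κ * n = 1 + t
  s_pos : 0 < s
  s_lt : s < 1
  A_pos : 0 < A
  A_lt : 2 * A < 1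
  A_eq : A * (n - s) = 1
  b_pos : 0 < b
  b_lt : b < 1
  b_eq : 1 ≤ b * (r - b)
  c_pos : 0 < c
  c_lt : c + κ ≤ 1
  c_le : c ≤ 1 / 2
  ρ_pos : 0 < ρ
  ρ_lt : ρ < 1
  ρ_eq : ρ * (m + t - A) = m + t - 1 - κ
  three_le : 3 ≤ n
  T_add_c : (1 - 2 * A) * ρ + c ≤ 1
  T_add_κ : (1 - 2 * A) * ρ + κ ≤ 1
  T_add_s : (1 - 2 * A) * ρ + s ≤ 1
  ρ_corner : ρ * (1 + c * t) ≤ 1 - κ * t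
  κ_even : 2 * κ ≤ t * (4 - b)
  κ_odd : κ ≤ (1 - ρ) * (n - b)
  ρ_even : (1 - ρ) * (t + b) + κ * b ≤ κ
  dual_corner : (1 - 2 * A) * ρ * (n + t - s) ≤ (1 - s) * (n + t - 2 - κ)
  dual_odd : ∀ β f : ℝ, 0 ≤ β → β ≤ b → -(κ * β) ≤ f → ρ * (1 - A * β) ≤ 1 - β + f →
    (1 - 2 * A) * ρ * (n - s - β) ≤ (1 - s) * (n - 2 - β + f)
  dual_even : (1 - 2 * A) * ρ * (m - b - s) ≤ (1 - s) * (m - b - 1 - κ)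
  T_b : (1 - 2 * A) * ρ * (1 + c * b) ≤ 1 - b * (1 + κ)

/-! ### Invariant regions for the left coordinates, and the four vertex inequalities -/

namespace CellData

variable (P : CellData)

/-- The lower bound for the values at the vertices. -/
def T : ℝ := (1 - 2 * P.A) * P.ρ

theorem T_pos : 0 < P.T := mul_pos (by linarith [P.A_lt]) P.ρ_pos

theorem T_lt : P.T < 1 := by
  have := P.T_add_c
  have := P.c_pos
  unfold T; linarith

/-- Conditions on a partial quotient. -/
structure Admits (a : ℕ) : Prop where
  two_le : 2 ≤ a
  odd : Odd a → P.n ≤ a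
  even : Even a → 3 ≤ a → P.m ≤ a
  big : 3 ≤ a → P.r ≤ a
  two : a = 2 → P.s = 1 / 2 ∧ P.T ≤ 3 / 20 ∧ P.b * (1 + P.κ) ≤ 3 / 5

/-- The region containing the (unsigned) left coordinates of a cell. -/
structure Small (β f : ℝ) : Prop where
  nonneg : 0 ≤ β
  le_one : β ≤ 1
  lower : -(P.κ * β) ≤ f
  upper : f ≤ P.κ
  upper' : f ≤ (1 + P.κ) * β
  cusp : P.T ≤ 1 - β - f
  flat : P.T * (1 + P.c * β) ≤ 1 - β + f

/-- The smaller region reached after a partial quotient other than `2`. -/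
structure Tiny (β f : ℝ) : Prop extends P.Small β f where
  le_b : β ≤ P.b
  -- These conditions matter after a minus sign, when B = −β and E = −f. `slope` keeps the next odd
  -- step below κ, `main` is the vertex (−1, −1) at α = g = A, and `dual` is the vertex (1, 1) at α
  -- = s, g = 0.
  slope : 1 - f ≤ P.κ * (P.n - β)
  main : P.ρ * (1 - P.A * β) ≤ 1 - β + f
  dual : P.T * (1 - P.s * β) ≤ (1 - P.s) * (1 - β - f)

/-- The signed left coordinates of a cell. -/
def Left (B E : ℝ) : Prop := P.Small B E ∨ P.Tiny (-B) (-E)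

theorem left_zero : P.Left 0 0 := by
  left
  have := P.T_lt
  have := P.κ_pos
  constructor <;> norm_num <;> linarith

variable {P}

theorem Left.add_pos {a : ℕ} {B E : ℝ} (h : P.Left B E) (ha : P.Admits a) : 1 < (a : ℝ) + B := by
  have h2 : (2 : ℝ) ≤ a := by exact_mod_cast ha.two_le
  rcases h with h | h
  · linarith [h.nonneg]
  · linarith [h.le_b, P.b_lt]

theorem Left.neg_b_le {B E : ℝ} (h : P.Left B E) : -P.b ≤ B := by
  rcases h with h | h
  · linarith [h.nonneg, P.b_pos]
  · linarith [h.le_b]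

theorem Left.abs_le {B E : ℝ} (h : P.Left B E) : |E| ≤ P.κ := by
  have hk := P.κ_pos
  rw [_root_.abs_le]
  rcases h with h | h
  · have := h.le_one; have := h.lower
    exact ⟨by nlinarith, h.upper⟩
  · have := h.le_one; have := h.lower
    exact ⟨by linarith [h.upper], by nlinarith⟩

theorem Left.le_b {a : ℕ} {B E : ℝ} (h : P.Left B E) (ha : P.Admits a) (h3 : 3 ≤ a) :
    1 ≤ P.b * (a + B) := by
  have h1 := ha.big h3
  have h2 := h.neg_b_le
  have h4 := P.b_eq
  have h5 := P.b_pos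
  nlinarith

/-- Bounds the new second coordinate by κ after an odd step. For a positive sign, E is at most both
κ and (1 + κ)B, two lines meeting at the fixed point (t, κ), and the step with quotient n maps this
corner to itself. -/
theorem Left.odd_upper {a : ℕ} {B E : ℝ} (h : P.Left B E) (ha : P.Admits a) (h1 : Odd a) :
    1 + E ≤ P.κ * (a + B) := by
  have hn := ha.odd h1
  have hk := P.κ_pos
  have h2 := P.n_eq
  have h3 := P.t_eq
  have h4 := P.t_pos
  have h7 : P.κ * P.n ≤ P.κ * a := mul_le_mul_of_nonneg_left hn hk.le
  rcases h with h | h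
  · have h5 := h.upper
    have h6 := h.upper'
    have h8 : P.t < 1 := by nlinarith
    -- Weights 1 − t and t on the two upper bounds. As (1 − t)κ = t and t(1 + κ) = κ, the right side
    -- is t + κB, which is κ(n + B) − 1.
    have h9 : E ≤ (1 - P.t) * P.κ + P.t * ((1 + P.κ) * B) := by nlinarith
    nlinarith
  · have h5 := h.slope
    nlinarith


/-- Multiplied by w = a + B, the conditions on (1/w, (1 + E)/w) become linear in a, B and E. The
delicate one is `dual`: for a positive sign its worst case is the corner (t, κ), covered by
`dual_corner`; for a negative sign it is the hypothesis `dual_odd`. `cusp` then follows from `dual`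
since 1/w ≤ 1. -/
theorem Left.step_odd_tiny {a : ℕ} {B E : ℝ} (h : P.Left B E) (ha : P.Admits a) (h1 : Odd a) :
    P.Tiny (1 / (a + B)) ((1 + E) / (a + B)) := by
  have hw := h.add_pos ha
  have h3 : 3 ≤ a := by
    have := ha.two_le
    rcases h1 with ⟨j, rfl⟩
    omega
  have hn := ha.odd h1
  have hup := h.odd_upper ha h1
  obtain ⟨hE1, hE2⟩ := _root_.abs_le.1 h.abs_le
  have hwb := h.le_b ha h3
  have hBb := h.neg_b_le
  have hdual : P.T * (a + B - P.s) ≤ (1 - P.s) * (a + B - 2 - E) := by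
    have h4 := P.T_add_s
    have h5 : 0 ≤ (1 - P.s - P.T) * (a - P.n) :=
      mul_nonneg (by unfold T; linarith) (by linarith)
    rcases h with h | h
    · have h6 := P.dual_corner
      have h7 := P.T_pos
      have h8 := P.s_lt
      have h9 := P.κ_pos
      have h11 : P.T ≤ 1 - P.s := by unfold T; linarith
      change P.T * _ ≤ _ at h6
      have ht := P.t_eq
      rcases le_total P.t B with hB | hB
      · nlinarith [h.upper, mul_nonneg (sub_nonneg.2 h11) (sub_nonneg.2 hB),
          mul_nonneg (sub_nonneg.2 h8.le) (sub_nonneg.2 h.upper)]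
      · have hq : P.κ - E ≥ (1 + P.κ) * (P.t - B) := by nlinarith [h.upper']
        have hr : (1 - P.s) * (P.κ - E) ≥ (1 - P.s) * (P.t - B) := by
          apply mul_le_mul_of_nonneg_left _ (by linarith)
          nlinarith
        nlinarith [mul_nonneg h7.le (sub_nonneg.2 hB)]
    · have := P.dual_odd (-B) (-E) h.nonneg h.le_b h.lower h.main
      change P.T * _ ≤ _ at this
      nlinarith
  have hmain : 0 ≤ a + B + E - P.ρ * (a + B - P.A) := by
    have h4 := P.κ_odd
    have h5 := P.ρ_lt
    nlinarith [mul_pos P.ρ_pos P.A_pos]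
  have hc : (a + B : ℝ) ≠ 0 := by linarith
  set w : ℝ := a + B with hwdef
  have hβ : 0 < 1 / w := by positivity
  have hβw : 1 / w * w = 1 := by field_simp
  have hf : (1 + E) / w = (1 + E) * (1 / w) := by ring
  rw [hf]
  set β := 1 / w with hβdef
  have hk := P.κ_pos
  have hk2 := P.κ_half
  have hb : β ≤ P.b := by
    have : 0 ≤ β * (P.b * w - 1) := mul_nonneg hβ.le (by linarith)
    nlinarith
  have hb1 := P.b_lt
  have hlow : -(P.κ * β) ≤ (1 + E) * β := by nlinarith
  have hdual' : P.T * (1 - P.s * β) ≤ (1 - P.s) * (1 - β - (1 + E) * β) := by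
    have h4 : 0 ≤ β * ((1 - P.s) * (w - 2 - E) - P.T * (w - P.s)) :=
      mul_nonneg hβ.le (by linarith)
    have h5 : β * ((1 - P.s) * (w - 2 - E) - P.T * (w - P.s)) =
      (1 - P.s) * (1 - β - (1 + E) * β) - P.T * (1 - P.s * β) := by
      linear_combination (1 - P.s - P.T) * hβw
    linarith
  refine ⟨⟨hβ.le, by linarith, hlow, ?_, ?_, ?_, ?_⟩, hb, ?_, ?_, hdual'⟩
  · have : 0 ≤ β * (P.κ * w - (1 + E)) := mul_nonneg hβ.le (by linarith)
    nlinarith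
  · nlinarith
  · have h6 : P.T * (1 - P.s) ≤ (1 - P.s) * (1 - β - (1 + E) * β) := by
      have : P.s * β ≤ P.s * 1 := mul_le_mul_of_nonneg_left (by linarith) P.s_pos.le
      nlinarith [P.T_pos]
    have h7 := P.s_lt
    by_contra hcon
    push Not at hcon
    nlinarith
  · have h6 := P.T_b
    change P.T * _ ≤ _ at h6
    have h8 : P.T * (P.c * β) ≤ P.T * (P.c * P.b) :=
      mul_le_mul_of_nonneg_left (mul_le_mul_of_nonneg_left hb P.c_pos.le) P.T_pos.le
    nlinarith
  · have h6 := P.n_eq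
    have h7 : 0 ≤ β * (P.t * w + 1 + E - P.κ) := by
      apply mul_nonneg hβ.le
      nlinarith [P.t_pos]
    linear_combination h7 + P.t * hβw - h6
  · have : 0 ≤ β * (w + E - P.ρ * (w - P.A)) := mul_nonneg hβ.le hmain
    linear_combination this + (1 - P.ρ) * hβw

/-- This inequality determines ρ: equality holds for a = m at the corner (t, κ), the left half of
the extremal configuration. All other positions have slack. -/
theorem Left.step_even_main {a : ℕ} {B E : ℝ} (h : P.Left B E) (ha : P.Admits a) (h1 : Even a)
    (h3 : 3 ≤ a) : P.ρ * (a + B - P.A) ≤ a + B - 1 - E := by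
  have hm := ha.even h1 h3
  have hρ := P.ρ_eq
  have hρ1 := P.ρ_lt
  have hk := P.κ_pos
  have hρ0 := P.ρ_pos
  have hma : 0 ≤ (1 - P.ρ) * (a - P.m) := mul_nonneg (by linarith) (by linarith)
  rcases h with h | h
  · rcases le_total P.t B with hB | hB
    · nlinarith [h.upper, mul_nonneg (sub_nonneg.2 hρ1.le) (sub_nonneg.2 hB)]
    · have hq : P.κ - E ≥ (1 + P.κ) * (P.t - B) := by nlinarith [h.upper', P.t_eq]
      nlinarith [mul_nonneg hρ0.le (sub_nonneg.2 hB), mul_nonneg hk.le (sub_nonneg.2 hB)]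
  · have h4 := P.ρ_even
    have h5 := h.le_b
    have h6 := h.lower
    have h7 : P.κ * -B ≤ P.κ * P.b := mul_le_mul_of_nonneg_left h5 hk.le
    have h8 : (1 - P.ρ) * -B ≤ (1 - P.ρ) * P.b := mul_le_mul_of_nonneg_left h5 (by linarith)
    nlinarith

theorem Left.step_even_tiny {a : ℕ} {B E : ℝ} (h : P.Left B E) (ha : P.Admits a) (h1 : Even a)
    (h3 : 3 ≤ a) : P.Tiny (1 / (a + B)) (-E / (a + B)) := by
  have hw := h.add_pos ha
  have h4a : (4 : ℝ) ≤ a := by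
    have : 4 ≤ a := by
      rcases h1 with ⟨j, rfl⟩
      omega
    exact_mod_cast this
  have hm := ha.even h1 h3
  obtain ⟨hE1, hE2⟩ := _root_.abs_le.1 h.abs_le
  have hwb := h.le_b ha h3
  have hBb := h.neg_b_le
  have hmain := h.step_even_main ha h1 h3
  have hT := P.T_pos
  have hs := P.s_lt
  have hdual : P.T * (a + B - P.s) ≤ (1 - P.s) * (a + B - 1 + E) := by
    have h4 := P.T_add_s
    have h5 := P.dual_even
    change P.T * _ ≤ _ at h5
    have h6 : 0 ≤ (1 - P.s - P.T) * (a + B - (P.m - P.b)) :=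
      mul_nonneg (by unfold T; linarith) (by linarith)
    nlinarith
  have hc : (a + B : ℝ) ≠ 0 := by linarith
  have htw : 2 * P.κ ≤ P.t * (a + B) := by
    have := P.κ_even
    have := P.t_pos
    nlinarith
  set w : ℝ := a + B with hwdef
  have hβ : 0 < 1 / w := by positivity
  have hβw : 1 / w * w = 1 := by field_simp
  have hf : -E / w = -E * (1 / w) := by ring
  rw [hf]
  set β := 1 / w with hβdef
  have hk := P.κ_pos
  have hk2 := P.κ_half
  have hb : β ≤ P.b := by
    have : 0 ≤ β * (P.b * w - 1) := mul_nonneg hβ.le (by linarith)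
    nlinarith
  have hb1 := P.b_lt
  have hlow : -(P.κ * β) ≤ -E * β := by nlinarith
  have hupp : -E * β ≤ P.κ * β := by nlinarith
  have hdual' : P.T * (1 - P.s * β) ≤ (1 - P.s) * (1 - β - -E * β) := by
    have h4 : 0 ≤ β * ((1 - P.s) * (w - 1 + E) - P.T * (w - P.s)) :=
      mul_nonneg hβ.le (by linarith)
    have h5 : β * ((1 - P.s) * (w - 1 + E) - P.T * (w - P.s)) =
      (1 - P.s) * (1 - β - -E * β) - P.T * (1 - P.s * β) := by
      linear_combination (1 - P.s - P.T) * hβw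
    linarith
  refine ⟨⟨hβ.le, by linarith, hlow, ?_, ?_, ?_, ?_⟩, hb, ?_, ?_, hdual'⟩
  · nlinarith
  · nlinarith
  · have h6 : P.T * (1 - P.s) ≤ (1 - P.s) * (1 - β - -E * β) := by
      have : P.s * β ≤ P.s * 1 := mul_le_mul_of_nonneg_left (by linarith) P.s_pos.le
      nlinarith [P.T_pos]
    by_contra hcon
    push Not at hcon
    nlinarith
  · have h6 := P.T_b
    change P.T * _ ≤ _ at h6
    have h8 : P.T * (P.c * β) ≤ P.T * (P.c * P.b) :=
      mul_le_mul_of_nonneg_left (mul_le_mul_of_nonneg_left hb P.c_pos.le) P.T_pos.le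
    nlinarith
  · have h6 := P.n_eq
    have h7 : 0 ≤ β * (P.t * w - E - P.κ) := mul_nonneg hβ.le (by linarith)
    linear_combination h7 + P.t * hβw - h6
  · have : 0 ≤ β * (w - 1 - E - P.ρ * (w - P.A)) := mul_nonneg hβ.le (by linarith)
    linear_combination this + (1 - P.ρ) * hβw

/-- A quotient 2 is never followed by a minus sign, so the larger region is enough here. -/
theorem Left.step_two_small {a : ℕ} {B E : ℝ} (h : P.Left B E) (ha : P.Admits a) (h2 : a = 2) :
    P.Small (1 / (a + B)) (-E / (a + B)) := by
  have hw := h.add_pos ha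
  obtain ⟨hE1, hE2⟩ := _root_.abs_le.1 h.abs_le
  obtain ⟨hs, hT2, hb2⟩ := ha.two h2
  have hT := P.T_pos
  have hk := P.κ_pos
  have hk2 := P.κ_half
  have hc1 := P.c_le
  have hc0 := P.c_pos
  have hcusp : P.T * (a + B) ≤ a + B - 1 + E := by
    subst h2
    rcases h with h | h
    · have h5 := h.lower
      have h6 := h.nonneg
      have h7 := h.le_one
      push_cast
      nlinarith
    -- With s = 1/2, twice `dual` is exactly `cusp` after a quotient 2.
    · have h5 := h.dual
      rw [hs] at h5
      push_cast
      nlinarith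
  have hflat : P.T * (a + B + P.c) ≤ a + B - 1 - E := by
    subst h2
    rcases h with h | h
    · have h5 := h.upper
      have h6 := h.nonneg
      have h7 := h.le_one
      push_cast
      nlinarith
    · have h7 := h.lower
      have h8 := h.nonneg
      have h9 : -B * (1 + P.κ) ≤ P.b * (1 + P.κ) :=
        mul_le_mul_of_nonneg_right h.le_b (by linarith)
      push_cast
      nlinarith
  have hw2 : 1 ≤ a + B := by linarith
  set w : ℝ := a + B with hwdef
  have hβ : 0 < 1 / w := by positivity
  have hβw : 1 / w * w = 1 := by field_simp
  have hβ1 : 1 / w ≤ 1 := by rw [div_le_one (by linarith)]; exact hw2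
  have hf : -E / w = -E * (1 / w) := by ring
  rw [hf]
  set β := 1 / w with hβdef
  have hupp : -E * β ≤ P.κ * β := by nlinarith
  refine ⟨hβ.le, hβ1, by nlinarith, by nlinarith, by nlinarith, ?_, ?_⟩
  · have h4 : 0 ≤ β * (w - 1 + E - P.T * w) := mul_nonneg hβ.le (by linarith)
    linear_combination h4 + (1 - P.T) * hβw
  · have h4 : 0 ≤ β * (w - 1 - E - P.T * (w + P.c)) := mul_nonneg hβ.le (by linarith)
    linear_combination h4 + (1 - P.T) * hβw

/-- One step of the left coordinates `(B, E)`, for a partial quotient `a` followed by the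
sign `e`. -/
def _root_.NICF.leftStep (a : ℕ) (e : ℝ) (p : ℝ × ℝ) : ℝ × ℝ :=
  (e / (a + p.1), if Odd a then e * (1 + p.2) / (a + p.1) else -(e * p.2) / (a + p.1))

theorem Left.step {a : ℕ} {e : ℝ} {p : ℝ × ℝ} (h : P.Left p.1 p.2) (ha : P.Admits a)
    (he : e = 1 ∨ e = -1) (h2 : a = 2 → e = 1) :
    P.Left (leftStep a e p).1 (leftStep a e p).2 := by
  have key : P.Small (1 / (a + p.1)) (if Odd a then (1 + p.2) / (a + p.1) else -p.2 / (a + p.1)) ∧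
      (a ≠ 2 → P.Tiny (1 / (a + p.1))
        (if Odd a then (1 + p.2) / (a + p.1) else -p.2 / (a + p.1))) := by
    by_cases h1 : Odd a
    · simp only [h1, if_true]
      exact ⟨(h.step_odd_tiny ha h1).toSmall, fun _ => h.step_odd_tiny ha h1⟩
    · simp only [h1, if_false]
      have h1' := Nat.not_odd_iff_even.1 h1
      have := ha.two_le
      by_cases h3 : a = 2
      · exact ⟨h.step_two_small ha h3, fun h => absurd h3 h⟩
      · have h4 := h.step_even_tiny ha h1' (by omega)
        exact ⟨h4.toSmall, fun _ => h4⟩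
  rcases he with rfl | rfl
  · left
    have h4 : leftStep a 1 p = (1 / (a + p.1),
        if Odd a then (1 + p.2) / (a + p.1) else -p.2 / (a + p.1)) := by
      unfold leftStep
      simp only [one_mul]
    rw [h4]
    exact key.1
  · right
    have h3 : a ≠ 2 := by
      intro h; have := h2 h; norm_num at this
    convert key.2 h3 using 1
    · simp [leftStep, neg_div]
    · simp only [leftStep]
      split_ifs <;> ring

/-- The values of the product at the four vertices of a cell exceed `c`, up to normalisation, and
the factors are positive. -/
structure _root_.NICF.VertexBound (c α g B E : ℝ) : Prop where
  -- The letters are the signs of the two coordinates (x, z) of the vertex; both factors are written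
  -- with the sign that makes them positive.
  pp : 0 < 1 - α + g ∧ c * (1 + α * B) ≤ (1 - α + g) * (1 + B + E)
  mm : 0 < 1 - α - g ∧ c * (1 + α * B) ≤ (1 - α - g) * (1 + B - E)
  mp : 0 < 1 + α + g ∧ c * (1 + α * B) ≤ (1 + α + g) * (1 - B - E)
  pm : 0 < 1 + α - g ∧ c * (1 + α * B) ≤ (1 + α - g) * (1 - B + E)

/-- The region containing the right coordinates of a cell. -/
structure Right (P : CellData) (α g : ℝ) : Prop where
  nonneg : 0 ≤ g
  le : g ≤ α
  le_c : α ≤ P.c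
  add_le : α + g ≤ 2 * P.A
  sub_le : α - g ≤ P.s

/-- The binding vertex is (−1, −1): its first factor is at least 1 − 2A, its second at least ρ(1 +
αB) in the extremal case, whence T = (1 − 2A)ρ. For negative B the vertex (1, 1) needs `dual`. The
other vertices are covered by `cusp`, `flat` and crude bounds. -/
theorem Left.vertexBound {B E α g : ℝ} (h : P.Left B E) (hr : P.Right α g) :
    VertexBound P.T α g B E := by
  obtain ⟨hg0, hgα, hαc, hadd, hsub⟩ := hr
  have hA := P.A_lt
  have hc := P.c_lt
  have hcle := P.c_le
  have hT := P.T_pos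
  have hTc : P.T + P.c ≤ 1 := P.T_add_c
  have hTκ : P.T + P.κ ≤ 1 := P.T_add_κ
  have hκ := P.κ_pos
  have hρ := P.ρ_pos
  have hρ1 := P.ρ_lt
  have hTdef : P.T = (1 - 2 * P.A) * P.ρ := rfl
  refine ⟨⟨by linarith, ?_⟩, ⟨by linarith, ?_⟩, ⟨by linarith, ?_⟩, ⟨by linarith, ?_⟩⟩
  · rcases h with h | h
    · have h1 := h.lower
      have h2 := h.nonneg
      have h3 : 1 + α * B ≤ 1 + B + E := by nlinarith
      have h4 : 0 ≤ 1 + α * B := by nlinarith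
      calc P.T * (1 + α * B) ≤ (1 - α + g) * (1 + α * B) :=
            mul_le_mul_of_nonneg_right (by linarith) h4
        _ ≤ _ := mul_le_mul_of_nonneg_left h3 (by linarith)
    · have h1 := h.dual
      have h2 := h.cusp
      have h3 := h.le_one
      have h4 := h.nonneg
      have hs := P.s_lt
      have h5 : 0 ≤ (P.s - (α - g)) * ((1 - -B - -E) - P.T * -B) :=
        mul_nonneg (by linarith) (by nlinarith)
      have h6 : 0 ≤ P.T * (g * -B) := by positivity
      nlinarith
  · rcases h with h | h
    · have h1 := h.upper
      have h2 := h.upper'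
      have h3 := h.nonneg
      have hco := P.ρ_corner
      have hte := P.t_eq
      have ht := P.t_pos
      have key : P.ρ * (1 + P.c * B) ≤ 1 + B - E := by
        have hρc : P.ρ * P.c ≤ 1 := by nlinarith
        rcases le_total P.t B with hB | hB
        · nlinarith [mul_nonneg (sub_nonneg.2 hB) (sub_nonneg.2 hρc)]
        · have h5 : (1 - P.κ * B - P.ρ * (1 + P.c * B)) * P.t =
            (1 - P.κ * P.t - P.ρ * (1 + P.c * P.t)) * B + (1 - P.ρ) * (P.t - B) := by ring
          have h6 : 0 ≤ (1 - P.κ * B - P.ρ * (1 + P.c * B)) * P.t := by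
            rw [h5]
            exact add_nonneg (mul_nonneg (by linarith) h3)
              (mul_nonneg (by linarith) (by linarith))
          have h7 := nonneg_of_mul_nonneg_left h6 ht
          linarith
      have h4 : P.ρ * (1 + α * B) ≤ 1 + B - E := by
        have : P.ρ * (α * B) ≤ P.ρ * (P.c * B) :=
          mul_le_mul_of_nonneg_left (mul_le_mul_of_nonneg_right hαc h3) hρ.le
        linarith
      have h5 : 0 ≤ P.ρ * (1 + α * B) :=
        mul_nonneg hρ.le (add_nonneg zero_le_one (mul_nonneg (by linarith) h3))
      calc P.T * (1 + α * B) = (1 - 2 * P.A) * (P.ρ * (1 + α * B)) := by rw [hTdef]; ring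
        _ ≤ (1 - α - g) * (P.ρ * (1 + α * B)) := mul_le_mul_of_nonneg_right (by linarith) h5
        _ ≤ _ := mul_le_mul_of_nonneg_left h4 (by linarith)
    · have h1 := h.main
      have h3 := h.le_one
      have h4 := h.nonneg
      have h7 : P.T * (1 - P.A * -B) ≤ (1 - 2 * P.A) * (1 - -B + -E) := by
        rw [hTdef, mul_assoc]
        exact mul_le_mul_of_nonneg_left h1 (by linarith)
      have h8 : P.ρ * (1 - P.A) ≤ 1 - -B + -E := by
        refine le_trans (mul_le_mul_of_nonneg_left ?_ hρ.le) h1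
        nlinarith [P.A_pos]
      have h9 : P.T * -B ≤ 2 * (1 - -B + -E) := by
        have : P.T ≤ P.ρ := by rw [hTdef]; nlinarith [P.A_pos]
        nlinarith
      -- The claim is affine in (α + g)/2 and (α − g)/2. It is known when these are A and 0; `h5`
      -- pays for lowering the first, `h6` for raising the second.
      have h5 : 0 ≤ (P.A - (α + g) / 2) * (2 * (1 - -B + -E) - P.T * -B) :=
        mul_nonneg (by linarith) (by linarith)
      have h6 : 0 ≤ P.T * ((α - g) / 2 * -B) :=
        mul_nonneg hT.le (mul_nonneg (by linarith) h4)
      nlinarith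
  · rcases h with h | h
    · have h1 := h.cusp
      have h2 := h.nonneg
      have h3 := h.le_one
      have h4 : 0 ≤ α := by linarith
      have h5 : (1 + α) * P.T ≤ (1 + α + g) * (1 - B - E) := by
        apply mul_le_mul (by linarith) h1 hT.le (by linarith)
      have h6 : α * B ≤ α * 1 := mul_le_mul_of_nonneg_left h3 h4
      nlinarith
    · have h1 := h.lower
      have h2 := h.nonneg
      have h4 : 0 ≤ α := by linarith
      have h5 : 0 ≤ α * -B := mul_nonneg h4 h2
      have h6 : 1 ≤ 1 - B - E := by nlinarith
      have h7 : (1:ℝ) * 1 ≤ (1 + α + g) * (1 - B - E) :=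
        mul_le_mul (by linarith) h6 zero_le_one (by linarith)
      nlinarith
  · rcases h with h | h
    · have h1 := h.flat
      have h2 := h.nonneg
      have h4 : 0 ≤ α := by linarith
      have h5 : P.T * (1 + α * B) ≤ P.T * (1 + P.c * B) := by
        apply mul_le_mul_of_nonneg_left _ hT.le
        nlinarith
      have h6 : 0 ≤ P.T * (1 + α * B) := by positivity
      nlinarith
    · have h1 := h.upper'
      have h2 := h.nonneg
      have h3 := h.le_one
      have h4 : 0 ≤ α := by linarith
      have h5 : 0 ≤ α * -B := mul_nonneg h4 h2
      have h6 : 1 - P.κ ≤ 1 - B + E := by nlinarith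
      have h7 : (1:ℝ) * (1 - P.κ) ≤ (1 + α - g) * (1 - B + E) :=
        mul_le_mul (by linarith) h6 (by linarith) (by linarith)
      nlinarith

end CellData

/-! ### The parameter inequalities for R ≥ 4 -/

/-- Relations between the parameters belonging to `R ≥ 4`. -/
structure LargeParams (N n m t κ s A b ρ : ℝ) : Prop where
  four_le : 4 ≤ N
  five_le : 5 ≤ n
  n_ge : N ≤ n
  m_ge : N ≤ m
  sum : n + m = 2 * N + 1
  diff : m = n + 1 ∨ m = n - 1
  t_pos : 0 < t
  t_def : t * (n + t) = 1
  κ_def : κ * (1 - t) = t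
  s_pos : 0 < s
  s_le : s ≤ 3 / 10
  s_def : s * (m - s) = 1
  A_def : A * (n - s) = 1
  -- A rational substitute for the root of b(N − b) = 1: since b ≤ 10/37 < 3/10 for N ≥ 4, it
  -- satisfies 1 ≤ b(N − b).
  b_def : b * (N - 3 / 10) = 1
  ρ_def : ρ * (m + t - A) = m + t - 1 - κ

namespace LargeParams


theorem t_le {N n m t κ s A b ρ : ℝ} (h : LargeParams N n m t κ s A b ρ) : t ≤ 1 / 5 := by
  have := h.five_le; have := h.t_def; have := h.t_pos
  nlinarith

theorem κ_pos {N n m t κ s A b ρ : ℝ} (h : LargeParams N n m t κ s A b ρ) : 0 < κ := by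
  have h1 := h.t_le; have h2 := h.t_pos; have h3 := h.κ_def
  by_contra hc
  push Not at hc
  nlinarith

theorem κ_le {N n m t κ s A b ρ : ℝ} (h : LargeParams N n m t κ s A b ρ) : κ ≤ 1 / 4 := by
  have h1 := h.t_le; have h2 := h.t_pos; have h3 := h.κ_def; have := h.κ_pos
  nlinarith

theorem n_eq {N n m t κ s A b ρ : ℝ} (h : LargeParams N n m t κ s A b ρ) : κ * n = 1 + t := by
  have h1 := h.t_pos; have h2 := h.t_def; have h3 := h.κ_def
  have : t * (κ * n - (1 + t)) = 0 := by linear_combination κ * h2 + (1 + t) * h3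
  rcases mul_eq_zero.1 this with h4 | h4
  · linarith
  · linarith

theorem b_pos {N n m t κ s A b ρ : ℝ} (h : LargeParams N n m t κ s A b ρ) : 0 < b := by
  have h1 := h.b_def; have h2 := h.four_le
  by_contra hc
  push Not at hc
  nlinarith

theorem b_le {N n m t κ s A b ρ : ℝ} (h : LargeParams N n m t κ s A b ρ) : b ≤ 10 / 37 := by
  have h1 := h.b_def; have h2 := h.four_le; have := h.b_pos
  nlinarith

theorem A_pos {N n m t κ s A b ρ : ℝ} (h : LargeParams N n m t κ s A b ρ) : 0 < A := by
  have h1 := h.A_def; have h2 := h.five_le; have := h.s_le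
  by_contra hc
  push Not at hc
  nlinarith

theorem A_le_b {N n m t κ s A b ρ : ℝ} (h : LargeParams N n m t κ s A b ρ) : A ≤ b := by
  have h1 := h.A_def; have h2 := h.b_def; have h3 := h.A_pos; have h4 := h.b_pos
  have h5 := h.s_le; have h6 := h.n_ge
  by_contra hc
  push Not at hc
  have h7 : A * (N - 3 / 10) ≤ A * (n - s) := mul_le_mul_of_nonneg_left (by linarith) h3.le
  have h8 : 0 < (A - b) * (N - 3 / 10) := mul_pos (by linarith) (by linarith [h.four_le])
  nlinarith

theorem s_le_b {N n m t κ s A b ρ : ℝ} (h : LargeParams N n m t κ s A b ρ) : s ≤ b := by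
  have h1 := h.s_def; have h2 := h.b_def; have h3 := h.s_pos; have h4 := h.b_pos
  have h5 := h.s_le; have h6 := h.m_ge
  by_contra hc
  push Not at hc
  have h7 : s * (N - 3 / 10) ≤ s * (m - s) := mul_le_mul_of_nonneg_left (by linarith) h3.le
  have h8 : 0 < (s - b) * (N - 3 / 10) := mul_pos (by linarith) (by linarith [h.four_le])
  nlinarith

theorem t_lt_A {N n m t κ s A b ρ : ℝ} (h : LargeParams N n m t κ s A b ρ) : t < A := by
  have h1 := h.A_def; have h2 := h.t_def; have h3 := h.A_pos; have h4 := h.t_pos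
  have h5 := h.s_pos
  have h6 : (A - t) * n = A * s + t * t := by linear_combination h1 - h2
  have h7 : 0 < A * s + t * t := by positivity
  have := h.five_le
  by_contra hc
  push Not at hc
  nlinarith

theorem A_lt_κ {N n m t κ s A b ρ : ℝ} (h : LargeParams N n m t κ s A b ρ) : A < κ := by
  have h1 := h.A_def; have h2 := h.n_eq; have h3 := h.A_pos; have h4 := h.κ_def
  have h5 := h.s_le; have h6 := h.t_le; have h7 := h.κ_pos
  have h8 : (κ - A) * (n - s) = κ * (1 - t - s) := by linear_combination h2 - h1 - h4
  have h9 : 0 < κ * (1 - t - s) := mul_pos h7 (by linarith)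
  have := h.five_le
  by_contra hc
  push Not at hc
  nlinarith

theorem A_mul_ge {N n m t κ s A b ρ : ℝ} (h : LargeParams N n m t κ s A b ρ) : 1 ≤ A * (N + 1) := by
  have h1 := h.A_def; have h2 := h.A_pos; have h3 := h.s_pos
  have h4 := h.sum; have h5 := h.m_ge
  nlinarith

theorem b_le_two_A {N n m t κ s A b ρ : ℝ} (h : LargeParams N n m t κ s A b ρ) : b ≤ 2 * A := by
  have h1 := h.A_mul_ge; have h2 := h.b_def; have h3 := h.A_pos; have h4 := h.four_le
  have h5 : 0 ≤ (2 * A - b) * (N - 3 / 10) := by nlinarith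
  exact sub_nonneg.1 (nonneg_of_mul_nonneg_left h5 (by linarith))

theorem den_pos {N n m t κ s A b ρ : ℝ} (h : LargeParams N n m t κ s A b ρ) : 0 < m + t - A := by
  have := h.four_le; have := h.m_ge; have := h.A_le_b; have := h.b_le; have := h.t_pos
  linarith

theorem ρ_mul_le {N n m t κ s A b ρ : ℝ} (h : LargeParams N n m t κ s A b ρ) : ρ * m ≤ m - 1 := by
  have h1 := h.ρ_def; have h2 := h.den_pos; have h3 := h.t_lt_A; have h4 := h.A_lt_κ
  have h5 := h.m_ge; have h6 := h.four_le
  have h7 : (m - 1 - ρ * m) * (m + t - A) = m * (κ - A) + (A - t) := by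
    linear_combination -m * h1
  have h8 : 0 < (m - 1 - ρ * m) * (m + t - A) := by
    rw [h7]
    have : 0 < m * (κ - A) := mul_pos (by linarith) (by linarith)
    linarith
  have := pos_of_mul_pos_left h8 h2.le
  linarith

theorem ρ_pos {N n m t κ s A b ρ : ℝ} (h : LargeParams N n m t κ s A b ρ) : 0 < ρ := by
  have h1 := h.ρ_def; have h2 := h.den_pos; have h3 := h.κ_le; have h4 := h.t_pos
  have h5 := h.m_ge; have h6 := h.four_le
  have : 0 < ρ * (m + t - A) := by rw [h1]; linarith
  exact pos_of_mul_pos_left this h2.le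

theorem ρ_lt {N n m t κ s A b ρ : ℝ} (h : LargeParams N n m t κ s A b ρ) : ρ < 1 := by
  have h1 := h.ρ_mul_le
  have h5 := h.m_ge; have h6 := h.four_le
  by_contra hc
  push Not at hc
  nlinarith

theorem A_le_quarter {N n m t κ s A b ρ : ℝ} (h : LargeParams N n m t κ s A b ρ) : A ≤ 1 / 4 := by
  have := h.A_lt_κ; have := h.κ_le
  linarith

theorem T_le {N n m t κ s A b ρ : ℝ} (h : LargeParams N n m t κ s A b ρ) :
    (1 - 2 * A) * ρ ≤ 1 - 2 * A := by
  have := h.ρ_lt; have := h.A_le_quarter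
  nlinarith

theorem κ_mul_le {N n m t κ s A b ρ : ℝ} (h : LargeParams N n m t κ s A b ρ) : κ * (N - 1) ≤ 1 := by
  have h1 := h.n_eq; have h2 := h.κ_def; have h3 := h.κ_pos; have h4 := h.n_ge; have h5 := h.t_pos
  nlinarith

theorem κ_le_two_A {N n m t κ s A b ρ : ℝ} (h : LargeParams N n m t κ s A b ρ) : κ ≤ 2 * A := by
  have h1 := h.A_mul_ge; have h2 := h.κ_mul_le; have h3 := h.A_pos; have h4 := h.four_le
  have h5 : 0 ≤ (2 * A - κ) * (N + 1) := by nlinarith [h.κ_le]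
  exact sub_nonneg.1 (nonneg_of_mul_nonneg_left h5 (by linarith))

theorem t_mul_le {N n m t κ s A b ρ : ℝ} (h : LargeParams N n m t κ s A b ρ) : t * N ≤ 1 := by
  have h1 := h.t_def; have h2 := h.t_pos; have h3 := h.n_ge
  nlinarith

theorem t_le_b {N n m t κ s A b ρ : ℝ} (h : LargeParams N n m t κ s A b ρ) : t ≤ b := by
  have := h.t_lt_A; have := h.A_le_b; linarith

theorem ρ_corner {N n m t κ s A b ρ : ℝ} (h : LargeParams N n m t κ s A b ρ) :
    ρ * (1 + b * t) ≤ 1 - κ * t := by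
  have h1 := h.ρ_mul_le; have h2 := h.b_le; have h3 := h.κ_le; have h4 := h.t_mul_le
  have h5 := h.t_pos; have h6 := h.m_ge; have h7 := h.four_le; have h8 := h.ρ_lt
  have h9 := h.ρ_pos; have h10 := h.b_pos; have h11 := h.κ_pos; have h12 := h.sum; have h13 := h.n_ge
  have h14 : ρ * (b * t) ≤ b * t := by
    have : 0 < b * t := by positivity
    nlinarith
  have h15 : (b + κ) * t ≤ (10 / 37 + 1 / 4) * t :=
    mul_le_mul_of_nonneg_right (by linarith) h5.le
  have h16 : (10 / 37 + 1 / 4) * t * m ≤ 1 := by nlinarith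
  have h17 : 0 ≤ (1 - ρ - (b + κ) * t) * m := by nlinarith
  have := nonneg_of_mul_nonneg_left h17 (by linarith)
  linarith

theorem κ_even {N n m t κ s A b ρ : ℝ} (h : LargeParams N n m t κ s A b ρ) :
    2 * κ ≤ t * (4 - b) := by
  have h1 := h.κ_def; have h2 := h.κ_pos; have h3 := h.t_le; have h4 := h.b_le
  have h5 : 2 ≤ (1 - t) * (4 - b) := by nlinarith
  calc 2 * κ = κ * 2 := by ring
    _ ≤ κ * ((1 - t) * (4 - b)) := mul_le_mul_of_nonneg_left h5 h2.le
    _ = _ := by rw [← mul_assoc, h1]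

theorem κ_odd {N n m t κ s A b ρ : ℝ} (h : LargeParams N n m t κ s A b ρ) :
    κ ≤ (1 - ρ) * (n - b) := by
  have h1 := h.ρ_mul_le; have h2 := h.b_le; have h3 := h.κ_mul_le; have h4 := h.κ_le
  have h5 := h.five_le; have h6 := h.m_ge; have h7 := h.four_le; have h8 := h.sum; have h9 := h.n_ge
  have h10 := h.κ_pos
  have h11 : 1 * (n - b) ≤ ((1 - ρ) * m) * (n - b) :=
    mul_le_mul_of_nonneg_right (by linarith) (by linarith)
  have h12 : κ * m ≤ n - b := by nlinarith
  have h17 : 0 ≤ ((1 - ρ) * (n - b) - κ) * m := by nlinarith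
  have := nonneg_of_mul_nonneg_left h17 (by linarith)
  linarith

theorem ρ_gap {N n m t κ s A b ρ : ℝ} (h : LargeParams N n m t κ s A b ρ) :
    (1 - ρ) * N ≤ 6 / 5 := by
  have h1 := h.ρ_def; have h2 := h.den_pos; have h3 := h.κ_le; have h4 := h.A_le_quarter
  have h5 := h.m_ge; have h6 := h.four_le; have h7 := h.t_pos; have h8 := h.κ_mul_le
  have h9 := h.A_mul_ge; have h10 := h.ρ_lt; have h11 := h.A_pos; have h12 := h.n_eq
  have h13 := h.κ_def; have h14 := h.A_def; have h15 := h.five_le; have h16 := h.s_pos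
  have h17 : (κ - A) ≤ 1 / 20 := by
    have h18 : 0 ≤ (1 / 20 - (κ - A)) * n := by nlinarith [h.κ_pos]
    have := nonneg_of_mul_nonneg_left h18 (by linarith)
    linarith
  have h19 : (1 - ρ) * (m + t - A) = 1 + κ - A := by linear_combination -h1
  have h20 : (1 - ρ) * (N - 1 / 4) ≤ 1 + 1 / 20 := by
    have : (1 - ρ) * (N - 1 / 4) ≤ (1 - ρ) * (m + t - A) :=
      mul_le_mul_of_nonneg_left (by linarith) (by linarith)
    linarith
  nlinarith

theorem κ_mul_ge {N n m t κ s A b ρ : ℝ} (h : LargeParams N n m t κ s A b ρ) :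
    1 ≤ κ * (N + 1 / 5) := by
  have h1 := h.n_eq; have h2 := h.κ_def; have h3 := h.κ_pos; have h4 := h.sum; have h5 := h.m_ge
  have h6 := h.t_le
  nlinarith

theorem ρ_even {N n m t κ s A b ρ : ℝ} (h : LargeParams N n m t κ s A b ρ) :
    (1 - ρ) * (t + b) + κ * b ≤ κ := by
  have h1 := h.ρ_gap; have h2 := h.b_le; have h3 := h.κ_mul_ge; have h4 := h.t_mul_le
  have h5 := h.b_def; have h6 := h.four_le; have h7 := h.ρ_lt; have h8 := h.t_pos
  have h9 := h.b_pos; have h10 := h.κ_pos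
  have h11 : (t + b) * N ≤ 1 + 40 / 37 := by nlinarith
  have h12 : (1 - ρ) * N * ((t + b) * N) ≤ 6 / 5 * (1 + 40 / 37) := by
    apply mul_le_mul h1 h11 (by positivity) (by norm_num)
  have h13 : κ * (1 - b) * (N * N) ≥ 6 / 5 * (1 + 40 / 37) := by
    have h14 : κ * N ≥ 20 / 21 := by nlinarith
    have h15 : κ * N * N ≥ 80 / 21 := by nlinarith
    nlinarith
  have h16 : 0 ≤ (κ * (1 - b) - (1 - ρ) * (t + b)) * (N * N) := by nlinarith
  have := nonneg_of_mul_nonneg_left h16 (by positivity)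
  linarith

theorem T_b {N n m t κ s A b ρ : ℝ} (h : LargeParams N n m t κ s A b ρ) :
    (1 - 2 * A) * ρ * (1 + b * b) ≤ 1 - b * (1 + κ) := by
  have h1 := h.T_le; have h2 := h.b_le; have h3 := h.A_mul_ge; have h4 := h.b_def
  have h5 := h.κ_le; have h6 := h.b_pos; have h7 := h.four_le; have h8 := h.A_pos
  have h9 := h.A_le_quarter
  have h10 : (1 - 2 * A) * ρ * (1 + b * b) ≤ (1 - 2 * A) * (1 + b * b) :=
    mul_le_mul_of_nonneg_right h1 (by positivity)
  have h11 : A * (N - 3 / 10) ≥ 37 / 50 := by nlinarith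
  have h12 : 1 + κ + b ≤ 2 * (A * (N - 3 / 10)) * (1 + b * b) := by
    rcases le_total N 5 with hN | hN
    · have h13 : 10 / 47 ≤ b := by nlinarith
      nlinarith
    · have h13 : b ≤ 10 / 47 := by nlinarith
      nlinarith
  have h14 : b * (1 + κ + b) ≤ 2 * A * (1 + b * b) := by
    calc b * (1 + κ + b) ≤ b * (2 * (A * (N - 3 / 10)) * (1 + b * b)) :=
          mul_le_mul_of_nonneg_left h12 h6.le
      _ = 2 * A * (1 + b * b) := by linear_combination 2 * A * (1 + b * b) * h4
  nlinarith

/-- Equivalent to (1 − s)(1 + κ − s) ≤ (1 − s − T)(m − b − s). The left side is controlled by κ − s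
≤ s/2, checked separately for m = n ± 1, and the right side by a lower bound for (1 − s − T)m. -/
theorem dual_even {N n m t κ s A b ρ : ℝ} (h : LargeParams N n m t κ s A b ρ) :
    (1 - 2 * A) * ρ * (m - b - s) ≤ (1 - s) * (m - b - 1 - κ) := by
  have h1 := h.ρ_mul_le; have h2 := h.b_le; have h3 := h.s_le; have h4 := h.s_pos
  have h5 := h.κ_le; have h6 := h.A_def; have h7 := h.s_def; have h8 := h.four_le
  have h9 := h.m_ge; have h10 := h.A_le_quarter; have h11 := h.A_pos; have h12 := h.κ_pos
  have h13 := h.n_eq; have h14 := h.κ_def; have h15 := h.five_le; have h16 := h.t_pos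
  have hA : A ≤ 10 / 47 := by nlinarith
  have hκs : κ - s ≤ s / 2 := by
    have e : (κ - s) * (m - s) = κ * (m - s - n + 1 - t) := by
      linear_combination h13 - h7 - h14
    rcases h.diff with hd | hd
    · have e2 : κ - s = κ * s * (2 - s - t) := by
        linear_combination s * e + (-κ * 1 + s) * h7 + κ * s * hd
      have : κ * s * (2 - s - t) ≤ 1 / 4 * s * 2 := by
        apply mul_le_mul _ (by linarith) (by linarith [h.t_le]) (by positivity)
        nlinarith
      linarith
    · have e2 : κ - s = -(κ * s * (s + t)) := by
        linear_combination s * e + (-κ * 1 + s) * h7 + κ * s * hd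
      have : 0 < κ * s * (s + t) := by positivity
      linarith
  have hρ : (1 - 2 * A) * (ρ * m) ≤ (1 - 2 * A) * (m - 1) :=
    mul_le_mul_of_nonneg_left h1 (by linarith)
  have hAm : 1 + A * s - A ≤ A * m := by
    rcases h.diff with hd | hd
    · rw [hd]; nlinarith
    · rw [hd]; nlinarith
  have hgap : 2 - 4 * A + 2 * A * s - s * s ≤ (1 - s - (1 - 2 * A) * ρ) * m := by nlinarith
  have hgap' : 54 / 47 + 2 / 25 * s ≤ (1 - s - (1 - 2 * A) * ρ) * m + s * s := by
    have : 1 / 25 ≤ A ∨ A ≤ 1 / 25 := le_total _ _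
    rcases this with h17 | h17
    · nlinarith
    · have : 0 < A * s := by positivity
      nlinarith
  have hbs : b + s ≤ 57 / 100 := by nlinarith [h.s_le_b, h.s_le]
  have hss : s * s ≤ 9 / 100 := by nlinarith
  have hX : 54 / 47 + 2 / 25 * s - s * s ≤ (1 - s - (1 - 2 * A) * ρ) * m := by linarith
  -- `q` is a lower bound for (m − b − s)/m. As b + s ≤ 57/100, it may be 1 − 57/400 when m ≥ 4 and
  -- 1 − 57/500 when m ≥ 5.
  have hq : ∃ q : ℝ, 0 < q ∧ q * m ≤ m - b - s ∧
      (1 - s) * (1 + s / 2) ≤ (54 / 47 + 2 / 25 * s - s * s) * q := by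
    rcases le_total N 5 with hN | hN
    · have h18 : m ≤ 6 := by have := h.sum; have := h.n_ge; linarith
      have h19 : 1 / 6 ≤ s := by nlinarith
      exact ⟨343 / 400, by norm_num, by linarith, by nlinarith⟩
    · exact ⟨443 / 500, by norm_num, by linarith, by nlinarith⟩
  have key : (1 - s) * (1 + s / 2) * m ≤ (1 - s - (1 - 2 * A) * ρ) * m * (m - b - s) := by
    obtain ⟨q, hq0, hq1, hq2⟩ := hq
    calc (1 - s) * (1 + s / 2) * m ≤ (54 / 47 + 2 / 25 * s - s * s) * q * m :=
          mul_le_mul_of_nonneg_right hq2 (by linarith)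
      _ = (54 / 47 + 2 / 25 * s - s * s) * (q * m) := by ring
      _ ≤ _ := mul_le_mul hX hq1 (mul_nonneg hq0.le (by linarith)) (by linarith)
  have h25 : 0 ≤ ((1 - s - (1 - 2 * A) * ρ) * (m - b - s) - (1 - s) * (1 + s / 2)) * m := by
    linarith
  have h26 := nonneg_of_mul_nonneg_left h25 (by linarith)
  nlinarith

/-- The critical case of `dual_odd`, where β − f = s and β = (1 − t)s. -/
theorem ρ_dual {N n m t κ s A b ρ : ℝ} (h : LargeParams N n m t κ s A b ρ) :
    ρ * (1 - A * s * (1 - t)) ≤ 1 - s := by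
  have h1 := h.ρ_def; have h2 := h.den_pos; have h3 := h.κ_le; have h4 := h.A_le_b
  have h5 := h.s_le_b; have h6 := h.t_le_b; have h7 := h.κ_mul_ge; have h8 := h.b_def
  have h9 := h.s_def; have h10 := h.t_lt_A; have h12 := h.four_le
  have h13 := h.b_pos; have h14 := h.A_pos; have h15 := h.s_pos; have h16 := h.t_pos
  have h17 := h.κ_pos
  have e : ((1 - s) - ρ * (1 - A * s * (1 - t))) * (m + t - A) =
      κ - A - s * s + s * (A - t) + A * (1 - t) * (1 + s * s + s * t - s - s * κ) := by
    linear_combination (-1 + A * s * (1 - t)) * h1 + (-1 + A * (1 - t)) * h9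
  have h18 : 1 - t - s - s * κ ≤ (1 - t) * (1 + s * s + s * t - s - s * κ) := by
    have ht := h.t_le
    nlinarith [mul_pos h15 h16, mul_pos (mul_pos h15 h16) h17, mul_pos h15 h15]
  have h19 : A * (1 - t - s - s * κ) ≤ A * ((1 - t) * (1 + s * s + s * t - s - s * κ)) :=
    mul_le_mul_of_nonneg_left h18 h14.le
  have h20 : 0 ≤ s * (A - t) := mul_nonneg h15.le (by linarith)
  have h21 : A * (t + s + s * κ) ≤ b * (b + b + b * (1 / 4)) := by gcongr
  have h22 : s * s ≤ b * b := by gcongr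
  have h23 : 13 / 4 * (b * b) ≤ κ := by
    have h24 : b * b * (13 / 4 * (N + 1 / 5)) ≤ 1 := by
      have h25 : (b * (N - 3 / 10)) * (b * (N - 3 / 10)) = 1 := by rw [h8]; norm_num
      have h26 : 0 ≤ b * b * ((N - 3 / 10) * (N - 3 / 10) - 13 / 4 * (N + 1 / 5)) := by
        apply mul_nonneg (by positivity)
        nlinarith
      nlinarith
    have h27 : 0 ≤ (κ - 13 / 4 * (b * b)) * (N + 1 / 5) := by nlinarith
    have := nonneg_of_mul_nonneg_left h27 (by linarith)
    linarith
  have h28 : 0 ≤ ((1 - s) - ρ * (1 - A * s * (1 - t))) * (m + t - A) := by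
    rw [e]; nlinarith
  have := nonneg_of_mul_nonneg_left h28 h2
  linarith

theorem dual_odd {N n m t κ s A b ρ : ℝ} (h : LargeParams N n m t κ s A b ρ) (β f : ℝ) (h0 : 0 ≤ β) (hf : -(κ * β) ≤ f)
    (hm : ρ * (1 - A * β) ≤ 1 - β + f) :
    (1 - 2 * A) * ρ * (n - s - β) ≤ (1 - s) * (n - 2 - β + f) := by
  have h1 := h.A_def; have h2 := h.five_le; have h3 := h.s_le
  have h4 : (1 - 2 * A) * (n - s) = n - s - 2 := by linear_combination -2 * h1
  have h5 : (1 - 2 * A) * ρ * (n - s - β) = (n - s - 2) * (ρ * (1 - A * β)) := by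
    linear_combination ρ * (1 - A * β) * h4 + (1 - 2 * A) * ρ * β * h1
  -- Replacing ρ(1 − Aβ) by its upper bound 1 − β + f leaves the difference (n − 3)(β − f − s), so
  -- the hypothesis suffices above the threshold. Below it, f ≥ −κβ gives β ≥ (1 − t)(β − f), and
  -- what remains is affine in β − f and is compared with its value at s.
  rcases le_total s (β - f) with hw | hw
  · have h6 : 0 ≤ (n - 3) * (β - f - s) := mul_nonneg (by linarith) (by linarith)
    have h7 : (n - s - 2) * (ρ * (1 - A * β)) ≤ (n - s - 2) * (1 - β + f) :=
      mul_le_mul_of_nonneg_left hm (by linarith)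
    rw [h5]
    nlinarith
  · have h6 := h.κ_def; have h7 := h.κ_pos; have h8 := h.t_le; have h9 := h.A_pos
    have h10 := h.ρ_pos; have h11 := h.ρ_dual
    have hβ : (1 - t) * (β - f) ≤ β := by nlinarith
    have h12 : (n - s - 2) * (ρ * (1 - A * β)) ≤
        (n - s - 2) * (ρ * (1 - A * ((1 - t) * (β - f)))) := by
      apply mul_le_mul_of_nonneg_left _ (by linarith)
      apply mul_le_mul_of_nonneg_left _ h10.le
      nlinarith
    have h13 : (n - s - 2) * (ρ * (1 - A * s * (1 - t))) ≤ (n - s - 2) * (1 - s) :=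
      mul_le_mul_of_nonneg_left h11 (by linarith)
    have h14 : (n - s - 2) * ρ * A ≤ 1 - s := by
      have h15 : (n - s - 2) * A = 1 - 2 * A := by linear_combination h1
      have := h.T_le; have := h.b_le_two_A; have := h.s_le_b
      nlinarith
    have h16 : 0 ≤ (1 - s - (n - s - 2) * ρ * A * (1 - t)) * (s - (β - f)) := by
      apply mul_nonneg _ (by linarith)
      have : 0 < (n - s - 2) * ρ * A := by
        apply mul_pos (mul_pos (by linarith) h10) h9
      nlinarith [h.t_pos]
    rw [h5]
    nlinarith

end LargeParams

theorem dual_corner_poly_odd {t s : ℝ} (ht : 0 < t) (ht5 : t ≤ 1 / 5) (hs : 0 < s)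
    (hs3 : s ≤ 3 / 10) (h : t * (1 + s * s) = s * (1 - t ^ 2 + t)) :
    0 ≤ (1 - s) * (1 - 3 * t + t ^ 2) * ((1 + t) * (1 - t ^ 2 - t * s) - t ^ 2) -
      (1 - t * s) * (1 - t ^ 2 - t * s - 2 * t) * (1 - t - t ^ 2) := by
  -- The root s of the quadratic relation has the expansion t − t² + 3t³ − 6t⁴ + .... Raising the
  -- last coefficient to −7/2 gives an upper bound `u` for s. The target decreases in s, so it is
  -- enough to check it at `u`, where it is t⁴ times an explicit positive polynomial.
  set u : ℝ := t - t ^ 2 + 3 * t ^ 3 - 7 / 2 * t ^ 4 with hu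
  have ht2 : t ^ 2 ≤ 1 / 25 := by nlinarith
  have hu0 : u ≤ 1 / 5 := by
    have : 0 ≤ t ^ 2 * (1 - 3 * t + 7 / 2 * t ^ 2) := by
      apply mul_nonneg (by positivity); nlinarith
    rw [hu]; linarith
  have hq : t * u * u - (1 - t ^ 2 + t) * u + t ≤ 0 := by
    have e : t * u * u - (1 - t ^ 2 + t) * u + t =
        -(t ^ 4 * (5 / 2 - 27 / 2 * t + 33 / 2 * t ^ 2 - 16 * t ^ 3 + 21 * t ^ 4
          - 49 / 4 * t ^ 5)) := by rw [hu]; ring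
    rw [e]
    have h1 : 0 ≤ 5 / 2 - 27 / 2 * t + 33 / 2 * t ^ 2 - 16 * t ^ 3 := by
      nlinarith [mul_nonneg ht.le (sub_nonneg.2 ht5), mul_nonneg (sq_nonneg t) (sub_nonneg.2 ht5)]
    have h2 : 0 ≤ t ^ 4 * (21 - 49 / 4 * t) := mul_nonneg (by positivity) (by linarith)
    have h3 : 0 ≤ t ^ 4 * (5 / 2 - 27 / 2 * t + 33 / 2 * t ^ 2 - 16 * t ^ 3 + 21 * t ^ 4
          - 49 / 4 * t ^ 5) := by
      apply mul_nonneg (by positivity); linarith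
    linarith
  have hsu : s ≤ u := by
    have h1 : (u - s) * ((1 - t ^ 2 + t) - t * (u + s)) ≥ 0 := by linarith
    have h2 : 0 < (1 - t ^ 2 + t) - t * (u + s) := by nlinarith
    have := nonneg_of_mul_nonneg_left h1 h2
    linarith
  have hD : 0 ≤ (1 - u) * (1 - 3 * t + t ^ 2) * ((1 + t) * (1 - t ^ 2 - t * u) - t ^ 2) -
      (1 - t * u) * (1 - t ^ 2 - t * u - 2 * t) * (1 - t - t ^ 2) := by
    have e : (1 - u) * (1 - 3 * t + t ^ 2) * ((1 + t) * (1 - t ^ 2 - t * u) - t ^ 2) -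
      (1 - t * u) * (1 - t ^ 2 - t * u - 2 * t) * (1 - t - t ^ 2) =
      t ^ 4 * (1 / 2 + 25 / 2 * t - 51 * t ^ 2 + 125 / 2 * t ^ 3 - 79 / 2 * t ^ 4
        + 105 / 4 * t ^ 5 + 65 / 4 * t ^ 6 - 217 / 4 * t ^ 7 + 49 / 2 * t ^ 8) := by
      rw [hu]; ring
    rw [e]
    apply mul_nonneg (by positivity)
    have h1 : 0 ≤ 25 / 2 * t - 51 * t ^ 2 := by nlinarith
    have h2 : 0 ≤ t ^ 3 * (125 / 2 - 79 / 2 * t) := mul_nonneg (by positivity) (by linarith)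
    have h3 : 0 ≤ t ^ 5 * (105 / 4 + 65 / 4 * t - 217 / 4 * t ^ 2) :=
      mul_nonneg (by positivity) (by nlinarith)
    have h4 : 0 ≤ 49 / 2 * t ^ 8 := by positivity
    linarith
  have hmono : ((1 - s) * (1 - 3 * t + t ^ 2) * ((1 + t) * (1 - t ^ 2 - t * s) - t ^ 2) -
      (1 - t * s) * (1 - t ^ 2 - t * s - 2 * t) * (1 - t - t ^ 2)) -
      ((1 - u) * (1 - 3 * t + t ^ 2) * ((1 + t) * (1 - t ^ 2 - t * u) - t ^ 2) -
      (1 - t * u) * (1 - t ^ 2 - t * u - 2 * t) * (1 - t - t ^ 2)) =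
      (u - s) * (1 - 3 * t - 2 * t ^ 2 + 5 * t ^ 3 - t ^ 4 - 2 * t ^ 5
        - (s + u) * (t - 3 * t ^ 2 - t ^ 3 + 2 * t ^ 4)) := by ring
  have hfac : 0 ≤ 1 - 3 * t - 2 * t ^ 2 + 5 * t ^ 3 - t ^ 4 - 2 * t ^ 5
        - (s + u) * (t - 3 * t ^ 2 - t ^ 3 + 2 * t ^ 4) := by
    have h1 : 0 ≤ t ^ 3 * (5 - t - 2 * t ^ 2) := mul_nonneg (by positivity) (by nlinarith)
    have h2 : t - 3 * t ^ 2 - t ^ 3 + 2 * t ^ 4 ≤ t := by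
      have : 0 ≤ t ^ 2 * (3 + t - 2 * t ^ 2) := mul_nonneg (by positivity) (by nlinarith)
      linarith
    have h3 : (s + u) * (t - 3 * t ^ 2 - t ^ 3 + 2 * t ^ 4) ≤ (s + u) * t :=
      mul_le_mul_of_nonneg_left h2 (by linarith)
    nlinarith
  have := mul_nonneg (sub_nonneg.2 hsu) hfac
  linarith

theorem dual_corner_poly_even {t s : ℝ} (ht : 0 < t) (ht5 : t ≤ 1 / 5) (hs : 0 < s)
    (hs3 : s ≤ 3 / 10) (h : t * (1 + s * s) = s * (1 - t ^ 2 - t)) :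
    0 ≤ (1 - s) * (1 - 3 * t + t ^ 2) * ((1 - t) * (1 - t ^ 2 - t * s) - t ^ 2) -
      (1 - t * s) * (1 - t ^ 2 - t * s - 2 * t) * (1 - 3 * t + t ^ 2) := by
  have hc : 0 ≤ 1 - 3 * t + t ^ 2 := by nlinarith
  have e : (1 - s) * (1 - 3 * t + t ^ 2) * ((1 - t) * (1 - t ^ 2 - t * s) - t ^ 2) -
      (1 - t * s) * (1 - t ^ 2 - t * s - 2 * t) * (1 - 3 * t + t ^ 2) =
      (1 - 3 * t + t ^ 2) * (t ^ 2 * (t + s * (1 - t - s))) := by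
    linear_combination (1 - 3 * t + t ^ 2) * (1 - t) * h
  rw [e]
  apply mul_nonneg hc
  have : 0 ≤ s * (1 - t - s) := mul_nonneg hs.le (by linarith)
  positivity

/-- The relations n = (1 − t²)/t and κ = t/(1 − t), with ρ and A eliminated by their defining
equations, turn this into a polynomial inequality in t and s. The cases m = n + 1 and m = n − 1 give
different polynomials. -/
theorem LargeParams.dual_corner {N n m t κ s A b ρ : ℝ} (h : LargeParams N n m t κ s A b ρ) :
    (1 - 2 * A) * ρ * (n + t - s) ≤ (1 - s) * (n + t - 2 - κ) := by
  have ht := h.t_pos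
  have ht5 := h.t_le
  have hden := h.den_pos
  have hn5 := h.five_le
  have hs3 := h.s_le
  have hns : 0 < n - s := by linarith
  have hρ := h.ρ_def
  have hA := h.A_def
  have hsd := h.s_def
  have htd := h.t_def
  have hκ : κ = t / (1 - t) := by
    rw [eq_div_iff (by linarith)]
    exact h.κ_def
  have hn : n = (1 - t ^ 2) / t := by
    rw [eq_div_iff ht.ne']
    linear_combination htd
  have key : 0 ≤ (1 - s) * (n + t - 2 - κ) * ((n - s) * (m + t) - 1) -
      (n - s - 2) * (m + t - 1 - κ) * (n + t - s) := by
    have h1t : (1 - t : ℝ) ≠ 0 := by linarith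
    rcases h.diff with hd | hd
    · have hp := dual_corner_poly_odd ht ht5 h.s_pos hs3 (by
        rw [hd] at hsd
        linear_combination -t * hsd + s * htd)
      have e : ((1 - s) * (n + t - 2 - κ) * ((n - s) * (m + t) - 1) -
          (n - s - 2) * (m + t - 1 - κ) * (n + t - s)) * (t ^ 3 * (1 - t)) =
          (1 - s) * (1 - 3 * t + t ^ 2) * ((1 + t) * (1 - t ^ 2 - t * s) - t ^ 2) -
          (1 - t * s) * (1 - t ^ 2 - t * s - 2 * t) * (1 - t - t ^ 2) := by
        rw [hd, hκ, hn]
        field_simp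
        ring
      rw [← e] at hp
      exact nonneg_of_mul_nonneg_left hp (mul_pos (by positivity) (by linarith))
    · have hp := dual_corner_poly_even ht ht5 h.s_pos hs3 (by
        rw [hd] at hsd
        linear_combination -t * hsd + s * htd)
      have e : ((1 - s) * (n + t - 2 - κ) * ((n - s) * (m + t) - 1) -
          (n - s - 2) * (m + t - 1 - κ) * (n + t - s)) * (t ^ 3 * (1 - t)) =
          (1 - s) * (1 - 3 * t + t ^ 2) * ((1 - t) * (1 - t ^ 2 - t * s) - t ^ 2) -
          (1 - t * s) * (1 - t ^ 2 - t * s - 2 * t) * (1 - 3 * t + t ^ 2) := by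
        rw [hd, hκ, hn]
        field_simp
        ring
      rw [← e] at hp
      exact nonneg_of_mul_nonneg_left hp (mul_pos (by positivity) (by linarith))
  have e : ((1 - s) * (n + t - 2 - κ) - (1 - 2 * A) * ρ * (n + t - s)) *
      ((m + t - A) * (n - s)) = (1 - s) * (n + t - 2 - κ) * ((n - s) * (m + t) - 1) -
      (n - s - 2) * (m + t - 1 - κ) * (n + t - s) := by
    linear_combination (-(1 - s) * (n + t - 2 - κ) + 2 * (n + t - s) * (m + t - 1 - κ)) * hA -
      (1 - 2 * A) * (n - s) * (n + t - s) * hρ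
  rw [← e] at key
  have := nonneg_of_mul_nonneg_left key (mul_pos hden hns)
  linarith

/-- The data attached to `R ≥ 4`. -/
def LargeParams.cellData {N n m t κ s A b ρ : ℝ} (h : LargeParams N n m t κ s A b ρ) : CellData where
  n := n
  m := m
  r := N
  t := t
  κ := κ
  s := s
  A := A
  b := b
  c := b
  ρ := ρ
  t_pos := h.t_pos
  κ_pos := h.κ_pos
  κ_half := by linarith [h.κ_le]
  t_eq := h.κ_def
  n_eq := h.n_eq
  s_pos := h.s_pos
  s_lt := by linarith [h.s_le]
  A_pos := h.A_pos
  A_lt := by linarith [h.A_le_quarter]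
  A_eq := h.A_def
  b_pos := h.b_pos
  b_lt := by linarith [h.b_le]
  b_eq := by have := h.b_def; have := h.b_le; have := h.b_pos; nlinarith
  c_pos := h.b_pos
  c_lt := by linarith [h.b_le, h.κ_le]
  c_le := by linarith [h.b_le]
  ρ_pos := h.ρ_pos
  ρ_lt := h.ρ_lt
  ρ_eq := h.ρ_def
  three_le := by linarith [h.five_le]
  T_add_c := by linarith [h.T_le, h.b_le_two_A]
  T_add_κ := by linarith [h.T_le, h.κ_le_two_A]
  T_add_s := by linarith [h.T_le, h.b_le_two_A, h.s_le_b]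
  ρ_corner := h.ρ_corner
  κ_even := h.κ_even
  κ_odd := h.κ_odd
  ρ_even := h.ρ_even
  dual_corner := h.dual_corner
  dual_odd := fun β f h0 _ hf hm => h.dual_odd β f h0 hf hm
  dual_even := h.dual_even
  T_b := h.T_b

/-! ### The parameter inequalities for R = 2 and R = 3 -/

/-- Relations between the parameters belonging to `R = 2` and `R = 3`. -/
structure SmallParams (t κ s A c ρ : ℝ) : Prop where
  t_ge : 30277 / 100000 ≤ t
  t_le : t ≤ 30278 / 100000
  t_def : t * (3 + t) = 1
  κ_def : κ * (1 - t) = t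
  s_pos : 0 < s
  s_le : s ≤ 1 / 2
  A_ge : 366 / 1000 ≤ A
  A_le : A ≤ 2 / 5
  A_def : A * (3 - s) = 1
  c_pos : 0 < c
  c_le : c ≤ 1 / 2
  ρ_def : ρ * (4 + t - A) = 3 + t - κ

namespace SmallParams

variable {t κ s A c ρ : ℝ}

theorem κ_bounds (h : SmallParams t κ s A c ρ) : 4342 / 10000 ≤ κ ∧ κ ≤ 4343 / 10000 := by
  have h1 := h.t_ge; have h2 := h.t_le; have h3 := h.κ_def
  constructor <;> nlinarith

theorem ρ_bounds (h : SmallParams t κ s A c ρ) : 728 / 1000 ≤ ρ ∧ ρ ≤ 7352 / 10000 := by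
  have h1 := h.t_ge; have h2 := h.t_le; have h3 := h.ρ_def; have h4 := h.A_ge; have h5 := h.A_le
  obtain ⟨h6, h7⟩ := h.κ_bounds
  constructor <;> nlinarith

theorem n_eq (h : SmallParams t κ s A c ρ) : κ * 3 = 1 + t := by
  have h1 := h.t_ge; have h2 := h.t_def; have h3 := h.κ_def
  have : t * (κ * 3 - (1 + t)) = 0 := by linear_combination κ * h2 + (1 + t) * h3
  rcases mul_eq_zero.1 this with h4 | h4 <;> linarith

/-- For n = 3 one has 1 − 2A = (1 − s)A, so the factor 1 − s cancels from all three dual conditions.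
-/
theorem T_eq (h : SmallParams t κ s A c ρ) : (1 - 2 * A) * ρ = (1 - s) * (A * ρ) := by
  linear_combination (-ρ) * h.A_def

theorem T_le (h : SmallParams t κ s A c ρ) : (1 - 2 * A) * ρ ≤ 1 / 5 := by
  have h4 := h.A_ge; have h5 := h.A_le
  obtain ⟨h6, h7⟩ := h.ρ_bounds
  nlinarith

/-- The data attached to `R = 2` and `R = 3`. -/
def cellData (h : SmallParams t κ s A c ρ) : CellData where
  n := 3
  m := 4
  r := 3
  t := t
  κ := κ
  s := s
  A := A
  -- Just above the smaller root (3 − √5)/2 of b(3 − b) = 1.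
  b := 382 / 1000
  c := c
  ρ := ρ
  t_pos := by linarith [h.t_ge]
  κ_pos := by linarith [h.κ_bounds.1]
  κ_half := by linarith [h.κ_bounds.2]
  t_eq := h.κ_def
  n_eq := h.n_eq
  s_pos := h.s_pos
  s_lt := by linarith [h.s_le]
  A_pos := by linarith [h.A_ge]
  A_lt := by linarith [h.A_le]
  A_eq := h.A_def
  b_pos := by norm_num
  b_lt := by norm_num
  b_eq := by norm_num
  c_pos := h.c_pos
  c_lt := by linarith [h.c_le, h.κ_bounds.2]
  c_le := h.c_le
  ρ_pos := by linarith [h.ρ_bounds.1]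
  ρ_lt := by linarith [h.ρ_bounds.2]
  ρ_eq := by linear_combination h.ρ_def
  three_le := le_rfl
  T_add_c := by linarith [h.T_le, h.c_le]
  T_add_κ := by linarith [h.T_le, h.κ_bounds.2]
  T_add_s := by linarith [h.T_le, h.s_le]
  ρ_corner := by
    have h1 := h.c_le; have h2 := h.c_pos; have h3 := h.t_le; have h4 := h.t_ge
    obtain ⟨h5, h6⟩ := h.ρ_bounds
    obtain ⟨h7, h8⟩ := h.κ_bounds
    have h9 : ρ * (1 + c * t) ≤ 7352 / 10000 * (1 + 1 / 2 * (30278 / 100000)) := by gcongr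
    have h10 : κ * t ≤ 4343 / 10000 * (30278 / 100000) := by gcongr
    norm_num at h9 h10
    linarith
  κ_even := by linarith [h.t_ge, h.κ_bounds.2]
  κ_odd := by linarith [h.ρ_bounds.2, h.κ_bounds.2]
  ρ_even := by
    have h3 := h.t_le; have h4 := h.t_ge
    obtain ⟨h5, h6⟩ := h.ρ_bounds
    obtain ⟨h7, h8⟩ := h.κ_bounds
    nlinarith
  dual_corner := by
    have h3 := h.t_le; have h4 := h.t_ge; have h1 := h.A_le; have h2 := h.A_ge
    obtain ⟨h5, h6⟩ := h.ρ_bounds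
    obtain ⟨h7, h8⟩ := h.κ_bounds
    rw [h.T_eq, mul_assoc]
    apply mul_le_mul_of_nonneg_left _ (by linarith [h.s_le])
    have h9 : ρ * (1 + A * t) ≤ 7352 / 10000 * (1 + 2 / 5 * (30278 / 100000)) := by gcongr
    have h10 : A * ρ * (3 + t - s) = ρ * (1 + A * t) := by linear_combination ρ * h.A_def
    rw [h10]
    norm_num at h9
    linarith
  dual_odd := by
    intro β f _ _ _ hm
    have h1 : (1 - 2 * A) * ρ * (3 - s - β) = (1 - s) * (ρ * (1 - A * β)) := by
      rw [h.T_eq]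
      linear_combination (1 - s) * ρ * h.A_def
    rw [h1]
    calc _ ≤ (1 - s) * (1 - β + f) := mul_le_mul_of_nonneg_left hm (by linarith [h.s_le])
      _ = _ := by ring
  dual_even := by
    have h1 := h.A_le; have h2 := h.A_ge
    obtain ⟨h5, h6⟩ := h.ρ_bounds
    obtain ⟨h7, h8⟩ := h.κ_bounds
    rw [h.T_eq, mul_assoc]
    apply mul_le_mul_of_nonneg_left _ (by linarith [h.s_le])
    have h9 : ρ * (1 + A * (618 / 1000)) ≤ 7352 / 10000 * (1 + 2 / 5 * (618 / 1000)) := by gcongr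
    have h10 : A * ρ * (4 - 382 / 1000 - s) = ρ * (1 + A * (618 / 1000)) := by
      linear_combination ρ * h.A_def
    rw [h10]
    norm_num at h9
    linarith
  T_b := by
    have h1 := h.T_le; have h2 := h.c_le; have h3 := h.c_pos
    obtain ⟨h7, h8⟩ := h.κ_bounds
    have h9 : (1 - 2 * A) * ρ * (1 + c * (382 / 1000)) ≤ 1 / 5 * (1 + 1 / 2 * (382 / 1000)) := by
      gcongr
    norm_num at h9
    linarith

end SmallParams

/-! ### The constants of the bound and the factorization of M₁ -/

/-- The second left coordinate `κ = θ₁ / (1 - θ₁)` fixed by an odd step. -/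
def kappa (R : ℕ) : ℝ := theta1 R / (1 - theta1 R)

/-- The largest value `1 / (R_* - θ₂)` of a tail starting with an odd partial quotient. -/
def oddTail (R : ℕ) : ℝ := 1 / (Rodd R - theta2 R)

/-- The even partial quotient occurring in the bound. -/
def evenQuot (R : ℕ) : ℝ := max 4 (Reven R)

/-- The second factor of the bound. -/
def leftFactor (R : ℕ) : ℝ :=
  (evenQuot R + theta1 R - 1 - kappa R) / (evenQuot R + theta1 R - oddTail R)

theorem Rodd_ge {R : ℕ} (hR : 2 ≤ R) : 3 ≤ Rodd R := by
  unfold Rodd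
  split_ifs with h
  · rcases h with ⟨j, rfl⟩; omega
  · omega

theorem theta1_eq (R : ℕ) : theta1 R * (Rodd R + theta1 R) = 1 := by
  have h : √((Rodd R : ℝ) ^ 2 + 4) ^ 2 = (Rodd R : ℝ) ^ 2 + 4 := Real.sq_sqrt (by positivity)
  unfold theta1
  linear_combination 1 / 4 * h

theorem theta1_pos (R : ℕ) : 0 < theta1 R := by
  unfold theta1
  have : (Rodd R : ℝ) < √((Rodd R : ℝ) ^ 2 + 4) := by
    apply Real.lt_sqrt_of_sq_lt; linarith
  linarith

theorem theta1_lt {R : ℕ} (hR : 2 ≤ R) : theta1 R < 1 / 3 := by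
  have h1 := theta1_eq R
  have h2 := theta1_pos R
  have h3 : (3 : ℝ) ≤ Rodd R := by exact_mod_cast Rodd_ge hR
  nlinarith

theorem Reven_ge {R : ℕ} (hR : 3 ≤ R) : 4 ≤ Reven R := by
  unfold Reven
  split_ifs with h
  · rcases h with ⟨j, rfl⟩; omega
  · omega

theorem theta2_eq {R : ℕ} (hR : 3 ≤ R) : theta2 R * (Reven R - theta2 R) = 1 := by
  have h4 : (4 : ℝ) ≤ Reven R := by exact_mod_cast Reven_ge hR
  have h : √((Reven R : ℝ) ^ 2 - 4) ^ 2 = (Reven R : ℝ) ^ 2 - 4 := Real.sq_sqrt (by nlinarith)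
  unfold theta2
  rw [if_pos hR]
  linear_combination -1 / 4 * h

theorem theta2_pos (R : ℕ) : 0 < theta2 R := by
  unfold theta2
  split_ifs with hR
  · have h4 : (4 : ℝ) ≤ Reven R := by exact_mod_cast Reven_ge hR
    have : √((Reven R : ℝ) ^ 2 - 4) < (Reven R : ℝ) := by
      rw [Real.sqrt_lt' (by linarith)]; linarith
    linarith
  · norm_num

theorem theta2_le {R : ℕ} (hR : 3 ≤ R) : theta2 R ≤ 3 / 10 := by
  have h4 : (4 : ℝ) ≤ Reven R := by exact_mod_cast Reven_ge hR
  unfold theta2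
  rw [if_pos hR]
  have : (Reven R : ℝ) - 3 / 5 ≤ √((Reven R : ℝ) ^ 2 - 4) := by
    apply Real.le_sqrt_of_sq_le; nlinarith
  linarith

theorem theta2_le_half (R : ℕ) : theta2 R ≤ 1 / 2 := by
  by_cases hR : 3 ≤ R
  · linarith [theta2_le hR]
  · unfold theta2; rw [if_neg hR]

theorem oddTail_eq {R : ℕ} (hR : 2 ≤ R) : oddTail R * (Rodd R - theta2 R) = 1 := by
  have h3 : (3 : ℝ) ≤ Rodd R := by exact_mod_cast Rodd_ge hR
  have := theta2_le_half R
  unfold oddTail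
  rw [one_div, inv_mul_cancel₀]
  linarith

theorem kappa_eq {R : ℕ} (hR : 2 ≤ R) : kappa R * (1 - theta1 R) = theta1 R := by
  have := theta1_lt hR
  unfold kappa
  rw [div_mul_cancel₀]
  linarith

theorem oddTail_le {R : ℕ} (hR : 2 ≤ R) : oddTail R ≤ 2 / 5 := by
  have h3 : (3 : ℝ) ≤ Rodd R := by exact_mod_cast Rodd_ge hR
  have := theta2_le_half R
  unfold oddTail
  rw [div_le_div_iff₀ (by linarith) (by norm_num)]
  linarith

theorem four_le_evenQuot (R : ℕ) : 4 ≤ evenQuot R := le_max_left _ _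

theorem leftFactor_eq {R : ℕ} (hR : 2 ≤ R) :
    leftFactor R * (evenQuot R + theta1 R - oddTail R) = evenQuot R + theta1 R - 1 - kappa R := by
  have := oddTail_le hR
  have := four_le_evenQuot R
  have := theta1_pos R
  unfold leftFactor
  rw [div_mul_cancel₀]
  linarith

/-- Because θ₁²/(1 − θ₁) = κ − θ₁, multiplying numerator and denominator of the bound by the even
quotient exposes the factor ρ. -/
theorem four_mul_M1 {R : ℕ} (hR : 2 ≤ R) : 4 * M1 R = (1 - 2 * oddTail R) * leftFactor R := by
  have h1 := oddTail_le hR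
  have h2 := four_le_evenQuot R
  have h3 := theta1_pos R
  have h4 := theta1_lt hR
  have h5 : (1 - theta1 R : ℝ) ≠ 0 := by linarith
  have h6 : evenQuot R + theta1 R - oddTail R ≠ 0 := by linarith
  have h7 : evenQuot R ≠ 0 := by linarith
  have h8 : (1 + 1 / evenQuot R * (theta1 R - oddTail R)) ≠ 0 := by
    have : 1 + 1 / evenQuot R * (theta1 R - oddTail R) =
      (evenQuot R + theta1 R - oddTail R) / evenQuot R := by field_simp; ring
    rw [this]
    positivity
  have e : M1 R = 1 / 4 * ((1 - 2 * oddTail R) *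
      (1 - 1 / evenQuot R * (1 + theta1 R ^ 2 / (1 - theta1 R)))) /
      (1 + 1 / evenQuot R * (theta1 R - oddTail R)) := by
    unfold M1 oddTail evenQuot
    ring_nf
  have e1 : 1 - 1 / evenQuot R * (1 + theta1 R ^ 2 / (1 - theta1 R)) =
      (evenQuot R + theta1 R - 1 - kappa R) / evenQuot R := by
    unfold kappa; field_simp; ring
  have e2 : 1 + 1 / evenQuot R * (theta1 R - oddTail R) =
      (evenQuot R + theta1 R - oddTail R) / evenQuot R := by field_simp; ring
  rw [e, e1, e2, leftFactor]
  field_simp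

/-! ### Bounds for the right coordinates -/

/-- A bounded sequence all of whose positive parts contract backwards is nonpositive. -/
theorem nonpos_of_contracting {u : ℕ → ℝ} {C q : ℝ} (hq0 : 0 ≤ q) (hq : q < 1)
    (hC : ∀ k, u k ≤ C) (h : ∀ k, u k ≤ q * max 0 (u (k + 1))) (k : ℕ) : u k ≤ 0 := by
  have hC' : ∀ k, max 0 (u k) ≤ max 0 C := fun k => max_le_max le_rfl (hC k)
  have h1 : ∀ j k, max 0 (u k) ≤ q ^ j * max 0 C := by
    intro j
    induction j with
    | zero => intro k; simpa using hC' k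
    | succ j ih =>
      intro k
      have h2 : 0 ≤ q ^ (j + 1) * max 0 C := mul_nonneg (pow_nonneg hq0 _) (le_max_left _ _)
      refine max_le h2 ((h k).trans ?_)
      calc q * max 0 (u (k + 1)) ≤ q * (q ^ j * max 0 C) :=
            mul_le_mul_of_nonneg_left (ih _) hq0
        _ = q ^ (j + 1) * max 0 C := by ring
  have h2 : Tendsto (fun j => q ^ j * max 0 C) atTop (𝓝 (0 * max 0 C)) :=
    (tendsto_pow_atTop_nhds_zero_of_lt_one hq0 hq).mul_const _
  rw [zero_mul] at h2
  exact (le_max_right _ _).trans (ge_of_tendsto' h2 fun j => h1 j k)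

/-- Sequences of partial quotients and signs, with the corresponding tails and right
coordinates. -/
structure RightSystem (a : ℕ → ℕ) (e α g : ℕ → ℝ) : Prop where
  two_le : ∀ k, 2 ≤ a k
  sign : ∀ k, e k = 1 ∨ e k = -1
  two : ∀ k, a k = 2 → e k = 1
  pos : ∀ k, 0 < α k
  lt : ∀ k, α k < 1 / 2
  tail : ∀ k, α k * (a k + e k * α (k + 1)) = 1
  right : ∀ k, g k = if Odd (a k) then α k * (1 - g (k + 1)) else α k * g (k + 1)
  bdd : ∀ k, |g k| ≤ 1

namespace RightSystem

variable {a : ℕ → ℕ} {e α g : ℕ → ℝ}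

theorem shift (h : RightSystem a e α g) (j : ℕ) :
    RightSystem (fun k => a (j + k)) (fun k => e (j + k)) (fun k => α (j + k))
      (fun k => g (j + k)) where
  two_le _ := h.two_le _
  sign _ := h.sign _
  two _ := h.two _
  pos _ := h.pos _
  lt _ := h.lt _
  tail _ := h.tail _
  right _ := h.right _
  bdd _ := h.bdd _

/-- The recursion runs backwards from infinity and has no initial value. Instead, the violation
max(−g, g − α) at an index is at most half the positive part of the next one and is bounded, hence
it is nonpositive. The same mechanism gives `le_b` and `slope_le`. -/
theorem g_nonneg (h : RightSystem a e α g) (k : ℕ) : 0 ≤ g k ∧ g k ≤ α k := by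
  have hu := nonpos_of_contracting (u := fun k => max (-g k) (g k - α k)) (C := 1) (q := 1 / 2)
    (by norm_num) (by norm_num)
    (fun k => max_le (by linarith [(abs_le.1 (h.bdd k)).1])
      (by linarith [(abs_le.1 (h.bdd k)).2, h.pos k])) (fun k => by
      have hr := h.right k
      have h1 := h.pos k
      have h2 := h.lt k
      have h3 := h.lt (k + 1)
      have h4 := h.pos (k + 1)
      set M := max 0 (max (-g (k + 1)) (g (k + 1) - α (k + 1))) with hM
      have hM0 : 0 ≤ M := le_max_left _ _
      have hM1 : -g (k + 1) ≤ M := (le_max_left _ _).trans (le_max_right _ _)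
      have hM2 : g (k + 1) - α (k + 1) ≤ M := (le_max_right _ _).trans (le_max_right _ _)
      have h5 : α k * M ≤ 1 / 2 * M := mul_le_mul_of_nonneg_right h2.le hM0
      by_cases ho : Odd (a k)
      · rw [if_pos ho] at hr
        refine max_le ?_ ?_ <;> rw [hr] <;> nlinarith
      · rw [if_neg ho] at hr
        refine max_le ?_ ?_ <;> rw [hr] <;> nlinarith) k
  have h1 := (le_max_left _ _).trans hu
  have h2 := (le_max_right _ _).trans hu
  constructor <;> linarith

theorem le_sub (h : RightSystem a e α g) (k : ℕ) :
    (a k : ℝ) - α (k + 1) ≤ a k + e k * α (k + 1) := by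
  rcases h.sign k with h1 | h1 <;> rw [h1] <;> linarith [h.pos (k + 1)]

/-- The right coordinates lie in the required region when `R = 2`. -/
theorem right_of_two (h : RightSystem a e α g) {P : CellData} (hc : P.c = 1 / 2)
    (hs : P.s = 1 / 2) (hA : P.A = 2 / 5) (k : ℕ) : P.Right (α k) (g k) := by
  obtain ⟨h0, h1⟩ := h.g_nonneg k
  obtain ⟨h2, h3⟩ := h.g_nonneg (k + 1)
  have h4 := h.lt k
  have h5 := h.lt (k + 1)
  have h6 := h.pos k
  have h7 := h.pos (k + 1)
  have ht := h.tail k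
  have hr := h.right k
  have hle := h.le_sub k
  refine ⟨h0, h1, by linarith, ?_, by linarith⟩
  rw [hA]
  by_cases ho : Odd (a k)
  · rw [if_pos ho] at hr
    have h3 : (3 : ℝ) ≤ a k := by
      have := h.two_le k
      have : 3 ≤ a k := by rcases ho with ⟨j, hj⟩; omega
      exact_mod_cast this
    nlinarith
  · rw [if_neg ho] at hr
    rcases (h.two_le k).eq_or_lt with h8 | h8
    · rw [h.two k h8.symm, ← h8] at ht
      push_cast at ht
      nlinarith
    · have : (3 : ℝ) ≤ a k := by exact_mod_cast h8
      nlinarith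

/-- Further relations between the parameters, valid for `R ≥ 3`. -/
structure Wide (P : CellData) : Prop where
  three_le : 3 ≤ P.r
  c_eq : P.c = P.b
  s_eq : P.s * (P.m - P.s) = 1
  n_le : P.n ≤ P.m + 1
  odd : 1 - (P.n - P.s) / 4 ≤ P.s * (P.n - 1 / 2)
  even : 1 + P.b ≤ 2 * P.A * (P.m - P.b)
  b_sq : P.b * P.b ≤ P.s

theorem le_b (h : RightSystem a e α g) {P : CellData}
    (ha : ∀ k, P.Admits (a k)) (h3 : ∀ k, 3 ≤ a k) (hP : Wide P) (k : ℕ) : α k ≤ P.b := by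
  have hb0 := P.b_pos
  have hb1 := P.b_lt
  have hr3 := hP.three_le
  have := nonpos_of_contracting (u := fun k => α k - P.b) (C := 1) (q := P.b) hb0.le hb1
    (fun k => by linarith [h.lt k]) (fun k => by
      have h1 := h.pos k
      have h2 := h.lt (k + 1)
      have h4 := h.tail k
      have h5 := h.le_sub k
      have h6 := (ha k).big (h3 k)
      have h7 := P.b_eq
      have h8 : (α k - P.b) * (P.r - α (k + 1)) ≤ P.b * (α (k + 1) - P.b) := by nlinarith
      have h9 : P.b * (α (k + 1) - P.b) ≤ P.b * max 0 (α (k + 1) - P.b) :=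
        mul_le_mul_of_nonneg_left (le_max_right _ _) hb0.le
      have h10 : 0 ≤ P.b * max 0 (α (k + 1) - P.b) := mul_nonneg hb0.le (le_max_left _ _)
      rcases le_total (α k - P.b) 0 with h11 | h11
      · exact h11.trans h10
      · change α k - P.b ≤ P.b * max 0 (α (k + 1) - P.b)
        nlinarith) k
  linarith

/-- The line of slope 2A through (s, 0) is what the next estimate requires: after an odd quotient n
with a minus sign, α + g ≤ 2A means 2 − g' ≤ 2A(n − α'), and 2A(n − s) = 2. -/
theorem slope_le (h : RightSystem a e α g) {P : CellData}
    (ha : ∀ k, P.Admits (a k)) (h3 : ∀ k, 3 ≤ a k) (hP : Wide P) (k : ℕ) :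
    2 * P.A * (α k - P.s) ≤ g k := by
  have hodd := hP.odd
  have hs := hP.s_eq
  have hA0 := P.A_pos
  have hA1 := P.A_eq
  have hs0 := P.s_pos
  have hs1 := P.s_lt
  have := nonpos_of_contracting (u := fun k => 2 * P.A * (α k - P.s) - g k) (C := 1) (q := 1 / 2)
    (by norm_num) (by norm_num) (fun k => by
      have h1 := P.A_lt
      have h2 := h.lt k
      have h4 := (h.g_nonneg k).1
      nlinarith) (fun k => by
      have h1 := h.pos k
      have h2 := h.lt k
      have h2' := h.lt (k + 1)
      have h4 := h.tail k
      have h5 := h.le_sub k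
      obtain ⟨h6, h7⟩ := h.g_nonneg (k + 1)
      have h8 := h.right k
      have h9 := h.pos (k + 1)
      set U := max 0 (2 * P.A * (α (k + 1) - P.s) - g (k + 1)) with hU
      have hU0 : 0 ≤ U := le_max_left _ _
      have hU1 : 2 * P.A * (α (k + 1) - P.s) - g (k + 1) ≤ U := le_max_right _ _
      change 2 * P.A * (α k - P.s) - g k ≤ 1 / 2 * U
      by_cases ho : Odd (a k)
      · rw [if_pos ho] at h8
        have hn := (ha k).odd ho
        have e1 : 2 * P.A * (α k - P.s) - g k = α k * (2 * P.A * (1 - P.s * (a k + e k * α (k + 1)))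
            - (1 - g (k + 1))) := by
          linear_combination (2 * P.A * P.s) * h4 - h8
        have h10 : P.s * (P.n - 1 / 2) ≤ P.s * (a k + e k * α (k + 1)) :=
          mul_le_mul_of_nonneg_left (by linarith) hs0.le
        have h11 : 2 * P.A * (1 - P.s * (a k + e k * α (k + 1))) ≤ 2 * P.A * ((P.n - P.s) / 4) :=
          mul_le_mul_of_nonneg_left (by linarith) (by linarith)
        have h12 : 2 * P.A * (1 - P.s * (a k + e k * α (k + 1))) - (1 - g (k + 1)) ≤ 0 := by
          nlinarith
        rw [e1]
        nlinarith
      · rw [if_neg ho] at h8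
        have hm := (ha k).even (Nat.not_odd_iff_even.1 ho) (h3 k)
        have e1 : 2 * P.A * (α k - P.s) - g k = α k * (2 * P.A * (1 - P.s * (a k + e k * α (k + 1)))
            - g (k + 1)) := by
          linear_combination (2 * P.A * P.s) * h4 - h8
        have h10 : P.s * (P.m - α (k + 1)) ≤ P.s * (a k + e k * α (k + 1)) :=
          mul_le_mul_of_nonneg_left (by linarith) hs0.le
        have h11 : 2 * P.A * (1 - P.s * (a k + e k * α (k + 1))) ≤
            P.s * (2 * P.A * (α (k + 1) - P.s)) := by nlinarith
        have h12 : 2 * P.A * (1 - P.s * (a k + e k * α (k + 1))) - g (k + 1) ≤ U := by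
          nlinarith
        rw [e1]
        calc _ ≤ α k * U := mul_le_mul_of_nonneg_left h12 h1.le
          _ ≤ _ := mul_le_mul_of_nonneg_right h2.le hU0) k
  linarith

theorem add_le (h : RightSystem a e α g) {P : CellData}
    (ha : ∀ k, P.Admits (a k)) (h3 : ∀ k, 3 ≤ a k) (hP : Wide P) (k : ℕ) : α k + g k ≤ 2 * P.A := by
  have heven := hP.even
  have hA0 := P.A_pos
  have hA1 := P.A_eq
  obtain ⟨h0, h1⟩ := h.g_nonneg k
  obtain ⟨h2, h4⟩ := h.g_nonneg (k + 1)
  have h5 := h.slope_le ha h3 hP (k + 1)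
  have h6 := h.tail k
  have h7 := h.le_sub k
  have h8 := h.right k
  have h9 := h.le_b ha h3 hP (k + 1)
  have h10 := h.pos k
  have h11 := h.le_b ha h3 hP k
  by_cases ho : Odd (a k)
  · rw [if_pos ho] at h8
    have hn := (ha k).odd ho
    have h12 : 2 - g (k + 1) ≤ 2 * P.A * (a k + e k * α (k + 1)) := by
      have : 2 * P.A * (P.n - α (k + 1)) ≤ 2 * P.A * (a k + e k * α (k + 1)) :=
        mul_le_mul_of_nonneg_left (by linarith) (by linarith)
      nlinarith
    have h13 := mul_le_mul_of_nonneg_left h12 h10.le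
    nlinarith
  · rw [if_neg ho] at h8
    have hm := (ha k).even (Nat.not_odd_iff_even.1 ho) (h3 k)
    have h12 : 1 + g (k + 1) ≤ 2 * P.A * (a k + e k * α (k + 1)) := by
      have : 2 * P.A * (P.m - P.b) ≤ 2 * P.A * (a k + e k * α (k + 1)) :=
        mul_le_mul_of_nonneg_left (by linarith) (by linarith)
      linarith
    have h13 := mul_le_mul_of_nonneg_left h12 h10.le
    nlinarith

/-- After an even quotient the worst case requires 1 − g' ≤ s(m − α'). Since s(m − s) = 1 this is g'
≥ s(α' − s), which follows from `slope_le` and s ≤ 2A. After an odd quotient α − g = αg' is at most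
b². -/
theorem sub_le (h : RightSystem a e α g) {P : CellData}
    (ha : ∀ k, P.Admits (a k)) (h3 : ∀ k, 3 ≤ a k) (hP : Wide P) (k : ℕ) : α k - g k ≤ P.s := by
  have hs := hP.s_eq
  have hnm := hP.n_le
  have hb := hP.b_sq
  have hb0 := P.b_pos
  have hA0 := P.A_pos
  have hA1 := P.A_eq
  have hs0 := P.s_pos
  have hs1 := P.s_lt
  have hn3 := P.three_le
  obtain ⟨h0, h1⟩ := h.g_nonneg k
  obtain ⟨h2, h4⟩ := h.g_nonneg (k + 1)
  have h5 := h.slope_le ha h3 hP (k + 1)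
  have h6 := h.tail k
  have h7 := h.le_sub k
  have h8 := h.right k
  have h9 := h.le_b ha h3 hP (k + 1)
  have h10 := h.pos k
  have h11 := h.le_b ha h3 hP k
  by_cases ho : Odd (a k)
  · rw [if_pos ho] at h8
    have : α k * g (k + 1) ≤ P.b * P.b := by
      apply mul_le_mul h11 (by linarith) h2 hb0.le
    linarith
  · rw [if_neg ho] at h8
    have hm := (ha k).even (Nat.not_odd_iff_even.1 ho) (h3 k)
    have h12 : 1 - g (k + 1) ≤ P.s * (a k + e k * α (k + 1)) := by
      have h13 : P.s * (P.m - α (k + 1)) ≤ P.s * (a k + e k * α (k + 1)) :=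
        mul_le_mul_of_nonneg_left (by linarith) hs0.le
      have h14 : P.s * (α (k + 1) - P.s) ≤ g (k + 1) := by
        rcases le_total (α (k + 1)) P.s with h15 | h15
        · nlinarith
        · have h16 : P.s * (P.n - P.s) ≤ 2 := by nlinarith
          have h17 : P.s ≤ 2 * P.A := by nlinarith
          nlinarith
      nlinarith
    have h13 := mul_le_mul_of_nonneg_left h12 h10.le
    nlinarith

/-- The right coordinates lie in the required region when `R ≥ 3`. -/
theorem right_of_three (h : RightSystem a e α g) {P : CellData}
    (ha : ∀ k, P.Admits (a k)) (h3 : ∀ k, 3 ≤ a k) (hP : Wide P) (k : ℕ) : P.Right (α k) (g k) :=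
  ⟨(h.g_nonneg k).1, (h.g_nonneg k).2, by rw [hP.c_eq]; exact h.le_b ha h3 hP k,
    h.add_le ha h3 hP k, h.sub_le ha h3 hP k⟩

end RightSystem

/-! ### Admissible parameters for every R ≥ 2 -/

/-- `P` is a valid choice of data for partial quotients bounded below by `R`. -/
structure CellData.For (P : CellData) (R : ℕ) : Prop where
  T_eq : P.T = 4 * M1 R
  admits : ∀ a : ℕ, 2 ≤ a → R ≤ a → P.Admits a
  right : ∀ (a : ℕ → ℕ) (e α g : ℕ → ℝ), RightSystem a e α g → (∀ k, R ≤ a k) →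
    ∀ k, P.Right (α k) (g k)

theorem Rodd_odd (R : ℕ) : Odd (Rodd R) := by
  unfold Rodd
  split_ifs with h
  · exact h
  · exact (Nat.not_odd_iff_even.1 h).add_one

theorem Reven_even (R : ℕ) : Even (Reven R) := by
  unfold Reven
  split_ifs with h
  · exact h
  · exact (Nat.not_even_iff_odd.1 h).add_one

theorem Rodd_add_Reven (R : ℕ) : Rodd R + Reven R = 2 * R + 1 := by
  unfold Rodd Reven
  by_cases h : Odd R
  · simp [h, Nat.not_even_iff_odd.2 h]; ring
  · simp [h, Nat.not_odd_iff_even.1 h]; ring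

theorem le_Rodd (R : ℕ) : R ≤ Rodd R := by unfold Rodd; split_ifs <;> omega

theorem le_Reven (R : ℕ) : R ≤ Reven R := by unfold Reven; split_ifs <;> omega

theorem Rodd_le_of_odd {R a : ℕ} (h : R ≤ a) (ha : Odd a) : Rodd R ≤ a := by
  unfold Rodd
  split_ifs with h1
  · exact h
  · rcases h.eq_or_lt with rfl | h2
    · exact absurd ha h1
    · exact h2

theorem Reven_le_of_even {R a : ℕ} (h : R ≤ a) (ha : Even a) : Reven R ≤ a := by
  unfold Reven
  split_ifs with h1
  · exact h
  · rcases h.eq_or_lt with rfl | h2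
    · exact absurd ha h1
    · exact h2

theorem evenQuot_eq {R : ℕ} (hR : 3 ≤ R) : evenQuot R = Reven R :=
  max_eq_right (by exact_mod_cast Reven_ge hR)

theorem largeParams {R : ℕ} (hR : 4 ≤ R) : LargeParams R (Rodd R) (evenQuot R) (theta1 R) (kappa R)
    (theta2 R) (oddTail R) (1 / (R - 3 / 10)) (leftFactor R) := by
  have hR4 : (4 : ℝ) ≤ R := by exact_mod_cast hR
  rw [evenQuot_eq (by omega)]
  have hle := evenQuot_eq (R := R) (by omega)
  refine ⟨hR4, ?_, by exact_mod_cast le_Rodd R, by exact_mod_cast le_Reven R,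
    by exact_mod_cast Rodd_add_Reven R, ?_, theta1_pos R, theta1_eq R, kappa_eq (by omega),
    theta2_pos R, theta2_le (by omega), theta2_eq (by omega), oddTail_eq (by omega), ?_, ?_⟩
  · have : 5 ≤ Rodd R := by
      have h1 := le_Rodd R
      rcases Rodd_odd R with ⟨j, hj⟩
      omega
    exact_mod_cast this
  · have h1 : Reven R = Rodd R + 1 ∨ Reven R + 1 = Rodd R := by
      unfold Rodd Reven
      by_cases h : Odd R
      · left; simp [h, Nat.not_even_iff_odd.2 h]
      · right; simp [h, Nat.not_odd_iff_even.1 h]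
    rcases h1 with h1 | h1
    · left; rw [h1]; push_cast; ring
    · right; rw [← h1]; push_cast; ring
  · rw [one_div, inv_mul_cancel₀]; linarith
  · rw [← hle]; exact leftFactor_eq (by omega)

theorem exists_cellData_large {R : ℕ} (hR : 4 ≤ R) : ∃ P : CellData, P.For R := by
  have h := largeParams hR
  have hR4 : (4 : ℝ) ≤ R := by exact_mod_cast hR
  have hadm : ∀ a : ℕ, 2 ≤ a → R ≤ a → h.cellData.Admits a := fun a h2 ha =>
    ⟨h2, fun ho => by
        change (Rodd R : ℝ) ≤ a
        exact_mod_cast (Rodd_le_of_odd ha ho),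
      fun he _ => by
        change evenQuot R ≤ a
        rw [evenQuot_eq (by omega)]
        exact_mod_cast (Reven_le_of_even ha he),
      fun _ => by change (R : ℝ) ≤ a; exact_mod_cast ha, fun h => by omega⟩
  refine ⟨h.cellData, (four_mul_M1 (by omega)).symm, hadm, fun a e α g hs ha k => ?_⟩
  refine hs.right_of_three (fun k => hadm _ (by have := ha k; omega) (ha k))
    (fun k => by have := ha k; omega) ?_ k
  have hb := h.b_pos
  have hb1 := h.b_le
  have hbd := h.b_def
  have hA := h.A_mul_ge
  have hsd := h.s_def
  have hsp := h.s_pos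
  have hm := h.m_ge
  have hn := h.n_ge
  have hsum := h.sum
  have hs3 := h.s_le
  have h5 := h.five_le
  refine ⟨?_, rfl, hsd, ?_, ?_, ?_, ?_⟩
  · change (3 : ℝ) ≤ R; linarith
  · change (Rodd R : ℝ) ≤ evenQuot R + 1
    rcases h.diff with h6 | h6 <;> linarith
  · change 1 - ((Rodd R : ℝ) - theta2 R) / 4 ≤ theta2 R * ((Rodd R : ℝ) - 1 / 2)
    have : 0 ≤ theta2 R * ((Rodd R : ℝ) - 1 / 2 - 4) := mul_nonneg hsp.le (by linarith)
    nlinarith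
  · change 1 + 1 / ((R : ℝ) - 3 / 10) ≤ 2 * oddTail R * (evenQuot R - 1 / ((R : ℝ) - 3 / 10))
    have hA0 := h.A_pos
    have h7 : oddTail R * (R - 10 / 37) ≤
        oddTail R * (evenQuot R - 1 / ((R : ℝ) - 3 / 10)) :=
      mul_le_mul_of_nonneg_left (by linarith) hA0.le
    nlinarith
  · change 1 / ((R : ℝ) - 3 / 10) * (1 / ((R : ℝ) - 3 / 10)) ≤ theta2 R
    have h6 : 1 ≤ theta2 R * (R + 1) := by nlinarith
    set b := 1 / ((R : ℝ) - 3 / 10) with hbdef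
    have h8 : b * b * (R + 1) ≤ 1 := by
      have e1 : (b * (R - 3 / 10)) * (b * (R - 3 / 10)) = 1 := by rw [hbd]; norm_num
      have e2 : 0 ≤ b * b * ((R - 3 / 10) * (R - 3 / 10) - (R + 1)) := by
        apply mul_nonneg (by positivity)
        nlinarith
      nlinarith
    nlinarith

theorem theta1_of_three {R : ℕ} (h : Rodd R = 3) :
    30277 / 100000 ≤ theta1 R ∧ theta1 R ≤ 30278 / 100000 := by
  have h1 := theta1_eq R
  have h2 := theta1_pos R
  rw [h] at h1
  push_cast at h1
  constructor <;> nlinarith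

theorem exists_cellData_three : ∃ P : CellData, P.For 3 := by
  have ho : Rodd 3 = 3 := by unfold Rodd; rw [if_pos (by decide)]
  have he : Reven 3 = 4 := by unfold Reven; rw [if_neg (by decide)]
  have hE : evenQuot 3 = 4 := by rw [evenQuot_eq le_rfl, he]; norm_num
  obtain ⟨ht1, ht2⟩ := theta1_of_three ho
  have hs := theta2_eq (R := 3) le_rfl
  have hs0 := theta2_pos 3
  have hs1 := theta2_le (R := 3) le_rfl
  have hA := oddTail_eq (R := 3) (by norm_num)
  have ht := theta1_eq 3
  rw [ho] at ht hA
  rw [he] at hs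
  push_cast at ht hs hA
  have hs2 : 2679 / 10000 ≤ theta2 3 := by nlinarith
  have hs4 : theta2 3 ≤ 2680 / 10000 := by nlinarith
  have hA1 : 366 / 1000 ≤ oddTail 3 := by nlinarith
  have hρ := leftFactor_eq (R := 3) (by norm_num)
  rw [hE] at hρ
  have h : SmallParams (theta1 3) (kappa 3) (theta2 3) (oddTail 3) (382 / 1000) (leftFactor 3) :=
    ⟨ht1, ht2, ht, kappa_eq (by norm_num), hs0, by linarith, hA1, oddTail_le (by norm_num), hA,
      by norm_num, by norm_num, by linear_combination hρ⟩
  have hadm : ∀ a : ℕ, 2 ≤ a → 3 ≤ a → (SmallParams.cellData h).Admits a := fun a h2 ha =>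
    ⟨h2, fun _ => by change (3 : ℝ) ≤ a; exact_mod_cast ha,
      fun he _ => by
        change (4 : ℝ) ≤ a
        have : 4 ≤ a := by rcases he with ⟨j, rfl⟩; omega
        exact_mod_cast this,
      fun _ => by change (3 : ℝ) ≤ a; exact_mod_cast ha, fun h => by omega⟩
  refine ⟨SmallParams.cellData h, (four_mul_M1 (by norm_num)).symm, hadm, fun a e α g hs ha k => ?_⟩
  refine hs.right_of_three (fun k => hadm _ (by have := ha k; omega) (ha k)) ha
    ⟨le_rfl, rfl, by assumption, ?_, ?_, ?_, ?_⟩ k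
  · change (3 : ℝ) ≤ 4 + 1; norm_num
  · change (1 : ℝ) - (3 - theta2 3) / 4 ≤ theta2 3 * (3 - 1 / 2); linarith
  · change (1 : ℝ) + 382 / 1000 ≤ 2 * oddTail 3 * (4 - 382 / 1000); linarith
  · change (382 / 1000 : ℝ) * (382 / 1000) ≤ theta2 3; linarith

theorem exists_cellData_two : ∃ P : CellData, P.For 2 := by
  have ho : Rodd 2 = 3 := by unfold Rodd; rw [if_neg (by decide)]
  have he : Reven 2 = 2 := by unfold Reven; rw [if_pos (by decide)]
  have hE : evenQuot 2 = 4 := by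
    unfold evenQuot; rw [he]; norm_num
  obtain ⟨ht1, ht2⟩ := theta1_of_three ho
  have hs : theta2 2 = 1 / 2 := by unfold theta2; rw [if_neg (by norm_num)]
  have hA := oddTail_eq (R := 2) (by norm_num)
  have ht := theta1_eq 2
  rw [ho] at ht hA
  rw [hs] at hA
  push_cast at ht hA
  have hA1 : oddTail 2 = 2 / 5 := by linarith
  have hρ := leftFactor_eq (R := 2) (by norm_num)
  rw [hE] at hρ
  have h : SmallParams (theta1 2) (kappa 2) (1 / 2) (2 / 5) (1 / 2) (leftFactor 2) :=
    ⟨ht1, ht2, ht, kappa_eq (by norm_num), by norm_num, by norm_num, by norm_num, by norm_num,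
      by norm_num, by norm_num, by norm_num, by rw [hA1] at hρ; linear_combination hρ⟩
  have hadm : ∀ a : ℕ, 2 ≤ a → 2 ≤ a → (SmallParams.cellData h).Admits a := fun a h2 _ =>
    ⟨h2, fun ho => by
        change (3 : ℝ) ≤ a
        have : 3 ≤ a := by rcases ho with ⟨j, rfl⟩; omega
        exact_mod_cast this,
      fun he h3 => by
        change (4 : ℝ) ≤ a
        have : 4 ≤ a := by rcases he with ⟨j, rfl⟩; omega
        exact_mod_cast this,
      fun h3 => by change (3 : ℝ) ≤ a; exact_mod_cast h3, fun _ => ⟨rfl, by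
        change (1 - 2 * (2 / 5)) * leftFactor 2 ≤ 3 / 20
        linarith [h.ρ_bounds.2], by
        change (382 / 1000 : ℝ) * (1 + kappa 2) ≤ 3 / 5
        linarith [h.κ_bounds.2]⟩⟩
  refine ⟨SmallParams.cellData h, ?_, hadm, fun a e α g hs ha k => hs.right_of_two rfl rfl rfl k⟩
  rw [four_mul_M1 (by norm_num), hA1]
  rfl

theorem exists_cellData {R : ℕ} (hR : 2 ≤ R) : ∃ P : CellData, P.For R := by
  rcases lt_or_ge R 4 with h | h
  · interval_cases R
    · exact exists_cellData_two
    · exact exists_cellData_three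
  · exact exists_cellData_large h

/-! ### Contraction of the left coordinates and eventual vertex bounds -/

/-- The left coordinates along a sequence of partial quotients and signs. -/
def leftSeq (a : ℕ → ℕ) (e : ℕ → ℝ) (p : ℝ × ℝ) : ℕ → ℝ × ℝ
  | 0 => p
  | k + 1 => leftStep (a k) (e k) (leftSeq a e p k)

theorem leftSeq_add (a : ℕ → ℕ) (e : ℕ → ℝ) (p : ℝ × ℝ) (j k : ℕ) :
    leftSeq a e p (j + k) =
      leftSeq (fun i => a (j + i)) (fun i => e (j + i)) (leftSeq a e p j) k := by
  induction k with
  | zero => rfl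
  | succ k ih => rw [← add_assoc, leftSeq, ih, leftSeq]

/-- A region preserved by every step of the left coordinates. -/
structure LeftBdd (p : ℝ × ℝ) : Prop where
  lower : -(2 / 5) ≤ p.1
  upper : p.1 ≤ 5 / 8
  abs_le : |p.2| ≤ 5 / 3

theorem LeftBdd.zero : LeftBdd (0, 0) := ⟨by norm_num, by norm_num, by norm_num⟩

theorem LeftBdd.den {p : ℝ × ℝ} (h : LeftBdd p) {a : ℕ} (ha : 2 ≤ a) : 8 / 5 ≤ (a : ℝ) + p.1 := by
  have : (2 : ℝ) ≤ a := by exact_mod_cast ha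
  linarith [h.lower]

theorem abs_sign {e : ℝ} (he : e = 1 ∨ e = -1) : |e| = 1 := by
  rcases he with rfl | rfl <;> norm_num

theorem LeftBdd.step {p : ℝ × ℝ} (h : LeftBdd p) {a : ℕ} {e : ℝ} (ha : 2 ≤ a)
    (he : e = 1 ∨ e = -1) (h2 : a = 2 → e = 1) : LeftBdd (leftStep a e p) := by
  have hw := h.den ha
  have hw0 : (0 : ℝ) < a + p.1 := by linarith
  have hE := _root_.abs_le.1 h.abs_le
  refine ⟨?_, ?_, ?_⟩
  · change _ ≤ e / (a + p.1)
    rcases he with rfl | rfl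
    · have : 0 ≤ 1 / (a + p.1) := by positivity
      linarith
    · have h3 : (3 : ℝ) ≤ a := by
        have : a ≠ 2 := fun h => by have := h2 h; norm_num at this
        have : 3 ≤ a := by omega
        exact_mod_cast this
      rw [le_div_iff₀ hw0]
      linarith [h.lower]
  · change e / (a + p.1) ≤ _
    rw [div_le_iff₀ hw0]
    rcases he with rfl | rfl <;> linarith
  · have h3 : |(leftStep a e p).2| ≤ (8 / 3) / (a + p.1) := by
      unfold leftStep
      dsimp only
      split_ifs
      · rw [abs_div, abs_of_pos hw0, abs_mul, abs_sign he, one_mul]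
        apply div_le_div_of_nonneg_right _ hw0.le
        rw [_root_.abs_le]; constructor <;> linarith
      · rw [abs_div, abs_of_pos hw0, abs_neg, abs_mul, abs_sign he, one_mul]
        apply div_le_div_of_nonneg_right _ hw0.le
        linarith [h.abs_le]
    refine h3.trans ?_
    rw [div_le_iff₀ hw0]
    linarith

/-- A weighted distance contracted by each step of the left coordinates. -/
def leftDist (p q : ℝ × ℝ) : ℝ := |p.2 - q.2| + 3 * |p.1 - q.1|

theorem leftDist_nonneg (p q : ℝ × ℝ) : 0 ≤ leftDist p q := by unfold leftDist; positivity

/-- Both denominators are at least 8/5, so 1/w varies by at most 25/64 of the change in B. The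
weight 3 is chosen so that 8/3 · 25/64 + 3 · 25/64 ≤ 3/4 · 3, while E itself contracts by 5/8. -/
theorem leftDist_step {p q : ℝ × ℝ} (hp : LeftBdd p) (hq : LeftBdd q) {a : ℕ} {e : ℝ} (ha : 2 ≤ a)
    (he : e = 1 ∨ e = -1) :
    leftDist (leftStep a e p) (leftStep a e q) ≤ 3 / 4 * leftDist p q := by
  have hw := hp.den ha
  have hv := hq.den ha
  set w := (a : ℝ) + p.1 with hwd
  set v := (a : ℝ) + q.1 with hvd
  have hw0 : 0 < w := by linarith
  have hv0 : 0 < v := by linarith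
  have hwi : 1 / w ≤ 5 / 8 := by rw [div_le_div_iff₀ hw0 (by norm_num)]; linarith
  have hvi : 1 / v ≤ 5 / 8 := by rw [div_le_div_iff₀ hv0 (by norm_num)]; linarith
  have h1 : |1 / w - 1 / v| ≤ 25 / 64 * |p.1 - q.1| := by
    have : 1 / w - 1 / v = -((1 / w) * (1 / v) * (p.1 - q.1)) := by
      have : p.1 - q.1 = w - v := by rw [hwd, hvd]; ring
      rw [this]; field_simp; ring
    rw [this, abs_neg, abs_mul]
    apply mul_le_mul_of_nonneg_right _ (abs_nonneg _)
    rw [abs_of_pos (by positivity)]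
    calc 1 / w * (1 / v) ≤ 5 / 8 * (5 / 8) := by gcongr
      _ = _ := by norm_num
  have hB : |(leftStep a e p).1 - (leftStep a e q).1| ≤ 25 / 64 * |p.1 - q.1| := by
    have : (leftStep a e p).1 - (leftStep a e q).1 = e * (1 / w - 1 / v) := by
      change e / w - e / v = _; ring
    rw [this, abs_mul, abs_sign he, one_mul]
    exact h1
  have key : ∀ x y : ℝ, |x| ≤ 8 / 3 → |x / v - y / w| ≤ 5 / 8 * |y - x| + 8 / 3 * (25 / 64 * |p.1 - q.1|) := by
    intro x y hx
    have : x / v - y / w = -(1 / w * (y - x)) - x * (1 / w - 1 / v) := by ring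
    rw [this]
    refine (abs_sub _ _).trans (add_le_add ?_ ?_)
    · rw [abs_neg, abs_mul, abs_of_pos (by positivity : 0 < 1 / w)]
      exact mul_le_mul_of_nonneg_right hwi (abs_nonneg _)
    · rw [abs_mul]
      exact mul_le_mul hx h1 (abs_nonneg _) (by norm_num)
  have hE : |(leftStep a e p).2 - (leftStep a e q).2| ≤
      5 / 8 * |p.2 - q.2| + 8 / 3 * (25 / 64 * |p.1 - q.1|) := by
    have hq2 := abs_le.1 hq.abs_le
    by_cases ho : Odd a
    · have h2 : (leftStep a e p).2 - (leftStep a e q).2 = -(e * ((1 + q.2) / v - (1 + p.2) / w)) := by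
        unfold leftStep
        rw [if_pos ho, if_pos ho]
        dsimp only
        ring
      rw [h2, abs_neg, abs_mul, abs_sign he, one_mul]
      have := key (1 + q.2) (1 + p.2) (by rw [abs_le]; constructor <;> linarith)
      rwa [show 1 + p.2 - (1 + q.2) = p.2 - q.2 by ring] at this
    · have h2 : (leftStep a e p).2 - (leftStep a e q).2 = e * (q.2 / v - p.2 / w) := by
        unfold leftStep
        rw [if_neg ho, if_neg ho]
        dsimp only
        ring
      rw [h2, abs_mul, abs_sign he, one_mul]
      exact key q.2 p.2 (by linarith [hq.abs_le])
  unfold leftDist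
  linarith [abs_nonneg (p.2 - q.2), abs_nonneg (p.1 - q.1)]

theorem LeftBdd.seq {a : ℕ → ℕ} {e : ℕ → ℝ} {p : ℝ × ℝ} (hp : LeftBdd p) (ha : ∀ k, 2 ≤ a k)
    (he : ∀ k, e k = 1 ∨ e k = -1) (h2 : ∀ k, a k = 2 → e k = 1) (k : ℕ) :
    LeftBdd (leftSeq a e p k) := by
  induction k with
  | zero => exact hp
  | succ k ih => exact ih.step (ha k) (he k) (h2 k)

theorem leftDist_seq {a : ℕ → ℕ} {e : ℕ → ℝ} {p q : ℝ × ℝ} (hp : LeftBdd p) (hq : LeftBdd q)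
    (ha : ∀ k, 2 ≤ a k) (he : ∀ k, e k = 1 ∨ e k = -1) (h2 : ∀ k, a k = 2 → e k = 1) (k : ℕ) :
    leftDist (leftSeq a e p k) (leftSeq a e q k) ≤ (3 / 4) ^ k * leftDist p q := by
  induction k with
  | zero => simp [leftSeq]
  | succ k ih =>
    calc _ ≤ 3 / 4 * leftDist (leftSeq a e p k) (leftSeq a e q k) :=
          leftDist_step (hp.seq ha he h2 k) (hq.seq ha he h2 k) (ha k) (he k)
      _ ≤ 3 / 4 * ((3 / 4) ^ k * leftDist p q) := by linarith
      _ = _ := by ring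

theorem LeftBdd.dist_le {p q : ℝ × ℝ} (hp : LeftBdd p) (hq : LeftBdd q) : leftDist p q ≤ 7 := by
  have h1 := _root_.abs_le.1 hp.abs_le
  have h2 := _root_.abs_le.1 hq.abs_le
  have h3 : |p.2 - q.2| ≤ 10 / 3 := by rw [_root_.abs_le]; constructor <;> linarith
  have h4 : |p.1 - q.1| ≤ 41 / 40 := by
    rw [_root_.abs_le]
    constructor <;> linarith [hp.lower, hp.upper, hq.lower, hq.upper]
  unfold leftDist
  linarith

/-- The right factors are at most 2 and the left factors move by at most 2η, so the products drop by
at most 4η. The margin 10η, times 1 + αB ≥ 4/5, pays for this and for the change in the normalizing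
factor. -/
theorem VertexBound.perturb {T c α g B E B' E' η : ℝ} (h : VertexBound T α g B E) (hT : T ≤ 1)
    (hc : 0 < c) (hcT : c + 10 * η ≤ T) (hα : α ≤ 1 / 2) (hg : 0 ≤ g) (hgα : g ≤ α)
    (hB : -(2 / 5) ≤ B) (hBB : |B' - B| ≤ η) (hEE : |E' - E| ≤ η) : VertexBound c α g B' E' := by
  have hη : 0 ≤ η := (abs_nonneg _).trans hBB
  obtain ⟨h1, h2⟩ := abs_le.1 hBB
  obtain ⟨h3, h4⟩ := abs_le.1 hEE
  have hden : c * (1 + α * B') + 4 * η ≤ T * (1 + α * B) := by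
    have h5 : α * B' ≤ α * B + 1 / 2 * η := by nlinarith
    have h6 : 4 / 5 ≤ 1 + α * B := by nlinarith
    have h7 : c * (1 + α * B') ≤ c * (1 + α * B) + 1 / 2 * η := by nlinarith
    have h8 : 0 ≤ (T - c - 10 * η) * (1 + α * B) := mul_nonneg (by linarith) (by linarith)
    nlinarith
  have key : ∀ r l l' : ℝ, 0 < r → r ≤ 2 → l - 2 * η ≤ l' → T * (1 + α * B) ≤ r * l →
      c * (1 + α * B') ≤ r * l' := by
    intro r l l' hr hr2 hl hT
    have : r * (l - 2 * η) ≤ r * l' := mul_le_mul_of_nonneg_left hl hr.le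
    nlinarith
  exact ⟨⟨h.pp.1, key _ _ _ h.pp.1 (by linarith) (by linarith) h.pp.2⟩,
    ⟨h.mm.1, key _ _ _ h.mm.1 (by linarith) (by linarith) h.mm.2⟩,
    ⟨h.mp.1, key _ _ _ h.mp.1 (by linarith) (by linarith) h.mp.2⟩,
    ⟨h.pm.1, key _ _ _ h.pm.1 (by linarith) (by linarith) h.pm.2⟩⟩

theorem CellData.For.left {P : CellData} {R : ℕ} (hP : P.For R) {a : ℕ → ℕ} {e α g : ℕ → ℝ}
    (h : RightSystem a e α g) (ha : ∀ k, R ≤ a k) (k : ℕ) :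
    P.Left (leftSeq a e (0, 0) k).1 (leftSeq a e (0, 0) k).2 := by
  induction k with
  | zero => exact P.left_zero
  | succ k ih => exact ih.step (hP.admits _ (h.two_le k) (ha k)) (h.sign k) (h.two k)

/-- If the partial quotients are eventually at least `R`, then the vertices eventually satisfy
every bound below the one for `R`. -/
theorem RightSystem.eventually_vertexBound {a : ℕ → ℕ} {e α g : ℕ → ℝ} (h : RightSystem a e α g)
    {R k₀ : ℕ} (hR : 2 ≤ R) (ha : ∀ k, k₀ ≤ k → R ≤ a k) {c : ℝ} (hc : 0 < c) (hcT : c < 4 * M1 R) :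
    ∃ k₁, ∀ k, k₁ ≤ k →
      VertexBound c (α k) (g k) (leftSeq a e (0, 0) k).1 (leftSeq a e (0, 0) k).2 := by
  obtain ⟨P, hP⟩ := exists_cellData hR
  have hT := hP.T_eq
  have hs := h.shift k₀
  have ha' : ∀ k, R ≤ a (k₀ + k) := fun k => ha _ (by omega)
  obtain ⟨j, hj⟩ : ∃ j : ℕ, (3 / 4 : ℝ) ^ j * 7 ≤ (4 * M1 R - c) / 10 := by
    have h1 : Tendsto (fun j : ℕ => (3 / 4 : ℝ) ^ j * 7) atTop (𝓝 (0 * 7)) :=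
      (tendsto_pow_atTop_nhds_zero_of_lt_one (by norm_num) (by norm_num)).mul_const _
    rw [zero_mul] at h1
    exact ((h1.eventually_lt_const (by linarith : 0 < (4 * M1 R - c) / 10)).exists).imp
      fun _ h => h.le
  refine ⟨k₀ + j, fun k hk => ?_⟩
  obtain ⟨i, rfl⟩ := Nat.exists_eq_add_of_le (show k₀ ≤ k by omega)
  have hv := (hP.left hs ha' i).vertexBound (hP.right _ _ _ _ hs ha' i)
  have hbdd := LeftBdd.zero.seq h.two_le h.sign h.two k₀
  -- Compares the true left coordinates with those restarted at (0, 0) at index k₀; the latter see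
  -- only quotients at least R, so they obey the sharp bound.
  have hd := leftDist_seq hbdd LeftBdd.zero hs.two_le hs.sign hs.two i
  rw [← leftSeq_add] at hd
  have hd7 := hbdd.dist_le LeftBdd.zero
  have hpow : (3 / 4 : ℝ) ^ i ≤ (3 / 4) ^ j :=
    pow_le_pow_of_le_one (by norm_num) (by norm_num) (by omega)
  have hd2 : leftDist (leftSeq a e (0, 0) (k₀ + i)) (leftSeq (fun i => a (k₀ + i))
      (fun i => e (k₀ + i)) (0, 0) i) ≤ (4 * M1 R - c) / 10 := by
    refine hd.trans (le_trans ?_ hj)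
    have : 0 ≤ (3 / 4 : ℝ) ^ i := by positivity
    have := leftDist_nonneg (leftSeq a e (0, 0) k₀) (0, 0)
    gcongr
  unfold leftDist at hd2
  have h0 := abs_nonneg ((leftSeq a e (0, 0) (k₀ + i)).2 -
    (leftSeq (fun i => a (k₀ + i)) (fun i => e (k₀ + i)) (0, 0) i).2)
  have h1 := abs_nonneg ((leftSeq a e (0, 0) (k₀ + i)).1 -
    (leftSeq (fun i => a (k₀ + i)) (fun i => e (k₀ + i)) (0, 0) i).1)
  obtain ⟨hg0, hg1⟩ := h.g_nonneg (k₀ + i)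
  exact hv.perturb (η := (4 * M1 R - c) / 10) P.T_lt.le hc (by rw [hT]; linarith) (h.lt _).le hg0 hg1
    (LeftBdd.zero.seq hs.two_le hs.sign hs.two i).lower (by linarith) (by linarith)

/-! ### From the vertices to arbitrary points -/

/-- The two vertex inequalities on one side of a cell. -/
structure HalfBound (m α g B E : ℝ) : Prop where
  pos : 0 < 1 - α + g
  le : m ≤ (1 - α + g) * (1 + B + E)
  pos' : 0 < 1 + α + g
  le' : m ≤ (1 + α + g) * (1 - B - E)

theorem VertexBound.upper {c α g B E : ℝ} (h : VertexBound c α g B E) :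
    HalfBound (c * (1 + α * B)) α g B E := ⟨h.pp.1, h.pp.2, h.mp.1, h.mp.2⟩

theorem VertexBound.lower {c α g B E : ℝ} (h : VertexBound c α g B E) :
    HalfBound (c * (1 + α * B)) α (-g) B (-E) := by
  refine ⟨?_, ?_, ?_, ?_⟩
  · linarith [h.mm.1]
  · calc _ ≤ _ := h.mm.2
      _ = _ := by ring
  · linarith [h.pm.1]
  · calc _ ≤ _ := h.pm.2
      _ = _ := by ring

theorem le_mul_scaled {m x y p q Z : ℝ} (hm : 0 < m) (hZ : 1 ≤ Z) (hx : 0 ≤ x) (hy : 0 ≤ y)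
    (hpos : 0 < x + p) (hle : m ≤ (x + p) * (y + q)) :
    0 < Z * x + p ∧ 0 < Z * y + q ∧ m ≤ (Z * x + p) * (Z * y + q) := by
  have hq : 0 < y + q := pos_of_mul_pos_right (hm.trans_le hle) hpos.le
  have h1 : x + p ≤ Z * x + p := by nlinarith
  have h2 : y + q ≤ Z * y + q := by nlinarith
  exact ⟨by linarith, by linarith, hle.trans (mul_le_mul h1 h2 hq.le (by linarith))⟩

theorem HalfBound.scaled {m α g B E Z : ℝ} (h : HalfBound m α g B E) (hm : 0 < m) (hZ : 1 ≤ Z)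
    (hα : |α| ≤ 1) (hB : |B| ≤ 1) :
    (0 < Z * (1 - α) + g ∧ 0 < Z * (1 + B) + E ∧ m ≤ (Z * (1 - α) + g) * (Z * (1 + B) + E)) ∧
    (0 < Z * (1 + α) + g ∧ 0 < Z * (1 - B) - E ∧ m ≤ (Z * (1 + α) + g) * (Z * (1 - B) - E)) := by
  obtain ⟨h1, h2⟩ := abs_le.1 hα
  obtain ⟨h3, h4⟩ := abs_le.1 hB
  exact ⟨le_mul_scaled hm hZ (by linarith) (by linarith) h.pos h.le,
    le_mul_scaled hm hZ (by linarith) (by linarith) h.pos' (by simpa [sub_eq_add_neg] using h.le')⟩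

/-- For α ≥ 0 the quadratic in X is concave, so on an interval it is at least the smaller of its
values at the ends. -/
theorem concave_le {m p q α X Y Z : ℝ} (hα : 0 ≤ α) (hZX : Z ≤ X) (hXY : X ≤ Y)
    (h1 : m ≤ (p - α * Z) * (Z + q)) (h2 : m ≤ (p - α * Y) * (Y + q)) :
    m ≤ (p - α * X) * (X + q) := by
  rcases (hZX.trans hXY).eq_or_lt with h | h
  · have : X = Z := le_antisymm (by linarith) hZX
    rwa [this]
  · have e : (Y - Z) * ((p - α * X) * (X + q) - m) = (Y - X) * ((p - α * Z) * (Z + q) - m) +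
        (X - Z) * ((p - α * Y) * (Y + q) - m) + (Y - Z) * (α * ((X - Z) * (Y - X))) := by ring
    have h3 : 0 ≤ (Y - Z) * ((p - α * X) * (X + q) - m) := by
      rw [e]
      have := mul_nonneg (sub_nonneg.2 hXY) (sub_nonneg.2 h1)
      have := mul_nonneg (sub_nonneg.2 hZX) (sub_nonneg.2 h2)
      have := mul_nonneg (sub_pos.2 h).le
        (mul_nonneg hα (mul_nonneg (sub_nonneg.2 hZX) (sub_nonneg.2 hXY)))
      linarith
    have := nonneg_of_mul_nonneg_right h3 (sub_pos.2 h)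
    linarith

/-- A point outside the vertices of two consecutive cells has a product at least as large as
those of the vertices. -/
theorem HalfBound.point_le {w e α α' g γ B B' E E₂ o m m' X Z : ℝ} (he : e = 1 ∨ e = -1)
    (hm : 0 < m) (hα0 : 0 < α) (hα : |α| ≤ 1) (hB : |B| ≤ 1) (hα' : |α'| ≤ 1) (hB' : |B'| ≤ 1)
    (hw : 0 < w + B)
    (htail : α * (w + e * α') = 1) (hleft : B' * (w + B) = e) (hg : g = α * (o + γ))
    (hE : o + E = -(e * (w + B) * E₂)) (hm' : m' * (α * (w + B)) = m)
    (h : HalfBound m α g B E) (h' : HalfBound m' α' γ B' E₂)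
    (h'' : HalfBound m' α' (-γ) B' (-E₂)) (hZ : 1 ≤ Z) (hX : Z ≤ |X|)
    (hW : Z ≤ |Z * w - X + o|) :
    m ≤ |(Z - X * α + g) * (X + Z * B + E)| := by
  obtain ⟨⟨a1, a2, a3⟩, ⟨b1, b2, b3⟩⟩ := h.scaled hm hZ hα hB
  have hk : 0 < α * (w + B) := mul_pos hα0 hw
  have hm'0 : 0 < m' := by
    by_contra hc
    push Not at hc
    nlinarith
  obtain ⟨⟨c1, c2, c3⟩, ⟨d1, d2, d3⟩⟩ := h'.scaled hm'0 hZ hα' hB'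
  obtain ⟨⟨e1, e2, e3⟩, ⟨f1, f2, f3⟩⟩ := h''.scaled hm'0 hZ hα' hB'
  have hee : e * e = 1 := by rcases he with rfl | rfl <;> norm_num
  have heB : 0 < e * B' := by
    have : e * B' * (w + B) = 1 := by rw [mul_assoc, hleft, hee]
    exact pos_of_mul_pos_left (by rw [this]; norm_num) hw.le
  set W := Z * w - X + o with hWdef
  have hU : Z - X * α + g = α * (W + e * α' * Z + γ) := by
    rw [hg, hWdef]; linear_combination -Z * htail
  have hV : X + Z * B + E = (w + B) * (Z - e * B' * W - e * E₂) := by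
    rw [hWdef]
    linear_combination hE + (e * (Z * w - X + o)) * hleft + (Z * w - X + o) * hee
  have hWpos : m' ≤ (Z + e * α' * Z + γ) * (Z - e * B' * Z - e * E₂) := by
    rcases he with rfl | rfl
    · calc m' ≤ _ := d3
        _ = _ := by ring
    · calc m' ≤ _ := c3
        _ = _ := by ring
  -- `Z` is the local minimum of |z|, `X` the first coordinate and `W`, up to sign, the second
  -- coordinate in the next cell; `o` is 1 or 0 as the quotient is odd or even. If X ≤ −Z both
  -- factors dominate those of the scaled vertex (−Z, Z).
  rcases le_abs.1 hX with hX | hX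
  · rcases le_abs.1 hW with hW | hW
    -- Here Z ≤ X ≤ Zw + o − Z. At the left end the point is a scaled vertex of this cell, at the
    -- right end (W = Z) one of the next, and the product is concave in between.
    · have hY : m ≤ ((Z + g) - α * (Z * w + o - Z)) * ((Z * w + o - Z) + (Z * B + E)) := by
        have e1 : (Z + g) - α * (Z * w + o - Z) = α * (Z + e * α' * Z + γ) := by
          rw [hg]; linear_combination -Z * htail
        have e2 : (Z * w + o - Z) + (Z * B + E) = (w + B) * (Z - e * B' * Z - e * E₂) := by
          linear_combination hE + (e * Z) * hleft + Z * hee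
        rw [e1, e2, ← hm']
        calc m' * (α * (w + B)) ≤
            (Z + e * α' * Z + γ) * (Z - e * B' * Z - e * E₂) * (α * (w + B)) :=
              mul_le_mul_of_nonneg_right hWpos hk.le
          _ = _ := by ring
      have := concave_le (X := X) hα0.le hX (by linarith) (m := m) (p := Z + g) (q := Z * B + E)
        (by calc m ≤ _ := a3
              _ = _ := by ring) hY
      refine le_trans ?_ (le_abs_self _)
      calc m ≤ _ := this
        _ = _ := by ring
    -- Here W ≤ −Z: the point lies beyond a scaled vertex of the next cell, and both factors only
    -- grow.
    · have hkey : m' ≤ (-W - e * α' * Z - γ) * (Z + e * B' * (-W) - e * E₂) := by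
        have h1 : m' ≤ (Z - e * α' * Z - γ) * (Z + e * B' * Z - e * E₂) ∧
            0 < Z - e * α' * Z - γ ∧ 0 < Z + e * B' * Z - e * E₂ := by
          rcases he with rfl | rfl
          · refine ⟨?_, by linarith, by linarith⟩
            calc m' ≤ _ := e3
              _ = _ := by ring
          · refine ⟨?_, by linarith, by linarith⟩
            calc m' ≤ _ := f3
              _ = _ := by ring
        refine h1.1.trans (mul_le_mul (by linarith) ?_ h1.2.2.le (by linarith [h1.2.1]))
        have : e * B' * Z ≤ e * B' * -W := mul_le_mul_of_nonneg_left hW heB.le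
        linarith
      rw [hU, hV, ← hm', ← abs_neg]
      refine le_trans ?_ (le_abs_self _)
      calc m' * (α * (w + B)) ≤
          (-W - e * α' * Z - γ) * (Z + e * B' * (-W) - e * E₂) * (α * (w + B)) :=
            mul_le_mul_of_nonneg_right hkey hk.le
        _ = _ := by ring
  · rw [← abs_neg]
    refine le_trans ?_ (le_abs_self _)
    have h1 : Z * (1 + α) + g ≤ Z - X * α + g := by nlinarith
    have h2 : Z * (1 - B) - E ≤ -X - Z * B - E := by linarith
    calc m ≤ _ := b3
      _ ≤ (Z - X * α + g) * (-X - Z * B - E) := mul_le_mul h1 h2 b2.le (by linarith)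
      _ = _ := by ring

/-! ### Integer points in successive cells -/

/-- One step of the coordinates of a point. -/
def stepPt (a : ℕ) (e : ℤ) (p : ℤ × ℤ) : ℤ × ℤ :=
  if Odd a then (e * p.2, p.1 - p.2 * a - 1) else (-(e * p.2), p.2 * a - p.1)

/-- The coordinates of a point with respect to the successive cells. -/
def ptSeq (a : ℕ → ℕ) (e : ℕ → ℤ) (p : ℤ × ℤ) : ℕ → ℤ × ℤ
  | 0 => p
  | k + 1 => stepPt (a k) (e k) (ptSeq a e p k)

/-- The first factor of the product at a point. -/
def rightVal (α g : ℝ) (p : ℤ × ℤ) : ℝ := p.2 - p.1 * α + g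

/-- The second factor of the product at a point. -/
def leftVal (q : ℝ × ℝ) (p : ℤ × ℤ) : ℝ := p.1 + p.2 * q.1 + q.2

theorem odd_stepPt {a : ℕ} {e : ℤ} {p : ℤ × ℤ} (he : e = 1 ∨ e = -1) (h1 : Odd p.1)
    (h2 : Odd p.2) : Odd (stepPt a e p).1 ∧ Odd (stepPt a e p).2 := by
  have hodd : Odd e := by rcases he with rfl | rfl <;> decide
  unfold stepPt
  split_ifs with h
  · have h' : Odd (a : ℤ) := by exact_mod_cast h
    exact ⟨hodd.mul h2, (h1.sub_odd (h2.mul h')).sub_odd odd_one⟩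
  · have h' : Even (a : ℤ) := by exact_mod_cast Nat.not_odd_iff_even.1 h
    exact ⟨(hodd.mul h2).neg, (h'.mul_left _).sub_odd h1⟩

/-- This makes the local minimum condition meaningful: |x| in one cell is |z| in the cell before. -/
theorem natAbs_stepPt_fst {a : ℕ} {e : ℤ} {p : ℤ × ℤ} (he : e = 1 ∨ e = -1) :
    (stepPt a e p).1.natAbs = p.2.natAbs := by
  unfold stepPt
  rcases he with rfl | rfl <;> split_ifs <;> simp

theorem sign_cast {e : ℤ} (he : e = 1 ∨ e = -1) : (e : ℝ) = 1 ∨ (e : ℝ) = -1 := by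
  rcases he with rfl | rfl <;> simp

theorem abs_rightVal_step {a : ℕ} {e : ℤ} {α α' g g' : ℝ} (hα : 0 < α)
    (htail : α * (a + e * α') = 1)
    (hg : g = if Odd a then α * (1 - g') else α * g') (p : ℤ × ℤ) :
    |rightVal α g p| = α * |rightVal α' g' (stepPt a e p)| := by
  unfold rightVal stepPt
  split_ifs at hg ⊢ with h
  · have e1 : (p.2 : ℝ) - p.1 * α + g = -(α * (((p.1 - p.2 * a - 1 : ℤ) : ℝ) -
        ((e * p.2 : ℤ) : ℝ) * α' + g')) := by
      rw [hg]; push_cast; linear_combination -(p.2 : ℝ) * htail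
    rw [e1, abs_neg, abs_mul, abs_of_pos hα]
  · have e1 : (p.2 : ℝ) - p.1 * α + g = α * (((p.2 * a - p.1 : ℤ) : ℝ) -
        ((-(e * p.2) : ℤ) : ℝ) * α' + g') := by
      rw [hg]; push_cast; linear_combination -(p.2 : ℝ) * htail
    rw [e1, abs_mul, abs_of_pos hα]

theorem abs_leftVal_step {a : ℕ} {e : ℤ} (he : e = 1 ∨ e = -1) {q : ℝ × ℝ} (hw : 0 < a + q.1)
    (p : ℤ × ℤ) : |leftVal q p| = (a + q.1) * |leftVal (leftStep a e q) (stepPt a e p)| := by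
  have hee : (e : ℝ) * e = 1 := by rcases he with rfl | rfl <;> norm_num
  unfold leftVal stepPt leftStep
  split_ifs with h
  · have e1 : (p.1 : ℝ) + p.2 * q.1 + q.2 = e * ((a + q.1) * (((e * p.2 : ℤ) : ℝ) +
        ((p.1 - p.2 * a - 1 : ℤ) : ℝ) * (e / (a + q.1)) + e * (1 + q.2) / (a + q.1))) := by
      push_cast; field_simp; linear_combination (-(p.1 : ℝ) - p.2 * q.1 - q.2) * hee
    rw [e1, abs_mul, abs_sign (sign_cast he), one_mul, abs_mul, abs_of_pos hw]
  · have e1 : (p.1 : ℝ) + p.2 * q.1 + q.2 = -(e * ((a + q.1) * (((-(e * p.2) : ℤ) : ℝ) +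
        ((p.2 * a - p.1 : ℤ) : ℝ) * (e / (a + q.1)) + -(e * q.2) / (a + q.1)))) := by
      push_cast; field_simp; linear_combination (-(p.1 : ℝ) - p.2 * q.1 - q.2) * hee
    rw [e1, abs_neg, abs_mul, abs_sign (sign_cast he), one_mul, abs_mul, abs_of_pos hw]

/-- Lower bound for the product at a point whose second coordinate is locally minimal. -/
theorem VertexBound.point_le {a : ℕ} {e : ℤ} {α α' g g' c : ℝ} {q : ℝ × ℝ} {p : ℤ × ℤ}
    (he : e = 1 ∨ e = -1) (ha : 2 ≤ a) (hc : 0 < c) (hq : LeftBdd q)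
    (hq' : LeftBdd (leftStep a e q))
    (hα0 : 0 < α) (hα : α < 1 / 2) (hα0' : 0 < α') (hα' : α' < 1 / 2)
    (htail : α * (a + e * α') = 1) (hg : g = if Odd a then α * (1 - g') else α * g')
    (hv : VertexBound c α g q.1 q.2)
    (hv' : VertexBound c α' g' (leftStep a e q).1 (leftStep a e q).2)
    (hp : Odd p.2) (h1 : p.2.natAbs ≤ p.1.natAbs) (h2 : p.2.natAbs ≤ (stepPt a e p).2.natAbs) :
    c * (1 + α * q.1) ≤ |rightVal α g p * leftVal q p| := by
  have hw := hq.den ha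
  have hw0 : (0 : ℝ) < a + q.1 := by linarith
  have hB : |q.1| ≤ 1 := abs_le.2 ⟨by linarith [hq.lower], by linarith [hq.upper]⟩
  have hB' : |(leftStep a e q).1| ≤ 1 := abs_le.2 ⟨by linarith [hq'.lower], by linarith [hq'.upper]⟩
  have hα1 : |α| ≤ 1 := abs_le.2 ⟨by linarith, by linarith⟩
  have hα1' : |α'| ≤ 1 := abs_le.2 ⟨by linarith, by linarith⟩
  have hd : 0 < 1 + α * q.1 := by nlinarith [hq.lower]
  have her := sign_cast he
  have hee : (e : ℝ) * e = 1 := by rcases he with rfl | rfl <;> norm_num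
  have hB'eq : (leftStep a e q).1 * (a + q.1) = e := by
    unfold leftStep; field_simp
  have hm : 0 < c * (1 + α * q.1) := mul_pos hc hd
  have hm' : c * (1 + α' * (leftStep a e q).1) * (α * (a + q.1)) = c * (1 + α * q.1) := by
    linear_combination (c * α' * α) * hB'eq + c * htail
  have hE : (leftStep a e q).2 * (a + q.1) = if Odd a then e * (1 + q.2) else -(e * q.2) := by
    unfold leftStep; split_ifs <;> field_simp
  have hz : p.2 ≠ 0 := fun h => by rw [h] at hp; exact absurd hp (by decide)
  have hX : (|p.2| : ℝ) ≤ |(p.1 : ℝ)| := by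
    rw [← Int.cast_abs, ← Int.cast_abs, Int.abs_eq_natAbs, Int.abs_eq_natAbs]
    exact_mod_cast h1
  have hW : (|p.2| : ℝ) ≤ |((stepPt a e p).2 : ℝ)| := by
    rw [← Int.cast_abs, ← Int.cast_abs, Int.abs_eq_natAbs, Int.abs_eq_natAbs]
    exact_mod_cast h2
  have hW' : |((stepPt a e p).2 : ℝ)| = |(p.2 : ℝ) * a - p.1 + if Odd a then 1 else 0| := by
    unfold stepPt
    split_ifs
    · rw [← abs_neg]; push_cast; congr 1; ring
    · push_cast; congr 1; ring
  rw [hW'] at hW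
  -- An odd step reverses the sign of the second coordinate relative to W, so (g', E') enters with
  -- opposite signs in the odd and even cases.
  have hg2 : ∃ γ E₂ : ℝ, HalfBound (c * (1 + α' * (leftStep a e q).1)) α' γ (leftStep a e q).1 E₂ ∧
      HalfBound (c * (1 + α' * (leftStep a e q).1)) α' (-γ) (leftStep a e q).1 (-E₂) ∧
      g = α * ((if Odd a then 1 else 0) + γ) ∧
      (if Odd a then 1 else 0) + q.2 = -(e * (a + q.1) * E₂) := by
    by_cases ho : Odd a
    · rw [if_pos ho] at hg hE ⊢
      refine ⟨-g', -(leftStep a e q).2, hv'.lower, ?_, by rw [hg]; ring, ?_⟩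
      · rw [neg_neg, neg_neg]; exact hv'.upper
      · linear_combination (-e : ℝ) * hE - (1 + q.2) * hee
    · rw [if_neg ho] at hg hE ⊢
      refine ⟨g', (leftStep a e q).2, hv'.upper, hv'.lower, by rw [hg]; ring, ?_⟩
      linear_combination (e : ℝ) * hE - q.2 * hee
  obtain ⟨γ, E₂, hh1, hh2, hh3, hh4⟩ := hg2
  -- Negating the point and (g, E) at once preserves the absolute value of the product, which
  -- reduces z < 0 to z > 0.
  rcases lt_or_gt_of_ne hz with hneg | hpos
  · have hneg' : (p.2 : ℝ) < 0 := by exact_mod_cast hneg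
    have hZ : (1 : ℝ) ≤ -p.2 := by
      have : 1 ≤ -p.2 := by omega
      exact_mod_cast this
    rw [abs_of_neg hneg'] at hX hW
    have := HalfBound.point_le (X := -(p.1 : ℝ)) (Z := -(p.2 : ℝ)) (o := -(if Odd a then 1 else 0))
      (γ := -γ) (E₂ := -E₂) her hm hα0 hα1 hB hα1' hB' hw0 htail hB'eq
      (by linear_combination -hh3 : -g = _) (by linear_combination -hh4 : _ + -q.2 = _) hm' hv.lower
      hh2 (by rw [neg_neg, neg_neg]; exact hh1) hZ (by rw [abs_neg]; exact hX) (by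
        rw [← abs_neg]
        refine hW.trans_eq ?_
        congr 1; ring)
    refine this.trans_eq ?_
    unfold rightVal leftVal
    congr 1; ring
  · have hpos' : (0 : ℝ) < p.2 := by exact_mod_cast hpos
    have hZ : (1 : ℝ) ≤ p.2 := by exact_mod_cast hpos
    rw [abs_of_pos hpos'] at hX hW
    exact HalfBound.point_le (X := (p.1 : ℝ)) (Z := (p.2 : ℝ)) (o := if Odd a then 1 else 0)
      (γ := γ) (E₂ := E₂) her hm hα0 hα1 hB hα1' hB' hw0 htail hB'eq
      hh3 hh4 hm' hv.upper hh1 hh2 hZ hX hW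

/-- A descent in the second coordinates of a point stops. -/
theorem exists_local_min {a : ℕ → ℕ} {e : ℕ → ℤ} (he : ∀ k, e k = 1 ∨ e k = -1) (p : ℤ × ℤ)
    {k₁ : ℕ} (h : (ptSeq a e p k₁).2.natAbs ≤ (ptSeq a e p k₁).1.natAbs) :
    ∃ k, k₁ ≤ k ∧ (ptSeq a e p k).2.natAbs ≤ (ptSeq a e p k).1.natAbs ∧
      (ptSeq a e p k).2.natAbs ≤ (ptSeq a e p (k + 1)).2.natAbs := by
  by_contra hcon
  push Not at hcon
  have key : ∀ j, (ptSeq a e p (k₁ + j)).2.natAbs ≤ (ptSeq a e p (k₁ + j)).1.natAbs ∧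
      (ptSeq a e p (k₁ + j)).2.natAbs + j ≤ (ptSeq a e p k₁).2.natAbs := by
    intro j
    induction j with
    | zero => exact ⟨h, le_rfl⟩
    | succ j ih =>
      have h1 := hcon (k₁ + j) (by omega) ih.1
      have h2 : (ptSeq a e p (k₁ + j + 1)).1.natAbs = (ptSeq a e p (k₁ + j)).2.natAbs :=
        natAbs_stepPt_fst (he _)
      rw [← add_assoc]
      omega
  have := (key ((ptSeq a e p k₁).2.natAbs + 1)).2
  omega

namespace RightSystem

variable {a : ℕ → ℕ} {e : ℕ → ℤ} {α g : ℕ → ℝ}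

theorem int_sign (h : RightSystem a (fun k => (e k : ℝ)) α g) (k : ℕ) : e k = 1 ∨ e k = -1 := by
  rcases h.sign k with h1 | h1
  · left; exact_mod_cast h1
  · right; exact_mod_cast h1

theorem leftBdd (h : RightSystem a (fun k => (e k : ℝ)) α g) (k : ℕ) :
    LeftBdd (leftSeq a (fun k => (e k : ℝ)) (0, 0) k) :=
  LeftBdd.zero.seq h.two_le h.sign h.two k

theorem one_add_pos (h : RightSystem a (fun k => (e k : ℝ)) α g) (k : ℕ) :
    0 < 1 + α k * (leftSeq a (fun k => (e k : ℝ)) (0, 0) k).1 := by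
  nlinarith [(h.leftBdd k).lower, h.pos k, h.lt k]

theorem exists_rightVal_eq (h : RightSystem a (fun k => (e k : ℝ)) α g) (k : ℕ) :
    ∃ C : ℝ, 0 < C ∧ ∀ p, |rightVal (α 0) (g 0) p| =
      C * |rightVal (α k) (g k) (ptSeq a e p k)| := by
  induction k with
  | zero => exact ⟨1, one_pos, fun p => by rw [one_mul]; rfl⟩
  | succ k ih =>
    obtain ⟨C, hC, ih⟩ := ih
    refine ⟨C * α k, mul_pos hC (h.pos k), fun p => ?_⟩
    rw [ih, abs_rightVal_step (h.pos k) (h.tail k) (h.right k), mul_assoc]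
    rfl

theorem exists_leftVal_eq (h : RightSystem a (fun k => (e k : ℝ)) α g) (k : ℕ) :
    ∃ C : ℝ, (8 / 5) ^ k ≤ C ∧ ∀ p : ℤ × ℤ, |(p.1 : ℝ)| =
      C * |leftVal (leftSeq a (fun k => (e k : ℝ)) (0, 0) k) (ptSeq a e p k)| := by
  induction k with
  | zero => exact ⟨1, by simp, fun p => by simp [leftVal, leftSeq, ptSeq]⟩
  | succ k ih =>
    obtain ⟨C, hC, ih⟩ := ih
    have hw := (h.leftBdd k).den (h.two_le k)
    refine ⟨C * (a k + (leftSeq a (fun k => (e k : ℝ)) (0, 0) k).1), ?_, fun p => ?_⟩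
    · rw [pow_succ]
      have : (0 : ℝ) ≤ (8 / 5) ^ k := by positivity
      exact mul_le_mul hC hw (by norm_num) (this.trans hC)
    · rw [ih, abs_leftVal_step (h.int_sign k) (by linarith), mul_assoc]
      rfl

/-- A step divides the absolute values of the two factors by α and a + B, and α(a + B)(1 + α'B') = 1
+ αB by the tail relation. -/
theorem product_eq (h : RightSystem a (fun k => (e k : ℝ)) α g) (p : ℤ × ℤ) (k : ℕ) :
    |rightVal (α 0) (g 0) p| * |(p.1 : ℝ)| *
        (1 + α k * (leftSeq a (fun k => (e k : ℝ)) (0, 0) k).1) =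
      |rightVal (α k) (g k) (ptSeq a e p k) *
        leftVal (leftSeq a (fun k => (e k : ℝ)) (0, 0) k) (ptSeq a e p k)| := by
  induction k with
  | zero => simp [leftVal, leftSeq, ptSeq, abs_mul]
  | succ k ih =>
    have hw := (h.leftBdd k).den (h.two_le k)
    have hw0 : 0 < (a k : ℝ) + (leftSeq a (fun k => (e k : ℝ)) (0, 0) k).1 := by linarith
    rw [abs_mul, abs_rightVal_step (h.pos k) (h.tail k) (h.right k),
      abs_leftVal_step (h.int_sign k) hw0] at ih
    have hk : 0 < α k * (a k + (leftSeq a (fun k => (e k : ℝ)) (0, 0) k).1) :=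
      mul_pos (h.pos k) hw0
    apply mul_left_cancel₀ hk.ne'
    have hB : (leftSeq a (fun k => (e k : ℝ)) (0, 0) (k + 1)).1 *
        (a k + (leftSeq a (fun k => (e k : ℝ)) (0, 0) k).1) = e k := by
      change (e k : ℝ) / _ * _ = _
      exact div_mul_cancel₀ _ hw0.ne'
    rw [abs_mul]
    change _ = α k * (a k + (leftSeq a (fun k => (e k : ℝ)) (0, 0) k).1) *
      (|rightVal (α (k + 1)) (g (k + 1)) (stepPt (a k) (e k) (ptSeq a e p k))| *
        |leftVal (leftStep (a k) (e k) (leftSeq a (fun k => (e k : ℝ)) (0, 0) k))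
          (stepPt (a k) (e k) (ptSeq a e p k))|)
    have ht := h.tail k
    linear_combination ih + (|rightVal (α 0) (g 0) p| * |(p.1 : ℝ)|) * (α k * α (k + 1)) * hB
      + (|rightVal (α 0) (g 0) p| * |(p.1 : ℝ)|) * ht

/-- Vertex bounds from some point on give a bound at all but finitely many points. -/
theorem exists_le_abs (h : RightSystem a (fun k => (e k : ℝ)) α g) {c : ℝ} (hc : 0 < c) (hc1 : c ≤ 1)
    {k₁ : ℕ} (hv : ∀ k, k₁ ≤ k → VertexBound c (α k) (g k)
      (leftSeq a (fun k => (e k : ℝ)) (0, 0) k).1 (leftSeq a (fun k => (e k : ℝ)) (0, 0) k).2) :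
    ∃ N : ℝ, ∀ p : ℤ × ℤ, Odd p.1 → Odd p.2 → N ≤ |(p.1 : ℝ)| →
      c ≤ |rightVal (α 0) (g 0) p| * |(p.1 : ℝ)| := by
  obtain ⟨C, hC, hright⟩ := h.exists_rightVal_eq k₁
  obtain ⟨C', hC', hleft⟩ := h.exists_leftVal_eq k₁
  have hC'0 : 0 < C' := lt_of_lt_of_le (by positivity) hC'
  -- The first bound forces the right value at k₁ below 1 whenever the product is below c ≤ 1; the
  -- second makes the left value at least 8. Were |x| ≤ |z| there, then |z| ≤ 3 and the left value
  -- would be at most 3 + 15/8 + 5/3 < 8.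
  refine ⟨max (1 / C) (8 * C'), fun p h1 h2 hN => ?_⟩
  have hN1 := (le_max_left _ _).trans hN
  have hN2 := (le_max_right _ _).trans hN
  by_contra hcon
  push Not at hcon
  have hodd : ∀ k, Odd (ptSeq a e p k).1 ∧ Odd (ptSeq a e p k).2 := by
    intro k
    induction k with
    | zero => exact ⟨h1, h2⟩
    | succ k ih => exact odd_stepPt (h.int_sign k) ih.1 ih.2
  have hle : (ptSeq a e p k₁).2.natAbs ≤ (ptSeq a e p k₁).1.natAbs := by
    by_contra hlt
    push Not at hlt
    set x : ℝ := ((ptSeq a e p k₁).1 : ℝ) with hx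
    set z : ℝ := ((ptSeq a e p k₁).2 : ℝ) with hz
    have hxz : |x| ≤ |z| := by
      rw [hx, hz, ← Int.cast_abs, ← Int.cast_abs, Int.abs_eq_natAbs, Int.abs_eq_natAbs]
      exact_mod_cast hlt.le
    have hr : |rightVal (α k₁) (g k₁) (ptSeq a e p k₁)| < 1 := by
      by_contra hge
      push Not at hge
      have h3 : C * 1 ≤ |rightVal (α 0) (g 0) p| := by
        rw [hright]; exact mul_le_mul_of_nonneg_left hge hC.le
      have h4 : C * (1 / C) ≤ |rightVal (α 0) (g 0) p| * |(p.1 : ℝ)| :=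
        mul_le_mul (by linarith) hN1 (by positivity) (abs_nonneg _)
      rw [mul_one_div_cancel hC.ne'] at h4
      linarith
    have hl : 8 ≤ |leftVal (leftSeq a (fun k => (e k : ℝ)) (0, 0) k₁) (ptSeq a e p k₁)| := by
      rw [hleft, mul_comm] at hN2
      exact le_of_mul_le_mul_left hN2 hC'0
    obtain ⟨h5, h6⟩ := h.g_nonneg k₁
    have h7 := h.lt k₁
    have h8 := h.pos k₁
    have hb := h.leftBdd k₁
    have hz3 : |z| ≤ 3 := by
      have e1 : z = rightVal (α k₁) (g k₁) (ptSeq a e p k₁) + (x * α k₁ - g k₁) := by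
        unfold rightVal; ring
      have e2 : |z| ≤ |rightVal (α k₁) (g k₁) (ptSeq a e p k₁)| + (|x| * α k₁ + g k₁) := by
        calc |z| = |rightVal (α k₁) (g k₁) (ptSeq a e p k₁) + (x * α k₁ - g k₁)| := by rw [← e1]
          _ ≤ _ := (abs_add_le _ _).trans (add_le_add le_rfl ((abs_sub _ _).trans
            (by rw [abs_mul, abs_of_pos h8, abs_of_nonneg h5])))
      nlinarith [abs_nonneg x]
    have hB : |(leftSeq a (fun k => (e k : ℝ)) (0, 0) k₁).1| ≤ 5 / 8 :=
      abs_le.2 ⟨by linarith [hb.lower], hb.upper⟩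
    have h9 : |leftVal (leftSeq a (fun k => (e k : ℝ)) (0, 0) k₁) (ptSeq a e p k₁)| ≤
        |x| + |z| * (5 / 8) + 5 / 3 := by
      unfold leftVal
      refine (abs_add_le _ _).trans (add_le_add ((abs_add_le _ _).trans (add_le_add le_rfl ?_))
        hb.abs_le)
      rw [abs_mul]
      exact mul_le_mul_of_nonneg_left hB (abs_nonneg _)
    linarith
  obtain ⟨k, hk, h3, h4⟩ := exists_local_min h.int_sign p hle
  have h5 := VertexBound.point_le (h.int_sign k) (h.two_le k) hc (h.leftBdd k) (h.leftBdd (k + 1))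
    (h.pos k) (h.lt k) (h.pos (k + 1)) (h.lt (k + 1)) (h.tail k) (h.right k) (hv k hk)
    (hv (k + 1) (by omega)) (hodd k).2 h3 h4
  rw [← h.product_eq] at h5
  linarith [le_of_mul_le_mul_right h5 (h.one_add_pos k)]

end RightSystem

/-! ### The nearest integer expansion -/

theorem distInt_eq_min (x : ℝ) : distInt x = min (Int.fract x) (1 - Int.fract x) :=
  abs_sub_round_eq_min x

theorem distInt_le (x : ℝ) : distInt x ≤ 1 / 2 := abs_sub_round x

theorem irrational_distInt {x : ℝ} (hx : Irrational x) : Irrational (distInt x) := by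
  have h : Irrational (x - round x) := hx.sub_intCast _
  unfold distInt
  rcases abs_choice (x - round x) with h1 | h1 <;> rw [h1]
  · exact h
  · exact h.neg

/-- The conditions on the number to be expanded. -/
structure Expandable (α : ℝ) : Prop where
  irrational : Irrational α
  pos : 0 < α
  lt : α < 1 / 2

namespace Expandable

variable {α : ℝ}

theorem half_ne {x : ℝ} (hx : Irrational x) : x ≠ 1 / 2 := by
  have := hx.ne_rat (1 / 2)
  simpa using this

theorem distInt_inv (h : Expandable α) : Expandable (distInt α⁻¹) := by
  have hi := irrational_distInt h.irrational.inv
  exact ⟨hi, lt_of_le_of_ne (abs_nonneg _) hi.ne_zero.symm,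
    lt_of_le_of_ne (distInt_le _) (half_ne hi)⟩

theorem tail (h : Expandable α) (i : ℕ) : Expandable (tail α i) := by
  induction i with
  | zero => exact h
  | succ i ih => exact ih.distInt_inv

theorem two_lt (h : Expandable α) : 2 < α⁻¹ := by
  rw [lt_inv_comm₀ (by norm_num) h.pos]
  simpa using h.lt

theorem sgn_eq (α : ℝ) (i : ℕ) : sgn α i = 1 ∨ sgn α i = -1 := by
  match i with
  | 0 => left; rfl
  | 1 => left; rfl
  | i + 2 => rw [sgn]; split_ifs <;> simp

theorem quot_add (h : Expandable α) (i : ℕ) :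
    (quot α (i + 1) : ℝ) + (sgn α (i + 2) : ℝ) * NICF.tail α (i + 1) = (NICF.tail α i)⁻¹ := by
  have ht := h.tail i
  have h2 := ht.two_lt
  set x := (NICF.tail α i)⁻¹ with hx
  change ((if distInt x = Int.fract x then ⌊x⌋₊ else ⌈x⌉₊ : ℕ) : ℝ) +
    ((if distInt x = Int.fract x then (1 : ℤ) else -1 : ℤ) : ℝ) * distInt x = x
  have hirr : Irrational x := ht.irrational.inv
  have hfl : ((⌊x⌋₊ : ℕ) : ℝ) = (⌊x⌋ : ℝ) := natCast_floor_eq_intCast_floor (by linarith)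
  by_cases hf : distInt x = Int.fract x
  · rw [if_pos hf, if_pos hf, hf, hfl, Int.cast_one, one_mul]
    exact Int.floor_add_fract x
  · rw [if_neg hf, if_neg hf]
    have h1 : distInt x = 1 - Int.fract x := by
      rw [distInt_eq_min] at hf ⊢
      rcases min_choice (Int.fract x) (1 - Int.fract x) with h3 | h3
      · exact absurd h3 hf
      · exact h3
    have h3 : ((⌈x⌉₊ : ℕ) : ℝ) = (⌈x⌉ : ℝ) := natCast_ceil_eq_intCast_ceil (by linarith)
    have h4 : Int.fract x ≠ 0 := fun h0 => by
      have := Int.floor_add_fract x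
      rw [h0, add_zero] at this
      exact hirr.ne_int _ this.symm
    rw [h3, h1, Int.ceil_eq_add_one_sub_fract h4]
    push_cast
    ring

theorem tail_mul (h : Expandable α) (i : ℕ) :
    NICF.tail α i * ((quot α (i + 1) : ℝ) + (sgn α (i + 2) : ℝ) * NICF.tail α (i + 1)) = 1 := by
  rw [h.quot_add, mul_inv_cancel₀ (h.tail i).pos.ne']

/-- The inverse of each tail exceeds 2, so rounding it up cannot give 2; hence 2 is always followed
by a plus sign. -/
theorem two_le_quot (h : Expandable α) (i : ℕ) :
    2 ≤ quot α (i + 1) ∧ (quot α (i + 1) = 2 → sgn α (i + 2) = 1) := by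
  have h1 := h.quot_add i
  have h2 := (h.tail i).two_lt
  have h3 := (h.tail (i + 1)).pos
  have h4 := (h.tail (i + 1)).lt
  rcases sgn_eq α (i + 2) with h5 | h5 <;> rw [h5] at h1 <;> push_cast at h1
  · refine ⟨?_, fun _ => h5⟩
    have : (1 : ℝ) < quot α (i + 1) := by linarith
    have : 1 < quot α (i + 1) := by exact_mod_cast this
    omega
  · have : (2 : ℝ) < quot α (i + 1) := by linarith
    have : 2 < quot α (i + 1) := by exact_mod_cast this
    exact ⟨this.le, fun h => by omega⟩

theorem conv_succ (h : Expandable α) (i : ℕ) :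
    (convDen α (i + 1) * α - convNum α (i + 1) : ℝ) =
      -((sgn α (i + 2) : ℝ) * NICF.tail α (i + 1)) * (convDen α i * α - convNum α i) := by
  induction i with
  | zero =>
    have h1 := h.tail_mul 0
    simp only [convDen, convNum, sgn, NICF.tail] at h1 ⊢
    push_cast
    linear_combination h1
  | succ i ih =>
    have h1 := h.tail_mul (i + 1)
    have h2 := (h.tail (i + 1)).pos
    have e1 : (convDen α (i + 2) * α - convNum α (i + 2) : ℝ) =
        quot α (i + 2) * (convDen α (i + 1) * α - convNum α (i + 1)) +
          sgn α (i + 2) * (convDen α i * α - convNum α i) := by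
      simp only [convDen, convNum]
      push_cast
      ring
    rw [show i + 1 + 1 = i + 2 by ring, e1, ih]
    rw [show i + 1 + 1 = i + 2 by ring] at h1
    linear_combination (-(sgn α (i + 2) : ℝ) * (convDen α i * α - convNum α i)) * h1

theorem convDist_succ (h : Expandable α) (i : ℕ) :
    convDist α (i + 1) = NICF.tail α (i + 1) * convDist α i := by
  unfold convDist
  rw [h.conv_succ, abs_mul, abs_neg, abs_mul, abs_sign (sign_cast (sgn_eq α _)), one_mul,
    abs_of_pos (h.tail _).pos]

end Expandable

/-! ### The series for γ_* and its normalized tails -/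

/-- The products of the tails. -/
def tailProd (α : ℝ) (n : ℕ) : ℝ := ∏ j ∈ Finset.range n, tail α j

/-- The signs `-(-1)^j`, where `j` is the number of odd terms among the first partial
quotients. -/
def paritySign (α : ℝ) (k : ℕ) : ℤ :=
  -(-1) ^ ((Finset.Icc 1 k).filter (fun l => Odd (quot α l))).card

theorem card_filter_succ (α : ℝ) (k : ℕ) :
    ((Finset.Icc 1 (k + 1)).filter (fun l => Odd (quot α l))).card =
      ((Finset.Icc 1 k).filter (fun l => Odd (quot α l))).card +
        if Odd (quot α (k + 1)) then 1 else 0 := by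
  rw [← Finset.insert_Icc_right_eq_Icc_add_one (by omega : 1 ≤ k + 1), Finset.filter_insert]
  split_ifs with h
  · rw [Finset.card_insert_of_notMem (by simp)]
  · rfl

theorem altSign_succ (α : ℝ) (k : ℕ) :
    altSign α (k + 1) = if Odd (quot α (k + 1)) then paritySign α k else 0 := by
  unfold altSign paritySign
  rw [card_filter_succ]
  by_cases h : Odd (quot α (k + 1))
  · rw [if_neg (Nat.not_even_iff_odd.2 h), if_pos h, if_pos h, pow_succ]
    ring
  · rw [if_pos (Nat.not_odd_iff_even.1 h), if_neg h]

theorem paritySign_succ (α : ℝ) (k : ℕ) :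
    paritySign α (k + 1) = if Odd (quot α (k + 1)) then -paritySign α k else paritySign α k := by
  unfold paritySign
  rw [card_filter_succ]
  split_ifs
  · rw [pow_succ]; ring
  · simp

theorem paritySign_eq (α : ℝ) (k : ℕ) : paritySign α k = 1 ∨ paritySign α k = -1 := by
  unfold paritySign
  rcases neg_one_pow_eq_or ℤ ((Finset.Icc 1 k).filter (fun l => Odd (quot α l))).card with h | h <;>
    rw [h] <;> simp

theorem abs_altSign_le (α : ℝ) (k : ℕ) : |(altSign α k : ℝ)| ≤ 1 := by
  unfold altSign
  split_ifs
  · simp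
  · rcases neg_one_pow_eq_or ℤ ((Finset.Icc 1 k).filter (fun l => Odd (quot α l))).card with h | h <;>
      rw [h] <;> simp

namespace Expandable

variable {α : ℝ}

theorem tailProd_pos (h : Expandable α) (n : ℕ) : 0 < tailProd α n :=
  Finset.prod_pos fun j _ => (h.tail j).pos

theorem tailProd_succ (α : ℝ) (n : ℕ) : tailProd α (n + 1) = tailProd α n * NICF.tail α n :=
  Finset.prod_range_succ _ _

theorem tailProd_add_le (h : Expandable α) (k i : ℕ) :
    tailProd α (k + i) ≤ tailProd α k * (1 / 2) ^ i := by
  induction i with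
  | zero => simp
  | succ i ih =>
    rw [← add_assoc, tailProd_succ, pow_succ, ← mul_assoc]
    exact mul_le_mul ih (h.tail _).lt.le (h.tail _).pos.le
      (mul_nonneg (h.tailProd_pos k).le (by positivity))

theorem convDist_eq (h : Expandable α) (n : ℕ) : convDist α n = tailProd α (n + 1) := by
  induction n with
  | zero => simp [convDist, convDen, convNum, tailProd, NICF.tail, abs_of_pos h.pos]
  | succ n ih => rw [h.convDist_succ, ih, tailProd_succ _ (n + 1), mul_comm]

theorem summable_mul_tailProd (h : Expandable α) {u : ℕ → ℝ} (hu : ∀ n, |u n| ≤ 1) (k : ℕ) :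
    Summable fun i => u i * tailProd α (k + i) := by
  refine Summable.of_norm_bounded (g := fun i => tailProd α k * (1 / 2) ^ i)
    (summable_geometric_two.mul_left _) fun i => ?_
  rw [Real.norm_eq_abs, abs_mul, abs_of_pos (h.tailProd_pos _)]
  calc _ ≤ 1 * tailProd α (k + i) := mul_le_mul_of_nonneg_right (hu i) (h.tailProd_pos _).le
    _ ≤ _ := by rw [one_mul]; exact h.tailProd_add_le k i

/-- The alternating part of the series for `γ_*`, from index `k + 1` on. -/
def _root_.NICF.altSum (α : ℝ) (k : ℕ) : ℝ :=
  ∑' i : ℕ, (altSign α (k + i + 1) : ℝ) * tailProd α (k + i + 1)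

theorem summable_altSum (h : Expandable α) (k : ℕ) :
    Summable fun i : ℕ => (altSign α (k + i + 1) : ℝ) * tailProd α (k + i + 1) := by
  have := h.summable_mul_tailProd (u := fun i => (altSign α (k + i + 1) : ℝ))
    (fun n => abs_altSign_le α _) (k + 1)
  refine this.congr fun i => ?_
  rw [show k + 1 + i = k + i + 1 by ring]

theorem altSum_eq (h : Expandable α) (k : ℕ) :
    altSum α k = altSign α (k + 1) * tailProd α (k + 1) + altSum α (k + 1) := by
  unfold altSum
  rw [(h.summable_altSum k).tsum_eq_zero_add]
  congr 1
  refine tsum_congr fun i => ?_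
  rw [show k + (i + 1) + 1 = k + 1 + i + 1 by ring]

theorem abs_altSum_le (h : Expandable α) (k : ℕ) : |altSum α k| ≤ tailProd α k := by
  have hg : HasSum (fun i : ℕ => tailProd α k * (1 / 2) ^ (i + 1)) (tailProd α k) := by
    have := (hasSum_geometric_two.mul_left (1 / 2)).mul_left (tailProd α k)
    norm_num at this
    refine (this.congr_fun fun i => ?_)
    rw [pow_succ]; ring
  have := tsum_of_norm_bounded hg (f := fun i : ℕ =>
    (altSign α (k + i + 1) : ℝ) * tailProd α (k + i + 1)) fun i => by
    rw [Real.norm_eq_abs, abs_mul, abs_of_pos (h.tailProd_pos _)]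
    calc _ ≤ 1 * tailProd α (k + i + 1) :=
          mul_le_mul_of_nonneg_right (abs_altSign_le α _) (h.tailProd_pos _).le
      _ ≤ _ := by rw [one_mul]; exact h.tailProd_add_le k (i + 1)
  exact this

/-- The normalized alternating sums. -/
def _root_.NICF.rightSeq (α : ℝ) (k : ℕ) : ℝ := paritySign α k * altSum α k / tailProd α k

/-- Splitting off one term of the alternating sum and dividing by the product of tails gives the
recursion. The parity sign flips exactly at odd quotients, which turns g' into 1 − g' there and
leaves it alone at even ones. -/
theorem rightSystem (h : Expandable α) :
    RightSystem (fun k => quot α (k + 1)) (fun k => (sgn α (k + 2) : ℝ)) (NICF.tail α)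
      (rightSeq α) where
  two_le k := (h.two_le_quot k).1
  sign k := sign_cast (sgn_eq α _)
  two k hk := by rw [(h.two_le_quot k).2 hk]; simp
  pos k := (h.tail k).pos
  lt k := (h.tail k).lt
  tail k := h.tail_mul k
  right k := by
    have h0 := h.tailProd_pos k
    have h1 := h.tailProd_pos (k + 1)
    have h2 := (h.tail k).pos
    have h3 : (paritySign α k : ℝ) * paritySign α k = 1 := by
      rcases paritySign_eq α k with h | h <;> rw [h] <;> norm_num
    unfold rightSeq
    rw [h.altSum_eq k, altSign_succ, paritySign_succ]
    split_ifs
    · rw [tailProd_succ]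
      field_simp
      push_cast
      linear_combination (NICF.tail α k * tailProd α k) * h3
    · rw [tailProd_succ]
      field_simp
      push_cast
      ring
  bdd k := by
    unfold rightSeq
    rw [abs_div, abs_mul, abs_of_pos (h.tailProd_pos k), abs_sign (sign_cast (paritySign_eq α k)),
      one_mul, div_le_one (h.tailProd_pos k)]
    exact h.abs_altSum_le k

/-- With Pₙ the product of the first n tails, D_{i−1} = P_i and the tail relation give (a_i − 1 +
ε_i)P_i = (P_{i−1} + ε_iP_i) − (P_i + ε_{i+1}P_{i+1}). This telescopes to P₀ + ε₁P₁ = 1 + α, and the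
λ part is −g₀. -/
theorem hasSum_gammaTerm (h : Expandable α) :
    HasSum (fun n : ℕ => gammaTerm α (n + 1)) ((1 + α - rightSeq α 0) / 2) := by
  have hs : ∀ n, |(sgn α n : ℝ)| ≤ 1 := fun n => (abs_sign (sign_cast (sgn_eq α n))).le
  have h0 : Summable fun n => tailProd α n := by
    simpa using h.summable_mul_tailProd (u := fun _ => 1) (by simp) 0
  have h1 : Summable fun n => (sgn α (n + 1) : ℝ) * tailProd α (n + 1) := by
    refine (h.summable_mul_tailProd (u := fun n => (sgn α (n + 1) : ℝ)) (fun n => hs _) 1).congr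
      fun i => ?_
    rw [add_comm]
  have hu : Summable fun n => tailProd α n + (sgn α (n + 1) : ℝ) * tailProd α (n + 1) := h0.add h1
  have htel : HasSum (fun n => (tailProd α n + (sgn α (n + 1) : ℝ) * tailProd α (n + 1)) -
      (tailProd α (n + 1) + (sgn α (n + 2) : ℝ) * tailProd α (n + 2))) (1 + α) := by
    rw [(hu.sub ((summable_nat_add_iff 1).2 hu)).hasSum_iff_tendsto_nat]
    have h2 := hu.tendsto_atTop_zero
    have h3 : Tendsto (fun n => 1 + α - (tailProd α n + (sgn α (n + 1) : ℝ) * tailProd α (n + 1)))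
        atTop (𝓝 (1 + α - 0)) := tendsto_const_nhds.sub h2
    rw [sub_zero] at h3
    refine h3.congr fun n => ?_
    rw [Finset.sum_range_sub' (fun n => tailProd α n + (sgn α (n + 1) : ℝ) * tailProd α (n + 1))]
    simp [tailProd, sgn, NICF.tail]
  have halt : HasSum (fun n : ℕ => (altSign α (n + 1) : ℝ) * tailProd α (n + 1)) (altSum α 0) := by
    have := (h.summable_altSum 0).hasSum
    simpa [altSum] using this
  have hg : rightSeq α 0 = -altSum α 0 := by
    simp [rightSeq, paritySign, tailProd]
  rw [hg, sub_neg_eq_add]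
  refine ((htel.add halt).div_const 2).congr_fun fun n => ?_
  unfold gammaTerm
  rw [Nat.add_sub_cancel, h.convDist_eq]
  have := h.tail_mul n
  rw [tailProd_succ _ (n + 1), tailProd_succ _ n]
  linear_combination (tailProd α n / 2) * this

theorem two_mul_gammaStar (h : Expandable α) : 2 * gammaStar α = 1 + α - rightSeq α 0 := by
  unfold gammaStar
  rw [h.hasSum_gammaTerm.tsum_eq]
  ring

end Expandable

namespace Expandable

variable {α : ℝ}

/-- The dictionary between the two problems: pairs (n, r) correspond to points with odd coordinates.
-/
theorem rightVal_eq (h : Expandable α) (n r : ℤ) :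
    rightVal α (rightSeq α 0) (1 - 2 * n, -(2 * r + 1)) = 2 * (n * α - gammaStar α - r) := by
  unfold rightVal
  push_cast
  linear_combination h.two_mul_gammaStar

theorem abs_rightVal_round (h : Expandable α) (n : ℤ) :
    |rightVal α (rightSeq α 0) (1 - 2 * n, -(2 * round (n * α - gammaStar α) + 1))| =
      2 * distInt (n * α - gammaStar α) := by
  rw [h.rightVal_eq, abs_mul, abs_two]
  rfl

theorem two_mul_distInt_le (h : Expandable α) (n r : ℤ) :
    2 * distInt (n * α - gammaStar α) ≤
      |rightVal α (rightSeq α 0) (1 - 2 * n, -(2 * r + 1))| := by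
  rw [h.rightVal_eq, abs_mul, abs_two]
  exact mul_le_mul_of_nonneg_left (round_le _ _) (by norm_num)

end Expandable

/-! ### The lower bound for the approximation constant -/

theorem tendsto_abs_cofinite : Tendsto (fun n : ℤ => |((1 - 2 * n : ℤ) : ℝ)|) cofinite atTop := by
  have h1 : Tendsto (fun n : ℤ => ‖(n : ℝ)‖) cofinite atTop :=
    tendsto_norm_cocompact_atTop.comp Int.tendsto_coe_cofinite
  refine tendsto_atTop_mono (fun n => ?_) (tendsto_atTop_add_const_right _ (-1) h1)
  rw [Real.norm_eq_abs]
  push_cast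
  have h2 : |2 * (n : ℝ)| ≤ |1 - 2 * (n : ℝ)| + 1 := by
    have := abs_sub (1 : ℝ) (1 - 2 * n)
    rw [abs_one] at this
    calc |2 * (n : ℝ)| = |1 - (1 - 2 * (n : ℝ))| := by ring_nf
      _ ≤ _ := by linarith
  rw [abs_mul, abs_two] at h2
  linarith [abs_nonneg (n : ℝ)]

theorem eventually_le_quot {α : ℝ} {R : ℕ} (hR : liminfQuot α = (R : ℕ∞)) :
    ∃ k₀, ∀ k, k₀ ≤ k → R ≤ quot α (k + 1) := by
  rcases Nat.eq_zero_or_pos R with rfl | hpos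
  · exact ⟨0, fun _ _ => Nat.zero_le _⟩
  have h1 : ((R - 1 : ℕ) : ℕ∞) < liminf (fun i => (quot α i : ℕ∞)) atTop := by
    change _ < liminfQuot α
    rw [hR]
    exact_mod_cast Nat.sub_lt hpos one_pos
  obtain ⟨k₀, hk⟩ := eventually_atTop.1 (eventually_lt_of_lt_liminf h1)
  refine ⟨k₀, fun k hk' => ?_⟩
  have := hk (k + 1) (by omega)
  have : R - 1 < quot α (k + 1) := by exact_mod_cast this
  omega

theorem Expandable.two_le_of_liminf {α : ℝ} (h : Expandable α) {R : ℕ}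
    (hR : liminfQuot α = (R : ℕ∞)) : 2 ≤ R := by
  have h1 : ((2 : ℕ) : ℕ∞) ≤ liminf (fun i => (quot α i : ℕ∞)) atTop := by
    refine le_liminf_of_le (by isBoundedDefault) ?_
    filter_upwards [eventually_ge_atTop 1] with i hi
    obtain ⟨j, rfl⟩ := Nat.exists_eq_add_of_le' hi
    exact_mod_cast (h.two_le_quot j).1
  change _ ≤ liminfQuot α at h1
  rw [hR] at h1
  exact_mod_cast h1

theorem four_mul_M1_bounds {R : ℕ} (hR : 2 ≤ R) : 0 < 4 * M1 R ∧ 4 * M1 R < 1 := by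
  obtain ⟨P, hP⟩ := exists_cellData hR
  rw [← hP.T_eq]
  exact ⟨P.T_pos, P.T_lt⟩

theorem Expandable.M1_le_approxConst {α : ℝ} (h : Expandable α) {R : ℕ}
    (hR : liminfQuot α = (R : ℕ∞)) :
    ((M1 R : ℝ) : EReal) ≤ approxConst α (gammaStar α) := by
  have hR2 := h.two_le_of_liminf hR
  obtain ⟨k₀, hk₀⟩ := eventually_le_quot hR
  obtain ⟨hM0, hM1⟩ := four_mul_M1_bounds hR2
  refine le_of_forall_lt fun y hy => ?_
  have hy' : max y 0 < ((M1 R : ℝ) : EReal) := max_lt hy (by exact_mod_cast (by linarith : 0 < M1 R))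
  obtain ⟨w, hw1, hw2⟩ := EReal.lt_iff_exists_real_btwn.1 hy'
  have hw0 : 0 < w := by exact_mod_cast (le_max_right _ _).trans_lt hw1
  have hwM : w < M1 R := by exact_mod_cast hw2
  refine ((le_max_left _ _).trans_lt hw1).trans_le ?_
  refine le_liminf_of_le (by isBoundedDefault) ?_
  obtain ⟨c, hc1, hc2⟩ := exists_between (show 4 * w < 4 * M1 R by linarith)
  have hc0 : 0 < c := by linarith
  obtain ⟨k₁, hk₁⟩ := h.rightSystem.eventually_vertexBound hR2 hk₀ hc0 hc2
  obtain ⟨N, hN⟩ := h.rightSystem.exists_le_abs (e := fun k => sgn α (k + 2)) hc0 (by linarith) hk₁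
  -- Passing from X = |1 − 2n| to 2|n| ≥ X − 1 costs a lower order term; X ≥ c/(c − 4w) means c(X −
  -- 1) ≥ 4wX, which absorbs it.
  filter_upwards [tendsto_abs_cofinite.eventually_ge_atTop N,
    tendsto_abs_cofinite.eventually_ge_atTop (c / (c - 4 * w))] with n hn1 hn2
  have h1 := hN (1 - 2 * n, -(2 * round (n * α - gammaStar α) + 1)) ⟨-n, by ring⟩
    ⟨-(round (n * α - gammaStar α) + 1), by ring⟩ hn1
  change c ≤ |rightVal α (rightSeq α 0) _| * _ at h1
  rw [h.abs_rightVal_round] at h1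
  simp only at h1
  rw [div_le_iff₀ (by linarith)] at hn2
  have h2 : |((1 - 2 * n : ℤ) : ℝ)| ≤ 2 * |(n : ℝ)| + 1 := by
    push_cast
    refine (abs_sub _ _).trans ?_
    rw [abs_one, abs_mul, abs_two]
    linarith
  set X := |((1 - 2 * n : ℤ) : ℝ)|
  set d := distInt (n * α - gammaStar α)
  have hd : 0 ≤ d := abs_nonneg _
  have hX : 0 < X := pos_of_mul_pos_right (hc0.trans_le h1) (by linarith)
  have h3 : w ≤ |(n : ℝ)| * d := by
    have h4 : c * (X - 1) ≤ 4 * X * (|(n : ℝ)| * d) := by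
      have h5 : 0 ≤ (2 * d * X - c) * (2 * |(n : ℝ)|) := by
        apply mul_nonneg (by linarith); positivity
      nlinarith
    have h6 : X * (4 * w) ≤ X * (4 * (|(n : ℝ)| * d)) := by nlinarith
    linarith [le_of_mul_le_mul_left h6 hX]
  exact_mod_cast h3

/-! ### Realizing prescribed expansions -/

/-- Sequences of partial quotients and signs that occur in nearest integer expansions. -/
structure Admissible (a : ℕ → ℕ) (e : ℕ → ℤ) : Prop where
  two_le : ∀ k, 2 ≤ a k
  sign : ∀ k, e k = 1 ∨ e k = -1
  two : ∀ k, a k = 2 → e k = 1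

namespace Admissible

variable {a : ℕ → ℕ} {e : ℕ → ℤ}

/-- The finite continued fractions with `n` levels beginning at index `i`. -/
def finiteTail (a : ℕ → ℕ) (e : ℕ → ℤ) : ℕ → ℕ → ℝ
  | 0, _ => 0
  | n + 1, i => 1 / (a i + e i * finiteTail a e n (i + 1))

theorem two_le_den (h : Admissible a e) (i : ℕ) {x : ℝ} (h0 : 0 ≤ x) (h1 : x ≤ 1 / 2) :
    2 ≤ (a i : ℝ) + e i * x := by
  rcases h.sign i with h2 | h2 <;> rw [h2] <;> push_cast
  · have : (2 : ℝ) ≤ a i := by exact_mod_cast h.two_le i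
    linarith
  · have : (3 : ℝ) ≤ a i := by
      have h3 : a i ≠ 2 := fun h3 => by
        have := h.two i h3
        omega
      have := h.two_le i
      have : 3 ≤ a i := by omega
      exact_mod_cast this
    linarith

theorem finiteTail_bounds (h : Admissible a e) (n i : ℕ) :
    0 ≤ finiteTail a e n i ∧ finiteTail a e n i ≤ 1 / 2 := by
  induction n generalizing i with
  | zero => simp [finiteTail]
  | succ n ih =>
    have := h.two_le_den i (ih (i + 1)).1 (ih (i + 1)).2
    exact ⟨one_div_nonneg.2 (by linarith), one_div_le_one_div_of_le (by norm_num) this⟩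

/-- All denominators are at least 2, so each level contracts by 1/4. -/
theorem dist_finiteTail (h : Admissible a e) (n i : ℕ) :
    dist (finiteTail a e n i) (finiteTail a e (n + 1) i) ≤ 1 / 2 * (1 / 4) ^ n := by
  induction n generalizing i with
  | zero =>
    have := h.finiteTail_bounds 1 i
    rw [Real.dist_eq, abs_sub_comm, abs_le]
    simp only [finiteTail] at this ⊢
    constructor <;> linarith [this.1, this.2]
  | succ n ih =>
    have h1 := h.finiteTail_bounds n (i + 1)
    have h2 := h.finiteTail_bounds (n + 1) (i + 1)
    have h3 := h.two_le_den i h1.1 h1.2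
    have h4 := h.two_le_den i h2.1 h2.2
    have ih := ih (i + 1)
    rw [Real.dist_eq] at ih ⊢
    rw [show finiteTail a e (n + 1) i = 1 / (a i + e i * finiteTail a e n (i + 1)) from rfl,
      show finiteTail a e (n + 1 + 1) i = 1 / (a i + e i * finiteTail a e (n + 1) (i + 1)) from rfl]
    set x := finiteTail a e n (i + 1)
    set y := finiteTail a e (n + 1) (i + 1)
    have e1 : 1 / ((a i : ℝ) + e i * x) - 1 / (a i + e i * y) =
        -(e i * (x - y)) / ((a i + e i * x) * (a i + e i * y)) := by
      rw [div_sub_div _ _ (by linarith) (by linarith)]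
      congr 1; ring
    have hprod : 0 < ((a i : ℝ) + e i * x) * (a i + e i * y) :=
      mul_pos (by linarith) (by linarith)
    rw [e1, abs_div, abs_neg, abs_mul, abs_sign (sign_cast (h.sign i)), one_mul,
      abs_of_pos hprod, div_le_iff₀ hprod]
    have h5 : 4 ≤ ((a i : ℝ) + e i * x) * (a i + e i * y) := by nlinarith
    have h6 : (0 : ℝ) ≤ 1 / 2 * (1 / 4) ^ (n + 1) := by positivity
    calc _ ≤ 1 / 2 * (1 / 4) ^ n := ih
      _ = 1 / 2 * (1 / 4) ^ (n + 1) * 4 := by ring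
      _ ≤ _ := mul_le_mul_of_nonneg_left h5 h6

theorem exists_tails (h : Admissible a e) :
    ∃ t : ℕ → ℝ, ∀ i, 0 < t i ∧ t i < 1 / 2 ∧ t i * (a i + e i * t (i + 1)) = 1 := by
  have hc : ∀ i, ∃ x, Tendsto (fun n => finiteTail a e n i) atTop (𝓝 x) := fun i =>
    cauchySeq_tendsto_of_complete
      (cauchySeq_of_le_geometric _ _ (by norm_num) fun n => h.dist_finiteTail n i)
  choose t ht using hc
  have h0 : ∀ i, 0 ≤ t i := fun i => ge_of_tendsto' (ht i) fun n => (h.finiteTail_bounds n i).1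
  have h1 : ∀ i, t i ≤ 1 / 2 := fun i => le_of_tendsto' (ht i) fun n => (h.finiteTail_bounds n i).2
  have hrec : ∀ i, t i * (a i + e i * t (i + 1)) = 1 := fun i => by
    have h2 : Tendsto (fun n => (a i : ℝ) + e i * finiteTail a e n (i + 1)) atTop
        (𝓝 (a i + e i * t (i + 1))) := ((ht (i + 1)).const_mul _).const_add _
    have h3 := ((tendsto_add_atTop_iff_nat 1).2 (ht i)).mul h2
    refine tendsto_nhds_unique h3 (tendsto_const_nhds.congr fun n => ?_)
    have := h.two_le_den i (h.finiteTail_bounds n (i + 1)).1 (h.finiteTail_bounds n (i + 1)).2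
    exact (one_div_mul_cancel (by linarith)).symm
  have hpos : ∀ i, 0 < t i := fun i => lt_of_le_of_ne (h0 i) fun h2 => by
    have := hrec i
    rw [← h2, zero_mul] at this
    exact zero_ne_one this
  refine ⟨t, fun i => ⟨hpos i, lt_of_le_of_ne (h1 i) fun h2 => ?_, hrec i⟩⟩
  have h3 := hrec i
  have h4 := hpos (i + 1)
  have h5 := h1 (i + 1)
  rw [h2] at h3
  rcases h.sign i with h6 | h6 <;> rw [h6] at h3 <;> push_cast at h3
  · have : (2 : ℝ) ≤ a i := by exact_mod_cast h.two_le i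
    linarith
  · have h7 : (2 : ℝ) < a i := by linarith
    have h8 : (a i : ℝ) < 3 := by linarith
    have h7 : 2 < a i := by exact_mod_cast h7
    have h8 : a i < 3 := by exact_mod_cast h8
    omega

/-- Descent: if a tail were c/b, the next would have the integer c as a denominator, and 0 < c < b.
-/
theorem irrational_of_tails (h : Admissible a e) {t : ℕ → ℝ}
    (ht : ∀ i, 0 < t i ∧ t i < 1 / 2 ∧ t i * (a i + e i * t (i + 1)) = 1) : Irrational (t 0) := by
  have key : ∀ b : ℕ, ∀ i, ∀ c : ℤ, 0 < b → t i * b ≠ c := by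
    intro b
    induction b using Nat.strong_induction_on with
    | _ b ih =>
      intro i c hb hc
      obtain ⟨h1, h2, h3⟩ := ht i
      have hb' : (0 : ℝ) < b := by exact_mod_cast hb
      have hc0 : (0 : ℝ) < c := by rw [← hc]; positivity
      have hcb : (c : ℝ) < b := by rw [← hc]; nlinarith
      have hc0 : 0 < c := by exact_mod_cast hc0
      lift c to ℕ using hc0.le
      have hcb' : c < b := by exact_mod_cast hcb
      refine ih c hcb' (i + 1) (e i * (b - a i * c)) (by exact_mod_cast hc0) ?_
      have h4 : (e i : ℝ) * e i = 1 := by rcases h.sign i with h | h <;> rw [h] <;> norm_num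
      push_cast at hc ⊢
      rw [← hc]
      linear_combination (e i * b : ℝ) * h3 - (t i * t (i + 1) * b) * h4
  rintro ⟨q, hq⟩
  refine key q.den 0 q.num q.den_pos ?_
  rw [← hq]
  exact_mod_cast Rat.mul_den_eq_num q

end Admissible

theorem nearest_step {x t : ℝ} {m : ℕ} {s : ℤ} (hs : s = 1 ∨ s = -1) (h0 : 0 < t) (h1 : t < 1 / 2)
    (hx : x = m + s * t) (hm : 2 ≤ m) : distInt x = t ∧
      (if distInt x = Int.fract x then ⌊x⌋₊ else ⌈x⌉₊) = m ∧
      (if distInt x = Int.fract x then (1 : ℤ) else -1) = s := by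
  have hm' : (2 : ℝ) ≤ m := by exact_mod_cast hm
  rcases hs with rfl | rfl
  · push_cast at hx
    rw [one_mul] at hx
    have hfl : ⌊x⌋ = m := Int.floor_eq_iff.2 ⟨by push_cast; linarith, by push_cast; linarith⟩
    have hfr : Int.fract x = t := by
      rw [Int.fract, hfl]; push_cast; linarith
    have hd : distInt x = t := by
      rw [distInt_eq_min, hfr, min_eq_left (by linarith)]
    refine ⟨hd, ?_, ?_⟩
    · rw [if_pos (by rw [hd, hfr])]
      exact (Nat.floor_eq_iff (by linarith)).2 ⟨by linarith, by linarith⟩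
    · rw [if_pos (by rw [hd, hfr])]
  · push_cast at hx
    have hfl : ⌊x⌋ = (m : ℤ) - 1 :=
      Int.floor_eq_iff.2 ⟨by push_cast; linarith, by push_cast; linarith⟩
    have hfr : Int.fract x = 1 - t := by
      rw [Int.fract, hfl]; push_cast; linarith
    have hd : distInt x = t := by
      rw [distInt_eq_min, hfr, min_eq_right (by linarith)]
      ring
    have hne : distInt x ≠ Int.fract x := by rw [hd, hfr]; intro h; linarith
    refine ⟨hd, ?_, ?_⟩
    · rw [if_neg hne]
      exact (Nat.ceil_eq_iff (by omega)).2 ⟨by rw [Nat.cast_sub (by omega)]; push_cast; linarith,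
        by linarith⟩
    · rw [if_neg hne]

theorem Admissible.exists_expandable {a : ℕ → ℕ} {e : ℕ → ℤ} (h : Admissible a e) :
    ∃ α, Expandable α ∧ (∀ k, quot α (k + 1) = a k) ∧ ∀ k, sgn α (k + 2) = e k := by
  obtain ⟨t, ht⟩ := h.exists_tails
  have hstep : ∀ i, _ := fun i => nearest_step (x := (t i)⁻¹) (h.sign i) (ht (i + 1)).1
    (ht (i + 1)).2.1 (inv_eq_of_mul_eq_one_right (ht i).2.2) (h.two_le i)
  have htail : ∀ i, tail (t 0) i = t i := by
    intro i
    induction i with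
    | zero => rfl
    | succ i ih => rw [tail, ih]; exact (hstep i).1
  refine ⟨t 0, ⟨h.irrational_of_tails ht, (ht 0).1, (ht 0).2.1⟩, fun k => ?_, fun k => ?_⟩
  · rw [quot, htail]; exact (hstep k).2.1
  · rw [sgn, htail]; exact (hstep k).2.2

/-- The entry 0 must be positive because ε₁ = 1, and an entry following ±2 must be positive because
2 is never reached by rounding up. -/
theorem exists_hasPeriodFrom {P : List ℤ} {c : ℕ → ℤ} (hc : ∀ m, P[m % P.length]? = some (c m))
    (h0 : 0 < c 0) (h2 : ∀ m, 2 ≤ (c m).natAbs) (h2' : ∀ m, (c m).natAbs = 2 → 0 < c (m + 1)) :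
    ∃ α : ℝ, Irrational α ∧ 0 < α ∧ α < 1 / 2 ∧ HasPeriodFrom α P 0 := by
  have hne : ∀ m, c m ≠ 0 := fun m h => by have := h2 m; rw [h] at this; simp at this
  have hadm : Admissible (fun k => (c k).natAbs) (fun k => (c (k + 1)).sign) := by
    refine ⟨h2, fun k => ?_, fun k hk => Int.sign_eq_one_of_pos (h2' k hk)⟩
    rcases lt_or_gt_of_ne (hne (k + 1)) with h | h
    · exact Or.inr (Int.sign_eq_neg_one_of_neg h)
    · exact Or.inl (Int.sign_eq_one_of_pos h)
  obtain ⟨α, hα, hq, hs⟩ := hadm.exists_expandable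
  refine ⟨α, hα.irrational, hα.pos, hα.lt, fun m => ?_⟩
  rw [hc, zero_add, hq]
  have hsgn : sgn α (m + 1) = (c m).sign := by
    cases m with
    | zero => exact (Int.sign_eq_one_of_pos h0).symm
    | succ m => exact hs m
  rw [hsgn, Int.sign_mul_natAbs]

/-- The entries of `period R k`. -/
def periodEntry (R k i : ℕ) : ℤ :=
  if i < k then (Rodd R : ℤ) else if i = k then (Reven R : ℤ) else
    if i = k + 1 then -(Rodd R : ℤ) else -(Reven R : ℤ)

/-- The entries of `periodTwo k A`. -/
def periodTwoEntry (k A i : ℕ) : ℤ :=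
  if i < k then 3 else if i = k then 4 else if i = k + 1 then -3 else if i = k + 2 then -2 else A

theorem length_period (R k : ℕ) : (period R k).length = 2 * k + 2 := by
  simp [period]; ring

theorem length_periodTwo (k A : ℕ) : (periodTwo k A).length = k + 4 := by
  simp [periodTwo]

theorem period_getElem? {R k i : ℕ} (hi : i < 2 * k + 2) :
    (period R k)[i]? = some (periodEntry R k i) := by
  unfold period periodEntry
  rcases lt_or_ge i k with h | h
  · rw [if_pos h, List.append_assoc, List.getElem?_append_left (by simpa using h)]
    simp [h]
  obtain ⟨j, rfl⟩ := Nat.exists_eq_add_of_le h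
  rw [if_neg (by omega), List.append_assoc, List.getElem?_append_right (by simp),
    List.length_replicate, Nat.add_sub_cancel_left]
  match j with
  | 0 => simp
  | 1 => simp
  | j + 2 =>
    rw [if_neg (by omega), if_neg (by omega)]
    have : j < k := by omega
    simp [this]

theorem periodTwo_getElem? {k A i : ℕ} (hi : i < k + 4) :
    (periodTwo k A)[i]? = some (periodTwoEntry k A i) := by
  unfold periodTwo periodTwoEntry
  rcases lt_or_ge i k with h | h
  · rw [if_pos h, List.getElem?_append_left (by simpa using h)]
    simp [h]
  obtain ⟨j, rfl⟩ := Nat.exists_eq_add_of_le h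
  rw [if_neg (by omega), List.getElem?_append_right (by simp),
    List.length_replicate, Nat.add_sub_cancel_left]
  have hj : j < 4 := by omega
  interval_cases j <;> simp

theorem periodEntry_natAbs (R k i : ℕ) :
    (periodEntry R k i).natAbs = Rodd R ∨ (periodEntry R k i).natAbs = Reven R := by
  unfold periodEntry
  split_ifs <;> simp

theorem exists_period {R : ℕ} (hR : 3 ≤ R) (k : ℕ) :
    ∃ α : ℝ, Irrational α ∧ 0 < α ∧ α < 1 / 2 ∧ HasPeriodFrom α (period R k) 0 := by
  have h1 := Rodd_ge (by omega : 2 ≤ R)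
  have h2 := Reven_ge hR
  refine exists_hasPeriodFrom (c := fun m => periodEntry R k (m % (2 * k + 2))) (fun m => ?_) ?_
    (fun m => ?_) (fun m hm => ?_)
  · rw [length_period]
    exact period_getElem? (Nat.mod_lt _ (by omega))
  · simp only [Nat.zero_mod, periodEntry]
    split_ifs <;> omega
  · rcases periodEntry_natAbs R k (m % (2 * k + 2)) with h | h <;> simp only [h] <;> omega
  · rcases periodEntry_natAbs R k (m % (2 * k + 2)) with h | h <;> simp only [h] at hm <;> omega

theorem exists_periodTwo (k : ℕ) {A : ℕ} (hA : 2 ≤ A) :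
    ∃ α : ℝ, Irrational α ∧ 0 < α ∧ α < 1 / 2 ∧ HasPeriodFrom α (periodTwo k A) 0 := by
  refine exists_hasPeriodFrom (c := fun m => periodTwoEntry k A (m % (k + 4))) (fun m => ?_) ?_
    (fun m => ?_) (fun m hm => ?_)
  · rw [length_periodTwo]
    exact periodTwo_getElem? (Nat.mod_lt _ (by omega))
  · simp only [Nat.zero_mod, periodTwoEntry]
    split_ifs <;> omega
  · simp only [periodTwoEntry]
    split_ifs <;> omega
  · have h1 : m % (k + 4) < k + 4 := Nat.mod_lt _ (by omega)
    have h2 : (m + 1) % (k + 4) = if m % (k + 4) = k + 3 then 0 else m % (k + 4) + 1 := by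
      rw [Nat.add_mod_eq_ite, Nat.mod_eq_of_lt (by omega : 1 < k + 4)]
      split_ifs <;> omega
    simp only [h2]
    simp only [periodTwoEntry] at hm ⊢
    generalize m % (k + 4) = r at *
    split_ifs at hm ⊢ <;> omega

/-! ### Upper bounds from extremal vertices -/

theorem exists_stepPt_eq (a : ℕ) {e : ℤ} (he : e = 1 ∨ e = -1) {p : ℤ × ℤ} (h1 : Odd p.1)
    (h2 : Odd p.2) : ∃ q : ℤ × ℤ, Odd q.1 ∧ Odd q.2 ∧ stepPt a e q = p := by
  have hee : e * e = 1 := by rcases he with rfl | rfl <;> norm_num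
  have hodd : Odd e := by rcases he with rfl | rfl <;> decide
  unfold stepPt
  by_cases h : Odd a
  · have h' : Odd (a : ℤ) := by exact_mod_cast h
    refine ⟨(p.2 + e * p.1 * a + 1, e * p.1), ?_, hodd.mul h1, ?_⟩
    · exact (h2.add_odd ((hodd.mul h1).mul h')).add_odd odd_one
    · rw [if_pos h]
      refine Prod.ext ?_ ?_
      · change e * (e * p.1) = p.1
        rw [← mul_assoc, hee, one_mul]
      · change p.2 + e * p.1 * a + 1 - e * p.1 * a - 1 = p.2
        ring
  · have h' : Even (a : ℤ) := by exact_mod_cast Nat.not_odd_iff_even.1 h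
    refine ⟨(-(e * p.1) * a - p.2, -(e * p.1)), ?_, (hodd.mul h1).neg, ?_⟩
    · exact (h'.mul_left _).sub_odd h2
    · rw [if_neg h]
      refine Prod.ext ?_ ?_
      · change -(e * -(e * p.1)) = p.1
        linear_combination p.1 * hee
      · change -(e * p.1) * a - (-(e * p.1) * a - p.2) = p.2
        ring

/-- The steps are invertible on points with odd coordinates, so each vertex of each cell is the
image of a genuine point of the original problem. -/
theorem exists_ptSeq_eq (a : ℕ → ℕ) {e : ℕ → ℤ} (he : ∀ k, e k = 1 ∨ e k = -1) (k : ℕ) :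
    ∀ p : ℤ × ℤ, Odd p.1 → Odd p.2 → ∃ q : ℤ × ℤ, Odd q.1 ∧ Odd q.2 ∧ ptSeq a e q k = p := by
  induction k with
  | zero => exact fun p h1 h2 => ⟨p, h1, h2, rfl⟩
  | succ k ih =>
    intro p h1 h2
    obtain ⟨q, h3, h4, hq⟩ := exists_stepPt_eq (a k) (he k) h1 h2
    obtain ⟨r, h5, h6, hr⟩ := ih q h3 h4
    exact ⟨r, h5, h6, by rw [ptSeq, hr, hq]⟩

namespace Expandable

variable {α : ℝ}

/-- The left coordinates along the expansion of `α`. -/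
def _root_.NICF.leftCoord (α : ℝ) (k : ℕ) : ℝ × ℝ :=
  leftSeq (fun k => quot α (k + 1)) (fun k => (sgn α (k + 2) : ℝ)) (0, 0) k

/-- Infinitely many vertices with small products bound the approximation constant. -/
theorem approxConst_le (h : Expandable α) {c l : ℝ} (hl : 0 < l)
    (hfreq : ∀ K₀ : ℕ, ∃ K, K₀ ≤ K ∧ l ≤ |leftVal (leftCoord α K) (-1, -1)| ∧
      |rightVal (NICF.tail α K) (rightSeq α K) (-1, -1)| * |leftVal (leftCoord α K) (-1, -1)| ≤
        c * (1 + NICF.tail α K * (leftCoord α K).1)) :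
    approxConst α (gammaStar α) ≤ ((c / 4 : ℝ) : EReal) := by
  have hsys := h.rightSystem
  have hpts : ∀ X : ℝ, ∃ p : ℤ × ℤ, Odd p.1 ∧ Odd p.2 ∧ X ≤ |(p.1 : ℝ)| ∧
      |rightVal α (rightSeq α 0) p| * |(p.1 : ℝ)| ≤ c := by
    intro X
    -- The original |x| is at least (8/5)^K times the left value at the vertex, so the bound `l`
    -- forces |x| to infinity with K.
    obtain ⟨K₀, hK₀⟩ : ∃ K₀ : ℕ, ∀ K, K₀ ≤ K → X / l ≤ (8 / 5 : ℝ) ^ K :=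
      eventually_atTop.1 ((tendsto_pow_atTop_atTop_of_one_lt (by norm_num : (1 : ℝ) < 8 / 5)
        ).eventually_ge_atTop (X / l))
    obtain ⟨K, hK, h1, h2⟩ := hfreq K₀
    obtain ⟨p, h3, h4, hp⟩ := exists_ptSeq_eq (fun k => quot α (k + 1)) (e := fun k => sgn α (k + 2))
      (fun k => sgn_eq α _) K (-1, -1) (by decide) (by decide)
    refine ⟨p, h3, h4, ?_, ?_⟩
    · obtain ⟨C, hC, hleft⟩ := hsys.exists_leftVal_eq (e := fun k => sgn α (k + 2)) K
      rw [hleft p, hp]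
      have h5 := (div_le_iff₀ hl).1 ((hK₀ K hK).trans hC)
      have h6 : 0 ≤ C := le_trans (by positivity) hC
      exact h5.trans (mul_le_mul_of_nonneg_left h1 h6)
    · have h5 := hsys.product_eq (e := fun k => sgn α (k + 2)) p K
      rw [hp, abs_mul] at h5
      exact le_of_mul_le_mul_right (h5.trans_le h2) (hsys.one_add_pos K)
  refine le_of_forall_gt fun y hy => ?_
  obtain ⟨w, hw1, hw2⟩ := EReal.lt_iff_exists_real_btwn.1 hy
  refine lt_of_le_of_lt ?_ hw2
  have hw : c / 4 < w := by exact_mod_cast hw1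
  refine liminf_le_of_frequently_le' (frequently_cofinite_iff_infinite.2 fun hfin => ?_)
  obtain ⟨M, hM⟩ := (hfin.image fun n : ℤ => |((1 - 2 * n : ℤ) : ℝ)|).bddAbove
  -- M + 1 escapes the supposedly finite set; X ≥ c/(4w − c) means c(X + 1) ≤ 4wX, which absorbs
  -- 2|n| ≤ X + 1.
  obtain ⟨p, ⟨i, hi⟩, ⟨j, hj⟩, hX, hle⟩ := hpts (max (M + 1) (max 1 (c / (4 * w - c))))
  obtain ⟨n, hn⟩ : ∃ n : ℤ, p.1 = 1 - 2 * n := ⟨-i, by linarith⟩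
  obtain ⟨r, hr⟩ : ∃ r : ℤ, p.2 = -(2 * r + 1) := ⟨-(j + 1), by linarith⟩
  have hpe : p = (1 - 2 * n, -(2 * r + 1)) := Prod.ext hn hr
  have h1 := h.two_mul_distInt_le n r
  rw [← hpe] at h1
  have hX1 := (le_max_left _ _).trans hX
  have hX2 := (le_max_right _ _).trans hX
  have hX3 := (le_max_left _ _).trans hX2
  have hX4 := (le_max_right _ _).trans hX2
  have h2 : 2 * |(n : ℝ)| ≤ |(p.1 : ℝ)| + 1 := by
    rw [hn]
    push_cast
    have := abs_sub (1 : ℝ) (1 - 2 * n)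
    rw [abs_one, sub_sub_cancel, abs_mul, abs_two] at this
    linarith
  have hmem : n ∈ {n : ℤ | ((|(n : ℝ)| * distInt (n * α - gammaStar α) : ℝ) : EReal) ≤ w} := by
    change ((|(n : ℝ)| * distInt (n * α - gammaStar α) : ℝ) : EReal) ≤ w
    rw [div_le_iff₀ (by linarith)] at hX4
    set X := |(p.1 : ℝ)|
    set d := distInt (n * α - gammaStar α)
    have hd : 0 ≤ d := abs_nonneg _
    have hdX : 2 * d * X ≤ c := (mul_le_mul_of_nonneg_right h1 (by linarith)).trans hle
    have h3 : 4 * (|(n : ℝ)| * d) ≤ 2 * d * (X + 1) := by nlinarith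
    have h4 : X * (2 * d * (X + 1)) ≤ c * (X + 1) := by nlinarith
    have h5 : X * (4 * (|(n : ℝ)| * d)) ≤ X * (4 * w) := by nlinarith
    have := le_of_mul_le_mul_left h5 (by linarith)
    have : |(n : ℝ)| * d ≤ w := by linarith
    exact_mod_cast this
  have := hM ⟨n, hmem, rfl⟩
  rw [hn] at hX1
  linarith

end Expandable

/-- One factor of the product at the extremal vertex, in terms of the left coordinates one step
earlier. -/
def extremalLeft (m : ℝ) (p : ℝ × ℝ) : ℝ := 1 - 1 / (m + p.1) - p.2 / (m + p.1)

/-- The other factor of the product at the extremal vertex, in terms of the right coordinates one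
step later. -/
def extremalRight (n : ℝ) (q : ℝ × ℝ) : ℝ := 1 - 1 / (n - q.1) - 1 / (n - q.1) * (1 - q.2)

/-- The normalizing factor belonging to the product at the extremal vertex. -/
def extremalDen (m n : ℝ) (p q : ℝ × ℝ) : ℝ := 1 + 1 / (n - q.1) * (-1 / (m + p.1))

theorem kappa_pos {R : ℕ} (hR : 2 ≤ R) : 0 < kappa R :=
  div_pos (theta1_pos R) (by linarith [theta1_lt hR])

theorem kappa_lt {R : ℕ} (hR : 2 ≤ R) : kappa R < 1 / 2 := by
  have := theta1_lt hR
  unfold kappa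
  rw [div_lt_iff₀ (by linarith)]
  linarith

/-- At p = (θ₁, κ), q = (θ₂, 0) the product is exactly 4M₁ times the normalizing factor. Both sides
are continuous there, so any c > 4M₁ works nearby. -/
theorem extremal_near {R : ℕ} (hR : 2 ≤ R) {c : ℝ} (hc : 4 * M1 R < c) :
    ∃ δ > 0, ∃ l > 0, ∀ p q : ℝ × ℝ, |p.1 - theta1 R| ≤ δ → |p.2 - kappa R| ≤ δ →
      |q.1 - theta2 R| ≤ δ → |q.2| ≤ δ →
      l ≤ extremalLeft (evenQuot R) p ∧
      |extremalRight (Rodd R) q| * extremalLeft (evenQuot R) p ≤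
        c * extremalDen (evenQuot R) (Rodd R) p q := by
  have hm := four_le_evenQuot R
  have hn : (3 : ℝ) ≤ Rodd R := by exact_mod_cast Rodd_ge hR
  have ht := theta1_pos R
  have hs := theta2_le_half R
  have hA := oddTail_le hR
  have hκ := kappa_lt hR
  have hne1 : evenQuot R + theta1 R ≠ 0 := by linarith
  have hne2 : (Rodd R : ℝ) - theta2 R ≠ 0 := by linarith
  have hne3 : evenQuot R + theta1 R - oddTail R ≠ 0 := by linarith
  have hl0 : 0 < extremalLeft (evenQuot R) (theta1 R, kappa R) := by
    have : extremalLeft (evenQuot R) (theta1 R, kappa R) =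
        (evenQuot R + theta1 R - 1 - kappa R) / (evenQuot R + theta1 R) := by
      unfold extremalLeft; field_simp
    rw [this]
    exact div_pos (by linarith) (by linarith)
  have hval : |extremalRight (Rodd R) (theta2 R, 0)| *
      extremalLeft (evenQuot R) (theta1 R, kappa R) <
        c * extremalDen (evenQuot R) (Rodd R) (theta1 R, kappa R) (theta2 R, 0) := by
    have e1 : extremalRight (Rodd R) (theta2 R, 0) = 1 - 2 * oddTail R := by
      unfold extremalRight oddTail; ring
    have e2 : extremalDen (evenQuot R) (Rodd R) (theta1 R, kappa R) (theta2 R, 0) =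
        (evenQuot R + theta1 R - oddTail R) / (evenQuot R + theta1 R) := by
      unfold extremalDen
      change 1 + oddTail R * (-1 / (evenQuot R + theta1 R)) = _
      field_simp
      ring
    have e3 : extremalLeft (evenQuot R) (theta1 R, kappa R) =
        leftFactor R * extremalDen (evenQuot R) (Rodd R) (theta1 R, kappa R) (theta2 R, 0) := by
      rw [e2]
      unfold extremalLeft leftFactor
      field_simp
    have hden : 0 < extremalDen (evenQuot R) (Rodd R) (theta1 R, kappa R) (theta2 R, 0) := by
      rw [e2]; exact div_pos (by linarith) (by linarith)
    rw [e1, abs_of_pos (by linarith), e3, ← mul_assoc, ← four_mul_M1 hR]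
    exact mul_lt_mul_of_pos_right hc hden
  have hcl : ContinuousAt (fun x : (ℝ × ℝ) × (ℝ × ℝ) => extremalLeft (evenQuot R) x.1)
      ((theta1 R, kappa R), (theta2 R, 0)) := by
    unfold extremalLeft
    fun_prop (disch := exact hne1)
  have hcr : ContinuousAt (fun x : (ℝ × ℝ) × (ℝ × ℝ) => extremalRight (Rodd R) x.2)
      ((theta1 R, kappa R), (theta2 R, 0)) := by
    unfold extremalRight
    fun_prop (disch := exact hne2)
  have hcd : ContinuousAt (fun x : (ℝ × ℝ) × (ℝ × ℝ) =>
      extremalDen (evenQuot R) (Rodd R) x.1 x.2) ((theta1 R, kappa R), (theta2 R, 0)) := by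
    unfold extremalDen
    fun_prop (disch := first | exact hne1 | exact hne2)
  have hev := (hcl.eventually_const_lt (half_lt_self hl0)).and
    ((hcr.abs.mul hcl).eventually_lt (hcd.const_mul c) hval)
  obtain ⟨ε, hε, hball⟩ := Metric.eventually_nhds_iff.1 hev
  refine ⟨ε / 2, half_pos hε, _, half_pos hl0, fun p q h1 h2 h3 h4 => ?_⟩
  have hd : dist ((p, q) : (ℝ × ℝ) × (ℝ × ℝ)) ((theta1 R, kappa R), (theta2 R, 0)) < ε := by
    refine lt_of_le_of_lt ?_ (half_lt_self hε)
    refine max_le (max_le h1 h2) (max_le h3 ?_)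
    simpa [Real.dist_eq] using h4
  exact (hball hd).imp (fun h => h.le) (fun h => h.le)

/-- The partial quotients and signs around an extremal vertex. -/
structure ExtremalBlock (α : ℝ) (R k b : ℕ) : Prop where
  run : ∀ i, i < k → quot α (b + i + 1) = Rodd R ∧ sgn α (b + i + 2) = 1
  even : Even (quot α (b + k + 1))
  quot_eq : (quot α (b + k + 1) : ℝ) = evenQuot R
  sgn_eq : sgn α (b + k + 2) = -1
  quot_eq' : quot α (b + k + 2) = Rodd R
  sgn_eq' : sgn α (b + k + 3) = -1

/-- With the contraction, this makes (θ₁, κ) the attractor of a long run of R_* with plus signs,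
whatever precedes it. -/
theorem leftStep_fixed {R : ℕ} (hR : 2 ≤ R) :
    leftStep (Rodd R) 1 (theta1 R, kappa R) = (theta1 R, kappa R) := by
  have h1 := theta1_eq R
  have h2 := theta1_pos R
  have h3 := kappa_eq hR
  have h4 : (0 : ℝ) < Rodd R + theta1 R := by positivity
  unfold leftStep
  rw [if_pos (Rodd_odd R)]
  refine Prod.ext ?_ ?_
  · change 1 / (Rodd R + theta1 R) = theta1 R
    rw [div_eq_iff h4.ne', h1]
  · change 1 * (1 + kappa R) / (Rodd R + theta1 R) = kappa R
    rw [div_eq_iff h4.ne']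
    linear_combination (-(1 + kappa R)) * h1 - (Rodd R + theta1 R) * h3

namespace Expandable

variable {α : ℝ}

theorem leftCoord_near (h : Expandable α) {R k b : ℕ} (hR : 2 ≤ R) (hb : ExtremalBlock α R k b) :
    leftDist (leftCoord α (b + k)) (theta1 R, kappa R) ≤ (3 / 4) ^ k * 7 := by
  have hs := h.rightSystem.shift b
  have hfix : ∀ j, j ≤ k → leftSeq (fun i => quot α (b + i + 1)) (fun i => (sgn α (b + i + 2) : ℝ))
      (theta1 R, kappa R) j = (theta1 R, kappa R) := by
    intro j
    induction j with
    | zero => exact fun _ => rfl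
    | succ j ih =>
      intro hj
      rw [leftSeq, ih (by omega), (hb.run j hj).1, (hb.run j hj).2, Int.cast_one, leftStep_fixed hR]
  have h1 : LeftBdd (theta1 R, kappa R) := by
    have h2 := theta1_pos R
    have h3 := theta1_lt hR
    have h4 := kappa_pos hR
    have h5 := kappa_lt hR
    refine ⟨?_, ?_, ?_⟩
    · change _ ≤ theta1 R; linarith
    · change theta1 R ≤ _; linarith
    · change |kappa R| ≤ _
      rw [abs_of_pos h4]; linarith
  have h2 : LeftBdd (leftCoord α b) := h.rightSystem.leftBdd (e := fun k => sgn α (k + 2)) b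
  have h3 := leftDist_seq h2 h1 hs.two_le hs.sign hs.two k
  unfold leftCoord at h3 ⊢
  rw [← leftSeq_add (fun k => quot α (k + 1)) (fun k => (sgn α (k + 2) : ℝ)), hfix k le_rfl] at h3
  refine h3.trans ?_
  have : (0 : ℝ) ≤ (3 / 4) ^ k := by positivity
  exact mul_le_mul_of_nonneg_left (h2.dist_le h1) this

/-- Infinitely many extremal blocks bound the approximation constant. -/
theorem approxConst_le_of_blocks (h : Expandable α) {R k : ℕ} (hR : 2 ≤ R) {c δ l : ℝ} (hl : 0 < l)
    (hnear : ∀ p q : ℝ × ℝ, |p.1 - theta1 R| ≤ δ → |p.2 - kappa R| ≤ δ →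
      |q.1 - theta2 R| ≤ δ → |q.2| ≤ δ →
      l ≤ extremalLeft (evenQuot R) p ∧
      |extremalRight (Rodd R) q| * extremalLeft (evenQuot R) p ≤
        c * extremalDen (evenQuot R) (Rodd R) p q)
    (hk : (3 / 4) ^ k * 7 ≤ δ)
    (hblock : ∀ K₀ : ℕ, ∃ b, K₀ ≤ b ∧ ExtremalBlock α R k b ∧
      |NICF.tail α (b + k + 2) - theta2 R| ≤ δ ∧ rightSeq α (b + k + 2) ≤ δ) :
    approxConst α (gammaStar α) ≤ ((c / 4 : ℝ) : EReal) := by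
  refine h.approxConst_le hl fun K₀ => ?_
  obtain ⟨b, hb, hB, hq1, hq2⟩ := hblock K₀
  refine ⟨b + k + 1, by omega, ?_⟩
  have hd := (h.leftCoord_near hR hB).trans hk
  unfold leftDist at hd
  set p := leftCoord α (b + k) with hp
  have ha1 := abs_nonneg (p.1 - theta1 R)
  have ha2 := abs_nonneg (p.2 - kappa R)
  have hg := (h.rightSystem.g_nonneg (b + k + 2)).1
  obtain ⟨hn1, hn2⟩ := hnear p (NICF.tail α (b + k + 2), rightSeq α (b + k + 2))
    (by linarith) (by linarith) hq1 (by rw [abs_of_nonneg hg]; exact hq2)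
  have hleft : leftCoord α (b + k + 1) = (-1 / (evenQuot R + p.1), p.2 / (evenQuot R + p.1)) := by
    change leftStep (quot α (b + k + 1)) (sgn α (b + k + 2)) p = _
    rw [hB.sgn_eq, leftStep, if_neg (Nat.not_odd_iff_even.2 hB.even), hB.quot_eq]
    push_cast
    simp
  have htail : NICF.tail α (b + k + 1) = 1 / (Rodd R - NICF.tail α (b + k + 2)) := by
    have h1 := h.tail_mul (b + k + 1)
    rw [show b + k + 1 + 1 = b + k + 2 by ring, show b + k + 1 + 2 = b + k + 3 by ring, hB.quot_eq',
      hB.sgn_eq'] at h1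
    rw [eq_one_div_of_mul_eq_one_left h1]
    push_cast
    ring
  have hright : rightSeq α (b + k + 1) =
      NICF.tail α (b + k + 1) * (1 - rightSeq α (b + k + 2)) := by
    have h1 := h.rightSystem.right (b + k + 1)
    have h2 : Odd (quot α (b + k + 1 + 1)) := by
      rw [show b + k + 1 + 1 = b + k + 2 by ring, hB.quot_eq']; exact Rodd_odd R
    rw [if_pos h2] at h1
    exact h1
  have e1 : leftVal (leftCoord α (b + k + 1)) (-1, -1) = -extremalLeft (evenQuot R) p := by
    rw [hleft]
    unfold leftVal extremalLeft
    push_cast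
    ring
  have e2 : rightVal (NICF.tail α (b + k + 1)) (rightSeq α (b + k + 1)) (-1, -1) =
      -extremalRight (Rodd R) (NICF.tail α (b + k + 2), rightSeq α (b + k + 2)) := by
    rw [hright, htail]
    unfold rightVal extremalRight
    push_cast
    ring
  rw [e1, e2, abs_neg, abs_neg, abs_of_pos (hl.trans_le hn1)]
  refine ⟨hn1, hn2.trans_eq ?_⟩
  rw [hleft, htail]
  rfl

/-- A run of equal even partial quotients with negative signs determines the right coordinates up to
a small error. -/
theorem right_near (h : Expandable α) {m : ℕ} (hm : Even m) {s : ℝ} (hs0 : 0 < s) (hs : s ≤ 1 / 2)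
    (hsm : s * (m - s) = 1) (n : ℕ) : ∀ b, (∀ i, i < n → quot α (b + i + 1) = m ∧
      sgn α (b + i + 2) = -1) →
      |NICF.tail α b - s| ≤ (1 / 2) ^ n ∧ rightSeq α b ≤ (1 / 2) ^ n := by
  induction n with
  | zero =>
    intro b _
    have h1 := (h.tail b).pos
    have h2 := (h.tail b).lt
    have h3 := (h.rightSystem.g_nonneg b).2
    rw [pow_zero]
    exact ⟨abs_le.2 ⟨by linarith, by linarith⟩, by linarith⟩
  | succ n ih =>
    intro b hb
    obtain ⟨ih1, ih2⟩ := ih (b + 1) fun i hi => by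
      have := hb (i + 1) (by omega)
      rwa [show b + (i + 1) + 1 = b + 1 + i + 1 by ring,
        show b + (i + 1) + 2 = b + 1 + i + 2 by ring] at this
    obtain ⟨h1, h2⟩ := hb 0 (by omega)
    rw [add_zero] at h1 h2
    have h3 := (h.tail b).pos
    have h4 := (h.tail b).lt
    have h5 := h.tail_mul b
    have h6 := h.rightSystem.right b
    have h7 := (h.rightSystem.g_nonneg (b + 1)).1
    rw [if_neg (by rw [h1]; exact Nat.not_odd_iff_even.2 hm)] at h6
    rw [h1, h2] at h5
    push_cast at h5
    have h8 : (0 : ℝ) < (1 / 2) ^ n := by positivity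
    constructor
    · have e1 : NICF.tail α b - s = NICF.tail α b * s * (NICF.tail α (b + 1) - s) := by
        linear_combination (-NICF.tail α b) * hsm + s * h5
      rw [e1, abs_mul, abs_of_pos (mul_pos h3 hs0), pow_succ']
      refine mul_le_mul ?_ ih1 (abs_nonneg _) (by norm_num)
      nlinarith
    · rw [h6, pow_succ']
      exact mul_le_mul h4.le ih2 h7 (by norm_num)

end Expandable

/-! ### The periodic examples and the limits -/

theorem liminfQuot_eq {α : ℝ} {R : ℕ} (h1 : ∀ᶠ i in atTop, R ≤ quot α i)
    (h2 : ∃ᶠ i in atTop, quot α i = R) : liminfQuot α = (R : ℕ∞) := by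
  refine le_antisymm (liminf_le_of_frequently_le' (h2.mono fun i hi => by rw [hi]))
    (le_liminf_of_le (by isBoundedDefault) (h1.mono fun i hi => by exact_mod_cast hi))

theorem HasPeriodFrom.entry {α : ℝ} {P : List ℤ} {N : ℕ} (h : HasPeriodFrom α P N) {i : ℕ} {c : ℤ}
    (hi : i < P.length) (hc : P[i]? = some c) (j : ℕ) :
    sgn α (N + P.length * j + i + 1) * (quot α (N + P.length * j + i + 1) : ℤ) = c := by
  have := h (P.length * j + i)
  rw [Nat.mul_add_mod, Nat.mod_eq_of_lt hi, hc, Option.some_inj] at this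
  rw [this]
  ring_nf

theorem quot_eq_natAbs {α : ℝ} {i : ℕ} {c : ℤ} (h : sgn α i * (quot α i : ℤ) = c) :
    quot α i = c.natAbs := by
  rw [← h]
  rcases Expandable.sgn_eq α i with h1 | h1 <;> rw [h1] <;> simp

theorem sgn_eq_sign {α : ℝ} {i : ℕ} {c : ℤ} (h : sgn α i * (quot α i : ℤ) = c) (hc : c ≠ 0) :
    sgn α i = c.sign := by
  have hq : (quot α i : ℤ) ≠ 0 := fun h0 => hc (by rw [← h, h0, mul_zero])
  have hq : (0 : ℤ) < quot α i := by omega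
  rw [← h, Int.sign_mul, Int.sign_eq_one_of_pos hq, mul_one]
  rcases Expandable.sgn_eq α i with h1 | h1 <;> rw [h1] <;> rfl

/-- The least absolute value of the entries of a period is the lower limit of the partial
quotients. -/
theorem HasPeriodFrom.liminfQuot_eq {α : ℝ} {P : List ℤ} {N R : ℕ} (h : HasPeriodFrom α P N)
    {c : ℕ → ℤ} (hc : ∀ i, i < P.length → P[i]? = some (c i)) (hle : ∀ i, R ≤ (c i).natAbs) {i₀ : ℕ}
    (hi₀ : i₀ < P.length) (heq : (c i₀).natAbs = R) : liminfQuot α = (R : ℕ∞) := by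
  apply NICF.liminfQuot_eq
  · filter_upwards [eventually_ge_atTop (N + 1)] with i hi
    obtain ⟨m, rfl⟩ := Nat.exists_eq_add_of_le hi
    have h1 := h m
    rw [hc _ (Nat.mod_lt _ (by omega)), Option.some_inj] at h1
    rw [show N + 1 + m = N + m + 1 by ring, quot_eq_natAbs h1.symm]
    exact hle _
  · refine frequently_atTop.2 fun K => ⟨N + P.length * K + i₀ + 1, ?_, ?_⟩
    · have : K ≤ P.length * K := Nat.le_mul_of_pos_left _ (by omega)
      omega
    · rw [quot_eq_natAbs (h.entry hi₀ (hc _ hi₀) K), heq]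

theorem HasPeriodFrom.liminfQuot_period {α : ℝ} {R k N : ℕ} (h : HasPeriodFrom α (period R k) N) :
    liminfQuot α = (R : ℕ∞) := by
  have hc : ∀ i, i < (period R k).length → (period R k)[i]? = some (periodEntry R k i) :=
    fun i hi => period_getElem? (by rwa [length_period] at hi)
  have hle : ∀ i, R ≤ (periodEntry R k i).natAbs := fun i => by
    have := le_Rodd R
    have := le_Reven R
    rcases periodEntry_natAbs R k i with h | h <;> omega
  by_cases hR : Even R
  · refine h.liminfQuot_eq hc hle (i₀ := k) (by rw [length_period]; omega) ?_
    simp [periodEntry, Reven, hR]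
  · refine h.liminfQuot_eq hc hle (i₀ := k + 1) (by rw [length_period]; omega) ?_
    simp [periodEntry, Rodd, Nat.not_even_iff_odd.1 hR]

theorem HasPeriodFrom.liminfQuot_periodTwo {α : ℝ} {k A N : ℕ} (hA : 2 ≤ A)
    (h : HasPeriodFrom α (periodTwo k A) N) : liminfQuot α = ((2 : ℕ) : ℕ∞) := by
  refine h.liminfQuot_eq (c := periodTwoEntry k A)
    (fun i hi => periodTwo_getElem? (by rwa [length_periodTwo] at hi)) (fun i => ?_) (i₀ := k + 2)
    (by rw [length_periodTwo]; omega) ?_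
  · unfold periodTwoEntry
    split_ifs <;> omega
  · simp [periodTwoEntry]

theorem HasPeriodFrom.period_block {α : ℝ} (hα : Expandable α) {R k N : ℕ} (hR : 3 ≤ R) (hk : 1 ≤ k)
    (h : HasPeriodFrom α (period R k) N) (j : ℕ) :
    ExtremalBlock α R k (N + (2 * k + 2) * j) ∧
      |tail α (N + (2 * k + 2) * j + k + 2) - theta2 R| ≤ (1 / 2) ^ (k - 1) ∧
      rightSeq α (N + (2 * k + 2) * j + k + 2) ≤ (1 / 2) ^ (k - 1) := by
  have hodd := Rodd_ge (by omega : 2 ≤ R)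
  have heven := Reven_ge hR
  set b := N + (2 * k + 2) * j with hb
  have hent : ∀ i, i < 2 * k + 2 → sgn α (b + i + 1) * (quot α (b + i + 1) : ℤ) =
      periodEntry R k i := fun i hi => by
    have := h.entry (by rwa [length_period]) (period_getElem? hi) j
    rwa [length_period] at this
  have hq : ∀ i, i < 2 * k + 2 → quot α (b + i + 1) = (periodEntry R k i).natAbs :=
    fun i hi => quot_eq_natAbs (hent i hi)
  have hpos : ∀ i, i ≤ k → sgn α (b + i + 1) = 1 := fun i hi => by
    have h0 : 0 < periodEntry R k i := by unfold periodEntry; split_ifs <;> omega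
    rw [sgn_eq_sign (hent i (by omega)) h0.ne', Int.sign_eq_one_of_pos h0]
  have hneg : ∀ i, k < i → i < 2 * k + 2 → sgn α (b + i + 1) = -1 := fun i hi hi' => by
    have h0 : periodEntry R k i < 0 := by unfold periodEntry; split_ifs <;> omega
    rw [sgn_eq_sign (hent i hi') h0.ne, Int.sign_eq_neg_one_of_neg h0]
  have hqk : quot α (b + k + 1) = Reven R := by rw [hq k (by omega)]; simp [periodEntry]
  refine ⟨⟨fun i hi => ⟨?_, hpos (i + 1) hi⟩, ?_, ?_, hneg (k + 1) (by omega) (by omega), ?_,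
    hneg (k + 2) (by omega) (by omega)⟩, ?_⟩
  · rw [hq i (by omega)]; simp [periodEntry, hi]
  · rw [hqk]; exact Reven_even R
  · rw [hqk, evenQuot_eq hR]
  · rw [show b + k + 2 = b + (k + 1) + 1 by ring, hq (k + 1) (by omega)]; simp [periodEntry]
  -- Only k − 1 of the k final entries are usable: the last one is followed by the positive first
  -- entry of the next period.
  · refine hα.right_near (Reven_even R) (theta2_pos R) (theta2_le_half R) (theta2_eq hR) (k - 1) _
      fun i hi => ⟨?_, ?_⟩
    · rw [show b + k + 2 + i + 1 = b + (k + 2 + i) + 1 by ring, hq _ (by omega)]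
      unfold periodEntry
      rw [if_neg (by omega), if_neg (by omega), if_neg (by omega)]
      simp
    · rw [show b + k + 2 + i + 2 = b + (k + 3 + i) + 1 by ring]
      exact hneg _ (by omega) (by omega)

/-- The tail beginning with A is at most 2/A, so the tail beginning with 2 is near 1/2 = θ₂. Since 2
is even, its g is the tail times the next g, which is again small. -/
theorem HasPeriodFrom.periodTwo_block {α : ℝ} (hα : Expandable α) {k A N : ℕ} (hA : 2 ≤ A)
    (h : HasPeriodFrom α (periodTwo k A) N) (j : ℕ) :
    ExtremalBlock α 2 k (N + (k + 4) * j) ∧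
      |tail α (N + (k + 4) * j + k + 2) - theta2 2| ≤ 2 / A ∧
      rightSeq α (N + (k + 4) * j + k + 2) ≤ 2 / A := by
  set b := N + (k + 4) * j with hb
  have hent : ∀ i, i < k + 4 → sgn α (b + i + 1) * (quot α (b + i + 1) : ℤ) =
      periodTwoEntry k A i := fun i hi => by
    have := h.entry (by rwa [length_periodTwo]) (periodTwo_getElem? hi) j
    rwa [length_periodTwo] at this
  have hq : ∀ i, i < k + 4 → quot α (b + i + 1) = (periodTwoEntry k A i).natAbs :=
    fun i hi => quot_eq_natAbs (hent i hi)
  have hs : ∀ i, i < k + 4 → sgn α (b + i + 1) = (periodTwoEntry k A i).sign :=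
    fun i hi => sgn_eq_sign (hent i hi) (by unfold periodTwoEntry; split_ifs <;> omega)
  have hRo : Rodd 2 = 3 := by unfold Rodd; rw [if_neg (by decide)]
  have hRe : Reven 2 = 2 := by unfold Reven; rw [if_pos (by decide)]
  have hqk : quot α (b + k + 1) = 4 := by rw [hq k (by omega)]; simp [periodTwoEntry]
  refine ⟨⟨fun i hi => ⟨?_, ?_⟩, ?_, ?_, ?_, ?_, ?_⟩, ?_⟩
  · rw [hq i (by omega), hRo]; simp [periodTwoEntry, hi]
  · rw [show b + i + 2 = b + (i + 1) + 1 by ring, hs _ (by omega)]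
    unfold periodTwoEntry
    rcases Nat.lt_or_ge (i + 1) k with h1 | h1
    · rw [if_pos h1]; rfl
    · rw [if_neg (by omega), if_pos (by omega)]; rfl
  · rw [hqk]; decide
  · rw [hqk, evenQuot, hRe]; norm_num
  · rw [show b + k + 2 = b + (k + 1) + 1 by ring, hs _ (by omega)]; simp [periodTwoEntry]
  · rw [show b + k + 2 = b + (k + 1) + 1 by ring, hq _ (by omega), hRo]; simp [periodTwoEntry]
  · rw [show b + k + 3 = b + (k + 2) + 1 by ring, hs _ (by omega)]; simp [periodTwoEntry]
  · have hA' : (2 : ℝ) ≤ A := by exact_mod_cast hA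
    have hq2 : quot α (b + k + 2 + 1) = 2 := by
      rw [show b + k + 2 + 1 = b + (k + 2) + 1 by ring, hq _ (by omega)]; simp [periodTwoEntry]
    have hs2 := (hα.two_le_quot (b + k + 2)).2 hq2
    have hq3 : quot α (b + k + 3 + 1) = A := by
      rw [show b + k + 3 + 1 = b + (k + 3) + 1 by ring, hq _ (by omega)]
      simp [periodTwoEntry]
    have h1 := hα.tail_mul (b + k + 2)
    have h2 := hα.rightSystem.right (b + k + 2)
    have h3 := hα.tail_mul (b + k + 3)
    obtain ⟨h4, h5⟩ := hα.rightSystem.g_nonneg (b + k + 3)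
    have h6 := (hα.tail (b + k + 2)).lt
    have h7 := (hα.tail (b + k + 2)).pos
    have h8 := (hα.tail (b + k + 3)).pos
    have h9 := (hα.tail (b + k + 3 + 1)).pos
    have h10 := (hα.tail (b + k + 3 + 1)).lt
    have h11 := hα.rightSystem.le_sub (b + k + 3)
    rw [hs2, hq2] at h1
    rw [if_neg (by rw [hq2]; decide)] at h2
    rw [hq3] at h3 h11
    change tail α (b + k + 2) * (_ + _ * tail α (b + k + 3)) = 1 at h1
    change rightSeq α (b + k + 2) = tail α (b + k + 2) * rightSeq α (b + k + 3) at h2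
    push_cast at h1
    have hx : tail α (b + k + 3) ≤ 2 / A := by
      rw [le_div_iff₀ (by linarith)]
      nlinarith
    have ht : theta2 2 = 1 / 2 := by unfold theta2; rw [if_neg (by norm_num)]
    constructor
    · rw [ht, abs_le]
      constructor <;> nlinarith
    · rw [h2]
      nlinarith

theorem exists_real_of_M1_lt {R : ℕ} {y : EReal} (hy : ((M1 R : ℝ) : EReal) < y) :
    ∃ c : ℝ, 4 * M1 R < c ∧ ((c / 4 : ℝ) : EReal) < y := by
  obtain ⟨w, hw1, hw2⟩ := EReal.lt_iff_exists_real_btwn.1 hy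
  have hw1 : M1 R < w := by exact_mod_cast hw1
  exact ⟨4 * w, by linarith, by rwa [mul_div_cancel_left₀ _ (by norm_num)]⟩

theorem tendsto_period {R : ℕ} (hR : 3 ≤ R) {α : ℕ → ℝ}
    (hα : ∀ k, Irrational (α k) ∧ 0 < α k ∧ α k < 1 / 2 ∧
      ∃ N, HasPeriodFrom (α k) (period R k) N) :
    Tendsto (fun k => approxConst (α k) (gammaStar (α k))) atTop (𝓝 ((M1 R : ℝ) : EReal)) := by
  have hE : ∀ k, Expandable (α k) := fun k => ⟨(hα k).1, (hα k).2.1, (hα k).2.2.1⟩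
  refine tendsto_order.2 ⟨fun y hy => Eventually.of_forall fun k => ?_, fun y hy => ?_⟩
  · obtain ⟨N, hN⟩ := (hα k).2.2.2
    exact hy.trans_le ((hE k).M1_le_approxConst hN.liminfQuot_period)
  · obtain ⟨c, hc, hcy⟩ := exists_real_of_M1_lt hy
    obtain ⟨δ, hδ, l, hl, hnear⟩ := extremal_near (by omega : 2 ≤ R) hc
    have h1 : Tendsto (fun k : ℕ => (3 / 4 : ℝ) ^ k * 7) atTop (𝓝 (0 * 7)) :=
      (tendsto_pow_atTop_nhds_zero_of_lt_one (by norm_num) (by norm_num)).mul_const _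
    rw [zero_mul] at h1
    have h2 : Tendsto (fun k : ℕ => (1 / 2 : ℝ) ^ (k - 1)) atTop (𝓝 0) :=
      (tendsto_pow_atTop_nhds_zero_of_lt_one (by norm_num) (by norm_num)).comp
        (tendsto_sub_atTop_nat 1)
    filter_upwards [h1.eventually_lt_const hδ, h2.eventually_lt_const hδ, eventually_ge_atTop 1]
      with k hk1 hk2 hk
    obtain ⟨N, hN⟩ := (hα k).2.2.2
    refine ((hE k).approxConst_le_of_blocks (by omega) hl hnear hk1.le fun K₀ => ?_).trans_lt hcy
    obtain ⟨h3, h4, h5⟩ := hN.period_block (hE k) hR hk K₀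
    refine ⟨_, ?_, h3, h4.trans hk2.le, h5.trans hk2.le⟩
    have : K₀ ≤ (2 * k + 2) * K₀ := Nat.le_mul_of_pos_left _ (by omega)
    omega

theorem tendsto_periodTwo {α : ℕ → ℕ → ℝ}
    (hα : ∀ k A, 2 ≤ A → Irrational (α k A) ∧ 0 < α k A ∧ α k A < 1 / 2 ∧
      ∃ N, HasPeriodFrom (α k A) (periodTwo k A) N) :
    Tendsto (fun x : ℕ × ℕ => approxConst (α x.1 x.2) (gammaStar (α x.1 x.2))) (atTop ×ˢ atTop)
      (𝓝 ((M1 2 : ℝ) : EReal)) := by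
  have hE : ∀ k A, 2 ≤ A → Expandable (α k A) :=
    fun k A hA => ⟨(hα k A hA).1, (hα k A hA).2.1, (hα k A hA).2.2.1⟩
  refine tendsto_order.2 ⟨fun y hy => ?_, fun y hy => ?_⟩
  · filter_upwards [tendsto_snd.eventually (eventually_ge_atTop 2)] with x hA
    obtain ⟨N, hN⟩ := (hα x.1 x.2 hA).2.2.2
    exact hy.trans_le ((hE x.1 x.2 hA).M1_le_approxConst (hN.liminfQuot_periodTwo hA))
  · obtain ⟨c, hc, hcy⟩ := exists_real_of_M1_lt hy
    obtain ⟨δ, hδ, l, hl, hnear⟩ := extremal_near le_rfl hc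
    have h1 : Tendsto (fun k : ℕ => (3 / 4 : ℝ) ^ k * 7) atTop (𝓝 (0 * 7)) :=
      (tendsto_pow_atTop_nhds_zero_of_lt_one (by norm_num) (by norm_num)).mul_const _
    rw [zero_mul] at h1
    have h2 : Tendsto (fun A : ℕ => (2 : ℝ) / A) atTop (𝓝 0) :=
      tendsto_const_div_atTop_nhds_zero_nat 2
    filter_upwards [tendsto_fst.eventually (h1.eventually_lt_const hδ),
      tendsto_snd.eventually (h2.eventually_lt_const hδ),
      tendsto_snd.eventually (eventually_ge_atTop 2)] with x hk hA hA2
    obtain ⟨N, hN⟩ := (hα x.1 x.2 hA2).2.2.2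
    refine ((hE x.1 x.2 hA2).approxConst_le_of_blocks le_rfl hl hnear hk.le fun K₀ => ?_).trans_lt
      hcy
    obtain ⟨h3, h4, h5⟩ := hN.periodTwo_block (hE x.1 x.2 hA2) hA2 K₀
    refine ⟨_, ?_, h3, h4.trans hA.le, h5.trans hA.le⟩
    have : K₀ ≤ (x.1 + 4) * K₀ := Nat.le_mul_of_pos_left _ (by omega)
    omega

end NICF

end

theorem theorem4 :
    -- the lower bound
    (∀ (α : ℝ) (R : ℕ), Irrational α → 0 < α → α < 1 / 2 → NICF.liminfQuot α = (R : ℕ∞) →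
      Summable (fun n : ℕ => NICF.gammaTerm α (n + 1)) ∧
      ((NICF.M1 R : ℝ) : EReal) ≤ NICF.approxConst α (NICF.gammaStar α)) ∧
    -- sharpness for every `R ≥ 3`: the periodic examples exist, and any such examples (even
    -- eventually periodic ones) have constants tending to the bound
    (∀ R : ℕ, 3 ≤ R →
      (∀ k : ℕ, ∃ α : ℝ, Irrational α ∧ 0 < α ∧ α < 1 / 2 ∧
        NICF.HasPeriodFrom α (NICF.period R k) 0) ∧
      (∀ α : ℕ → ℝ,
        (∀ k : ℕ, Irrational (α k) ∧ 0 < α k ∧ α k < 1 / 2 ∧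
          ∃ N : ℕ, NICF.HasPeriodFrom (α k) (NICF.period R k) N) →
        Filter.Tendsto (fun k : ℕ => NICF.approxConst (α k) (NICF.gammaStar (α k)))
          Filter.atTop (nhds ((NICF.M1 R : ℝ) : EReal)))) ∧
    -- sharpness for `R = 2`, as `k` and `A` tend to infinity
    ((∀ k A : ℕ, 2 ≤ A → ∃ α : ℝ, Irrational α ∧ 0 < α ∧ α < 1 / 2 ∧
        NICF.HasPeriodFrom α (NICF.periodTwo k A) 0) ∧
      (∀ α : ℕ → ℕ → ℝ,
        (∀ k A : ℕ, 2 ≤ A → Irrational (α k A) ∧ 0 < α k A ∧ α k A < 1 / 2 ∧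
          ∃ N : ℕ, NICF.HasPeriodFrom (α k A) (NICF.periodTwo k A) N) →
        Filter.Tendsto
          (fun x : ℕ × ℕ => NICF.approxConst (α x.1 x.2) (NICF.gammaStar (α x.1 x.2)))
          (Filter.atTop ×ˢ Filter.atTop) (nhds ((NICF.M1 2 : ℝ) : EReal)))) := by
  refine ⟨fun α R hα h0 h1 hR => ?_, fun R hR => ⟨NICF.exists_period hR, fun α => NICF.tendsto_period hR⟩,
    fun k A => NICF.exists_periodTwo k, fun α => NICF.tendsto_periodTwo⟩
  have h : NICF.Expandable α := ⟨hα, h0, h1⟩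
  exact ⟨h.hasSum_gammaTerm.summable, h.M1_le_approxConst hR⟩
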